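/- Graphs are finite, simple and undirected, with vertex set $\{0,\dots,n-1\}$, and every vertex $v$ of a graph $G$ carries a feature $Z(G,v)\in\{0,1\}^*$; $|G|=n$ is the order of $G$. A feature transformation $F$ assigns to every such $G$ and $v\in V(G)$ a bit string $F(G,v)$. Put $\mathrm{mpc}^{(0)}_G(v)=Z(G,v)$, $\mathrm{mpc}^{(t+1)}_G(v)=\bigl(\mathrm{mpc}^{(t)}_G(v),\{\!\{\mathrm{mpc}^{(t)}_G(w): w\in N_G(v)\}\!\}\bigr)$, and $\mathrm{mpc}_G(v)=\mathrm{mpc}^{(2|G|)}_G(v)$. $F$ is mp-invariant if $F(G,v)=F(H,w)$ whenever $|G|=|H|$ and $\mathrm{mpc}^{(t)}_G(v)=\mathrm{mpc}^{(t)}_H(w)$ for all $t\ge 1$. For a colour $c$ after $t$ rounds, $D(c)$ is the following levelled dag. Its level $t$ has one node, representing $c$; level $i-1$ has one node for each colour that is an element of a colour represented on level $i$, where the elements of $(d_0,\{\!\{d_1,\dots,d_m\}\!\})$ are $d_0,\dots,d_m$. From the node for $(d_0,M)$ there is an edge labelled $0$ to the node for $d_0$, and for each $d\in M$ an edge to the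 node for $d$ labelled by the multiplicity of $d$ in $M$. Each node on level $0$ is labelled by the bit string that it represents. Algorithms are multi-stack Turing machines; rooted graphs $(G,v)$ (by adjacency matrix, feature list and root) and dags (by leaf labels and, level by level, matrices of edge labels, with respect to an arbitrary numbering of the nodes of each level) are given as strings over a fixed finite alphabet, and an algorithm that is given a dag has to be correct for every numbering. For $T:\mathbb N^2\to\mathbb N$, "in time $T$" means in at most $T(n,k)$ steps for all $n,k$, all $G$ of order $n$ with all features of length at most $k$, and all $v\in V(G)$. **Lemma.** There is a polynomial $p$ such that the following holds. For every $G$ of order $n$ with features of length at most $k$ and every $v\in V(G)$, every string describing $D(\mathrm{mpc}_G(v))$ has length at most $p(n+k)$. Moreover, for every computable feature transformation $F$ (that is, some algorithm computes $F(G,v)$ from $(G,v)$): 1. $F$ is mp-invariant if and only if there is an algorithm that, given $D(\mathrm{mpc}_G(v))$, computes $F(G,v)$, for all $G$ and $v\in V(G)$. 2. If $F$ is mp-invariant and computable from $(G,v)$ in time $T(n,k)$, then there is an algorithm that, given $D(\mathrm{mpc}_G(v))$, computes $F(G,v)$ in time $T(n,k)+p(n+k)$. 3. Conversely, if some algorithm,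 given $D(\mathrm{mpc}_G(v))$, computes $F(G,v)$ in time $T(n,k)$, then $F$ is computable from $(G,v)$ in time $T(n,k)+p(n+k)$. -/

import Mathlib

namespace MsgPass

/-! ### Featured graphs and message-passing colours -/

/-- A finite simple undirected graph with vertex set `{0, …, order - 1}`, each vertex carrying a
finite bit string as its feature. -/
structure FeaturedGraph where
  order : ℕ
  graph : SimpleGraph (Fin order)
  feature : Fin order → List Bool

/-- A feature transformation maps a featured graph `G` to a new feature map on the vertices
of `G`. -/
abbrev FeatureTransformation : Type :=
  (G : FeaturedGraph) → Fin G.order → List Bool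

/-- The type of colours after `t` rounds: bit strings for `t = 0`, and pairs of a colour after
`t` rounds and a finite multiset of such colours for `t + 1`. -/
def Color : ℕ → Type
  | 0 => List Bool
  | t + 1 => Color t × Multiset (Color t)

/-- The first component `d₀` of a colour `(d₀, {{d₁, …, dₖ}})`. -/
def Color.prev {t : ℕ} (c : Color (t + 1)) : Color t := Prod.fst c

/-- The multiset `{{d₁, …, dₖ}}` of a colour `(d₀, {{d₁, …, dₖ}})`. -/
def Color.nbrs {t : ℕ} (c : Color (t + 1)) : Multiset (Color t) := Prod.snd c

open Classical in
/-- The message-passing colour of a vertex after `t` rounds. -/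
noncomputable def mpc (G : FeaturedGraph) : (t : ℕ) → Fin G.order → Color t
  | 0, v => G.feature v
  | t + 1, v => (mpc G t v, (Finset.univ.filter (G.graph.Adj v)).val.map (mpc G t))

/-- The final colour: the colour after `2|G|` rounds. -/
noncomputable def finalColor (G : FeaturedGraph) (v : Fin G.order) : Color (2 * G.order) :=
  mpc G (2 * G.order) v

/-- Message-passing invariance of a feature transformation. -/
def MPInvariant (F : FeatureTransformation) : Prop :=
  ∀ (G H : FeaturedGraph) (v : Fin G.order) (w : Fin H.order), G.order = H.order →
    (∀ t : ℕ, 1 ≤ t → mpc G t v = mpc H t w) → F G v = F H w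

/-! ### The dag of a colour -/

/-- A directed acyclic graph with levels `0, …, height`, whose edges go from some level `i + 1` to
level `i` and are labelled by natural numbers, and whose nodes on level `0` are labelled by bit
strings. Parallel edges with distinct labels are allowed: `edgeLabels i x y` is the set of the
labels of all edges from `x` to `y`. -/
structure LevelDag where
  height : ℕ
  /-- `Node i` is the set of nodes on level `i`. -/
  Node : ℕ → Type
  isEmpty_above : ∀ i, height < i → IsEmpty (Node i)
  edgeLabels : (i : ℕ) → Node (i + 1) → Node i → Finset ℕ
  leafLabel : Node 0 → List Bool

/-- `Occurs c i d`: the colour `d` belongs to the set `C_i` of colours represented on level `i` of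
the dag of `c`. The only colour on the top level `t` is `c`, and `C_i` consists of all elements of
colours in `C_{i+1}`, where the elements of `(d₀, {{d₁, …, dₖ}})` are `d₀, d₁, …, dₖ`. -/
inductive Occurs {t : ℕ} (c : Color t) : (i : ℕ) → Color i → Prop
  | top : Occurs c t c
  | prev {i : ℕ} {d : Color (i + 1)} : Occurs c (i + 1) d → Occurs c i d.prev
  | nbr {i : ℕ} {d : Color (i + 1)} {e : Color i} :
      Occurs c (i + 1) d → e ∈ d.nbrs → Occurs c i e

theorem Occurs.le {t : ℕ} {c : Color t} {i : ℕ} {d : Color i} (h : Occurs c i d) : i ≤ t := by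
  induction h with
  | top => exact le_rfl
  | prev _ ih => exact (Nat.le_succ _).trans ih
  | nbr _ _ ih => exact (Nat.le_succ _).trans ih

open Classical in
/-- The dag `D(c)` of a colour `c`. From a node representing `(d₀, M)` there is an edge labelled
`0` to the node representing `d₀`, and for every `e ∈ M` an edge to the node representing `e` that
is labelled by the multiplicity of `e` in `M`. -/
noncomputable def colorDag {t : ℕ} (c : Color t) : LevelDag where
  height := t
  Node i := {d : Color i // Occurs c i d}
  isEmpty_above _ hi := ⟨fun d => absurd d.2.le (Nat.not_le.mpr hi)⟩
  edgeLabels _ x y :=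
    (if y.1 = x.1.prev then {0} else ∅) ∪
      (if y.1 ∈ x.1.nbrs then {x.1.nbrs.count y.1} else ∅)
  leafLabel x := x.1

/-! ### Encoding graphs and dags as strings -/

/-- The input alphabet: two bits and two parentheses. -/
inductive Sym : Type
  | zero
  | one
  | lpar
  | rpar
  deriving DecidableEq

instance : Fintype Sym where
  elems := {Sym.zero, Sym.one, Sym.lpar, Sym.rpar}
  complete x := by cases x <;> simp

def paren (s : List Sym) : List Sym := Sym.lpar :: (s ++ [Sym.rpar])

def encodeBits (b : List Bool) : List Sym := paren (b.map fun x => cond x Sym.one Sym.zero)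

/-- Numbers are written in unary. -/
def encodeNat (n : ℕ) : List Sym := paren (List.replicate n Sym.one)

def encodeList (l : List (List Sym)) : List Sym := paren l.flatten

open Classical in
/-- The string for a rooted featured graph: the root (as the bit string of its indicator function),
the list of features, and the rows of the adjacency matrix. -/
noncomputable def encodeRooted (G : FeaturedGraph) (v : Fin G.order) : List Sym :=
  encodeList
    [ encodeBits (List.ofFn fun u => decide (u = v)),
      encodeList (List.ofFn fun u => encodeBits (G.feature u)),
      encodeList (List.ofFn fun u =>
        encodeBits (List.ofFn fun w => decide (G.graph.Adj u w))) ]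

/-- A numbering of the nodes of a dag, level by level. To hand a dag to a machine its nodes have to
be numbered, in an arbitrary way. -/
structure Numbering (D : LevelDag) where
  width : ℕ → ℕ
  num : (i : ℕ) → D.Node i ≃ Fin (width i)

/-- The string for a dag with numbered nodes: the list of the leaf labels, and the list that
contains, for `i = 0, …, height - 1`, the matrix of the (sorted) label lists of the edges from the
nodes on level `i + 1` (rows) to the nodes on level `i` (columns). -/
def encodeDag (D : LevelDag) (N : Numbering D) : List Sym :=
  encodeList
    [ encodeList (List.ofFn fun q => encodeBits (D.leafLabel ((N.num 0).symm q))),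
      encodeList ((List.range D.height).map fun i =>
        encodeList (List.ofFn fun p => encodeList (List.ofFn fun q =>
          encodeList (((D.edgeLabels i ((N.num (i + 1)).symm p) ((N.num i).symm q)).sort
            (· ≤ ·)).map encodeNat)))) ]

/-! ### Computation by Turing machines

Algorithms are (multi-stack) Turing machines in the sense of `Turing.FinTM2`, with input alphabet
`Sym` and output alphabet `Bool`. -/

/-- On input `s` the machine `M` halts with output `y`. -/
def Outputs (M : Turing.TM2ComputableAux Sym Bool) (s : List Sym) (y : List Bool) : Prop :=
  Nonempty (Turing.TM2Outputs M.tm (s.map M.inputAlphabet.symm)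
    (some (y.map M.outputAlphabet.symm)))

/-- On input `s` the machine `M` halts with output `y` after at most `m` steps. -/
def OutputsInTime (M : Turing.TM2ComputableAux Sym Bool) (s : List Sym) (y : List Bool) (m : ℕ) :
    Prop :=
  Nonempty (Turing.TM2OutputsInTime M.tm (s.map M.inputAlphabet.symm)
    (some (y.map M.outputAlphabet.symm)) m)

/-- All features of `G` have length at most `k`. -/
def FeatureBound (G : FeaturedGraph) (k : ℕ) : Prop :=
  ∀ u, (G.feature u).length ≤ k

/-- `F` is computable: some machine computes `F(G, v)` from `(G, v)`. -/
def IsComputable (F : FeatureTransformation) : Prop :=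
  ∃ M : Turing.TM2ComputableAux Sym Bool, ∀ (G : FeaturedGraph) (v : Fin G.order),
    Outputs M (encodeRooted G v) (F G v)

/-- `F` is computable in time `T`: some machine computes `F(G, v)` from `(G, v)` in at most
`T n k` steps, for all `G` of order `n` with features of length at most `k`. -/
def ComputableInTime (F : FeatureTransformation) (T : ℕ → ℕ → ℕ) : Prop :=
  ∃ M : Turing.TM2ComputableAux Sym Bool, ∀ (G : FeaturedGraph) (v : Fin G.order) (k : ℕ),
    FeatureBound G k → OutputsInTime M (encodeRooted G v) (F G v) (T G.order k)

/-- Some machine computes `F(G, v)` from the dag of the final colour of `v`, however the nodes of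
the dag are numbered. -/
def ComputableFromDag (F : FeatureTransformation) : Prop :=
  ∃ M : Turing.TM2ComputableAux Sym Bool, ∀ (G : FeaturedGraph) (v : Fin G.order)
    (N : Numbering (colorDag (finalColor G v))),
    Outputs M (encodeDag (colorDag (finalColor G v)) N) (F G v)

/-- Some machine computes `F(G, v)` from the dag of the final colour of `v` in at most `T n k`
steps, for all `G` of order `n` with features of length at most `k`. -/
def ComputableFromDagInTime (F : FeatureTransformation) (T : ℕ → ℕ → ℕ) : Prop :=
  ∃ M : Turing.TM2ComputableAux Sym Bool, ∀ (G : FeaturedGraph) (v : Fin G.order)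
    (N : Numbering (colorDag (finalColor G v))) (k : ℕ),
    FeatureBound G k →
      OutputsInTime M (encodeDag (colorDag (finalColor G v)) N) (F G v) (T G.order k)

end MsgPass

/-!
From a rooted graph the dag is obtained by colour refinement. For the converse, colours stabilise
after `n - 1` rounds, and level `n + 1` of the dag of a colour after `2n` rounds shows, for every
vertex within distance `n - 1` of the root, its stable class and the number of its neighbours in
each class, that is, the degree matrix of an equitable partition of the component of the root. Any
positive class sizes that satisfy the obvious counting and parity conditions and sum up to at most
`n` are realised by regular graphs inside the classes and biregular bipartite graphs between them;
padded with isolated vertices, this is a graph of order `n` with a vertex that has all colours in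
common with the root. An mp-invariant transformation cannot tell the two apart, so it suffices to
run its algorithm on the reconstructed graph. Minimal class sizes are found greedily.

Both translations are computed in polynomial time by programs on four stacks, which manipulate
binary trees in Polish notation; such a program can be run in front of any machine.
-/

namespace MsgPass

/-! ### Stack programs -/

/-- Structured programs acting on a family of stacks, indexed by `K`, of symbols from `A`. They are
compiled to Turing machines by `Preprocess.machine`. -/
inductive Cmd (K A : Type) : Type
  | skip : Cmd K A
  | push (k : K) (a : A) : Cmd K A
  | seq (c d : Cmd K A) : Cmd K A
  /-- Pop the stack `k` and continue according to the symbol obtained. -/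
  | case (k : K) (f : Option A → Cmd K A) : Cmd K A
  /-- Pop the stack `k`; leave the loop if it was empty or the symbol satisfies `leave`, else run
  the body for this symbol and repeat. -/
  | loop (k : K) (leave : A → Bool) (f : A → Cmd K A) : Cmd K A

namespace Cmd

variable {K A : Type}

section Runs

variable [DecidableEq K] {c d : Cmd K A} {k : K} {a : A} {l : List A} {s s' s'' : K → List A}
  {T U : ℕ}

/-- One step of computation: a list of pending programs acts on the stacks. -/
def step : List (Cmd K A) × (K → List A) → List (Cmd K A) × (K → List A)
  | ([], s) => ([], s)
  | (skip :: r, s) => (r, s)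
  | (push k a :: r, s) => (r, Function.update s k (a :: s k))
  | (seq c d :: r, s) => (c :: d :: r, s)
  | (case k f :: r, s) => (f (s k).head? :: r, Function.update s k (s k).tail)
  | (loop k leave f :: r, s) =>
      (match (s k).head? with
        | none => r
        | some a => if leave a then r else f a :: loop k leave f :: r,
        Function.update s k (s k).tail)

/-- The program `c` transforms the stacks `s` into `s'` in at most `T` steps. -/
def Runs (c : Cmd K A) (s s' : K → List A) (T : ℕ) : Prop :=
  ∃ t ≤ T, ∀ r, step^[t] (c :: r, s) = (r, s')

theorem Runs.mono (h : Runs c s s' T) (hT : T ≤ U) : Runs c s s' U :=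
  let ⟨t, ht, h⟩ := h
  ⟨t, ht.trans hT, h⟩

theorem runs_skip (s : K → List A) : Runs skip s s 1 :=
  ⟨1, le_rfl, fun _ => rfl⟩

theorem runs_push (k : K) (a : A) (s : K → List A) :
    Runs (push k a) s (Function.update s k (a :: s k)) 1 :=
  ⟨1, le_rfl, fun _ => rfl⟩

theorem Runs.seq (hc : Runs c s s' T) (hd : Runs d s' s'' U) :
    Runs (seq c d) s s'' (T + U + 1) := by
  obtain ⟨t, ht, hc⟩ := hc
  obtain ⟨u, hu, hd⟩ := hd
  refine ⟨u + t + 1, by omega, fun r => ?_⟩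
  rw [Function.iterate_succ_apply, step, Function.iterate_add_apply, hc, hd]

theorem Runs.case {f : Option A → Cmd K A}
    (h : Runs (f (s k).head?) (Function.update s k (s k).tail) s' T) :
    Runs (case k f) s s' (T + 1) := by
  obtain ⟨t, ht, h⟩ := h
  refine ⟨t + 1, by omega, fun r => ?_⟩
  rw [Function.iterate_succ_apply, step, h]

variable {leave : A → Bool} {f : A → Cmd K A}

theorem runs_loop_nil (h : s k = []) : Runs (loop k leave f) s s 1 :=
  ⟨1, le_rfl, fun r => by simp [step, h]⟩

theorem runs_loop_leave (h : s k = a :: l) (ha : leave a = true) :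
    Runs (loop k leave f) s (Function.update s k l) 1 :=
  ⟨1, le_rfl, fun r => by simp [step, h, ha]⟩

theorem Runs.loop (h : s k = a :: l) (ha : leave a = false)
    (hf : Runs (f a) (Function.update s k l) s' T) (hl : Runs (loop k leave f) s' s'' U) :
    Runs (loop k leave f) s s'' (T + U + 1) := by
  obtain ⟨t, ht, hf⟩ := hf
  obtain ⟨u, hu, hl⟩ := hl
  refine ⟨u + t + 1, by omega, fun r => ?_⟩
  rw [Function.iterate_succ_apply, step, Function.iterate_add_apply]
  simp only [h, List.head?_cons, ha, Bool.false_eq_true, if_false, List.tail_cons, hf, hl]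

theorem length_step_le (q : List (Cmd K A) × (K → List A)) (k : K) :
    ((step q).2 k).length ≤ (q.2 k).length + 1 := by
  have length_tail_le (k' : K) (s : K → List A) :
      (Function.update s k' (s k').tail k).length ≤ (s k).length + 1 := by
    rcases eq_or_ne k k' with rfl | h
    · rw [Function.update_self, List.length_tail]
      omega
    · rw [Function.update_of_ne h]
      omega
  match q with
  | ([], s) => exact Nat.le_succ _
  | (skip :: _, s) => exact Nat.le_succ _
  | (.seq _ _ :: _, s) => exact Nat.le_succ _
  | (.case k' _ :: _, s) => exact length_tail_le k' s
  | (.loop k' _ _ :: _, s) => exact length_tail_le k' s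
  | (push k' a :: _, s) =>
    rcases eq_or_ne k k' with rfl | h
    · simp [step]
    · simp [step, h]

theorem Runs.length_le (h : Runs c s s' T) (k : K) : (s' k).length ≤ (s k).length + T := by
  obtain ⟨t, ht, h⟩ := h
  have length_iterate_le (t : ℕ) (q : List (Cmd K A) × (K → List A)) :
      ((step^[t] q).2 k).length ≤ (q.2 k).length + t := by
    induction t with
    | zero => rfl
    | succ t ih =>
      rw [Function.iterate_succ_apply']
      have := length_step_le (step^[t] q) k
      omega
  have : (s' k).length ≤ (s k).length + t := by simpa only [h] using length_iterate_le t ([c], s)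
  omega

end Runs

/-- All lists of pending programs that can arise while `c` is run with `r` pending. They become the
labels of a Turing machine, so there have to be finitely many of them. -/
def pending : Cmd K A → List (Cmd K A) → Set (List (Cmd K A))
  | skip, r => {skip :: r, r}
  | push k a, r => {push k a :: r, r}
  | seq c d, r => {seq c d :: r} ∪ pending c (d :: r) ∪ pending d r
  | case k f, r => {case k f :: r} ∪ ⋃ o, pending (f o) r
  | loop k leave f, r => {loop k leave f :: r, r} ∪ ⋃ a, pending (f a) (loop k leave f :: r)

theorem cons_mem_pending (c : Cmd K A) (r : List (Cmd K A)) : c :: r ∈ pending c r := by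
  cases c <;> simp [pending]

theorem self_mem_pending (c : Cmd K A) (r : List (Cmd K A)) : r ∈ pending c r := by
  induction c generalizing r with
  | seq c d _ ihd => exact Or.inr (ihd r)
  | case k f ih => exact Or.inr (Set.mem_iUnion.2 ⟨none, ih _ _⟩)
  | _ => simp [pending]

theorem finite_pending [Finite A] (c : Cmd K A) (r : List (Cmd K A)) : (pending c r).Finite := by
  induction c generalizing r with
  | seq c d ihc ihd => exact ((Set.finite_singleton _).union (ihc _)).union (ihd _)
  | case k f ih => exact (Set.finite_singleton _).union (Set.finite_iUnion fun o => ih o _)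
  | loop k leave f ih => exact (Set.toFinite _).union (Set.finite_iUnion fun a => ih a _)
  | _ => simp [pending]

theorem step_mem_pending [DecidableEq K] {c : Cmd K A} {r l : List (Cmd K A)} (s : K → List A)
    (hl : l ∈ pending c r) (hr : l ≠ r) : (step (l, s)).1 ∈ pending c r := by
  induction c generalizing r with
  | skip | push =>
    obtain rfl : l = _ := hl.resolve_right hr
    exact Or.inr rfl
  | seq c d ihc ihd =>
    have step_mem_of_mem_snd (h : l ∈ pending d r) : (step (l, s)).1 ∈ pending (seq c d) r :=
      Or.inr (ihd h hr)
    rcases hl with (rfl | h) | h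
    · exact Or.inl (Or.inr (cons_mem_pending _ _))
    · by_cases h' : l = d :: r
      · exact step_mem_of_mem_snd (h' ▸ cons_mem_pending d r)
      · exact Or.inl (Or.inr (ihc h h'))
    · exact step_mem_of_mem_snd h
  | case k f ih =>
    rcases hl with rfl | h
    · exact Or.inr (Set.mem_iUnion.2 ⟨(s k).head?, cons_mem_pending _ _⟩)
    · obtain ⟨o, h⟩ := Set.mem_iUnion.1 h
      exact Or.inr (Set.mem_iUnion.2 ⟨o, ih o h hr⟩)
  | loop k leave f ih =>
    have step_loop_mem :
        (step (loop k leave f :: r, s)).1 ∈ pending (loop k leave f) r := by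
      rw [step]
      cases h : (s k).head? with
      | none => exact Or.inl (Or.inr rfl)
      | some a =>
        dsimp only
        split_ifs with ha
        · exact Or.inl (Or.inr rfl)
        · exact Or.inr (Set.mem_iUnion.2 ⟨a, cons_mem_pending _ _⟩)
    rcases hl with (rfl | h) | h
    · exact step_loop_mem
    · exact absurd h hr
    · obtain ⟨a, h⟩ := Set.mem_iUnion.1 h
      by_cases h' : l = loop k leave f :: r
      · exact h' ▸ step_loop_mem
      · exact Or.inr (Set.mem_iUnion.2 ⟨a, ih a h h'⟩)

end Cmd

/-! ### Preprocessing the input of a machine -/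

section Reaches

open StateTransition

variable {σ τ : Type*} {f : σ → Option σ} {m n : ℕ} {a b c : σ}

/-- Repeated application of the partial function `f` leads from `a` to `b` in at most `m` steps.
This is the proposition underlying Mathlib's `StateTransition.EvalsToInTime`. -/
def ReachesIn (f : σ → Option σ) (m : ℕ) (a b : σ) : Prop :=
  Nonempty (EvalsToInTime f a (some b) m)

namespace ReachesIn

theorem refl (f : σ → Option σ) (a : σ) : ReachesIn f 0 a a :=
  ⟨.refl f a⟩

theorem single (h : f a = some b) : ReachesIn f 1 a b :=
  ⟨⟨⟨1, h⟩, le_rfl⟩⟩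

theorem mono (h : ReachesIn f m a b) (hmn : m ≤ n) : ReachesIn f n a b :=
  h.map fun e => ⟨e.toEvalsTo, e.steps_le_m.trans hmn⟩

theorem trans (hab : ReachesIn f m a b) (hbc : ReachesIn f n b c) : ReachesIn f (n + m) a c :=
  hab.elim fun e => hbc.map fun e' => .trans f m n a b c e e'

theorem map {g : τ → Option τ} {φ : σ → τ} (hφ : ∀ a, g (φ a) = (f a).map φ)
    (h : ReachesIn f m a b) : ReachesIn g m (φ a) (φ b) := by
  have semiconj : Function.Semiconj (Option.map φ) (flip bind f) (flip bind g) := by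
    rintro (_ | a)
    · rfl
    · exact (hφ a).symm
  obtain ⟨⟨⟨t, ht⟩, htm⟩⟩ := h
  refine ⟨⟨⟨t, ?_⟩, htm⟩⟩
  exact ((semiconj.iterate_right t).eq (some a)).symm.trans (congrArg (Option.map φ) ht)

theorem eq_of_halted (hb : f b = none) (hc : f c = none) (hab : ReachesIn f m a b)
    (hac : ReachesIn f n a c) : b = c := by
  have eq_of_le {s t : ℕ} {b c : σ} (hb : f b = none) (hst : s ≤ t)
      (hs : (flip bind f)^[s] (some a) = some b) (ht : (flip bind f)^[t] (some a) = some c) :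
      b = c := by
    obtain ⟨r, rfl⟩ := Nat.exists_eq_add_of_le' hst
    rw [Function.iterate_add_apply, hs] at ht
    cases r with
    | zero => exact Option.some_injective _ ht
    | succ r =>
      rw [Function.iterate_succ_apply, show flip bind f (some b) = none from hb,
        Function.iterate_fixed rfl] at ht
      cases ht
  obtain ⟨⟨⟨s, hs⟩, -⟩⟩ := hab
  obtain ⟨⟨⟨t, ht⟩, -⟩⟩ := hac
  rcases le_total s t with hst | hst
  · exact eq_of_le hb hst hs ht
  · exact (eq_of_le hc hst ht hs).symm

end ReachesIn

end Reaches

open Turing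

instance : Inhabited Sym := ⟨.zero⟩

section Outputs

variable {M : TM2ComputableAux Sym Bool} {s : List Sym} {y y' : List Bool} {m m' : ℕ}

theorem outputsInTime_iff_reachesIn : OutputsInTime M s y m ↔ ReachesIn M.tm.step m
    (initList M.tm (s.map M.inputAlphabet.symm)) (haltList M.tm (y.map M.outputAlphabet.symm)) :=
  Iff.rfl

theorem outputs_iff_exists_outputsInTime : Outputs M s y ↔ ∃ m, OutputsInTime M s y m :=
  ⟨fun ⟨h⟩ => ⟨h.steps, ⟨⟨h, le_rfl⟩⟩⟩, fun ⟨_, ⟨h⟩⟩ => ⟨h.toEvalsTo⟩⟩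

theorem OutputsInTime.mono (h : OutputsInTime M s y m) (hm : m ≤ m') : OutputsInTime M s y m' :=
  ReachesIn.mono h hm

theorem initList_eq_update (tm : FinTM2) (s : List (tm.Γ tm.k₀)) : initList tm s =
    ⟨some tm.main, tm.initialState, Function.update (fun _ => []) tm.k₀ s⟩ := by
  refine congrArg (TM2.Cfg.mk _ _) (funext fun k => ?_)
  by_cases hk : k = tm.k₀
  · subst hk; simp
  · simp [hk]

theorem haltList_eq_update (tm : FinTM2) (s : List (tm.Γ tm.k₁)) : haltList tm s =
    ⟨none, tm.initialState, Function.update (fun _ => []) tm.k₁ s⟩ := by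
  refine congrArg (TM2.Cfg.mk _ _) (funext fun k => ?_)
  by_cases hk : k = tm.k₁
  · subst hk; simp
  · simp [hk]

theorem haltList_injective (tm : FinTM2) : Function.Injective (haltList tm) := by
  intro y y' h
  rw [haltList_eq_update, haltList_eq_update] at h
  simpa using congrFun (congrArg TM2.Cfg.stk h) tm.k₁

theorem Outputs.unique (h : Outputs M s y) (h' : Outputs M s y') : y = y' := by
  obtain ⟨m, h⟩ := outputs_iff_exists_outputsInTime.1 h
  obtain ⟨m', h'⟩ := outputs_iff_exists_outputsInTime.1 h'
  exact List.map_injective_iff.2 M.outputAlphabet.symm.injective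
    (haltList_injective M.tm (ReachesIn.eq_of_halted rfl rfl h h'))

end Outputs

namespace Preprocess

variable {K A B : Type} (c : Cmd K A) (i j : K) (M : TM2ComputableAux A B)

/-- The labels of the machine that first runs `c` and then `M`: the lists of pending programs of `c`
and the labels of `M`. -/
abbrev Label : Type := c.pending [] ⊕ M.tm.Λ

/-- The stack alphabets of the machine that first runs `c` and then `M`. -/
abbrev Alphabet : K ⊕ M.tm.K → Type
  | .inl _ => A
  | .inr k => M.tm.Γ k

/-- The statements of the machine that first runs `c` and then `M`. Its states are those of `M`,
together with the symbol that was just popped from a stack of `c`. -/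
abbrev Stmt : Type := TM2.Stmt (Alphabet (K := K) M) (Label c M) (Option A × M.tm.σ)

/-- The configurations of the machine that first runs `c` and then `M`. -/
abbrev Cfg : Type := TM2.Cfg (Alphabet (K := K) M) (Label c M) (Option A × M.tm.σ)

open Classical in
/-- The label for a list of pending programs. For a list that does not arise while `c` is run, it is
the label with which `M` starts. -/
noncomputable def label (l : List (Cmd K A)) : Label c M :=
  if h : l ∈ c.pending [] then .inl ⟨l, h⟩ else .inr M.tm.main

/-- The statements of `M`, as statements of the combined machine. -/
def liftStmt : TM2.Stmt M.tm.Γ M.tm.Λ M.tm.σ → Stmt c M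
  | .push k f q => .push (.inr k) (fun v => f v.2) (liftStmt q)
  | .peek k f q => .peek (.inr k) (fun v o => (none, f v.2 o)) (liftStmt q)
  | .pop k f q => .pop (.inr k) (fun v o => (none, f v.2 o)) (liftStmt q)
  | .load f q => .load (fun v => (none, f v.2)) (liftStmt q)
  | .branch f q₁ q₂ => .branch (fun v => f v.2) (liftStmt q₁) (liftStmt q₂)
  | .goto f => .goto fun v => .inr (f v.2)
  | .halt => .halt

/-- The statement that performs the next step of a list of pending programs. When no program is
left, the stack `j` is moved, symbol by symbol, to the input stack of `M`. -/
noncomputable def pendingStmt [Inhabited A] : List (Cmd K A) → Stmt c M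
  | [] => .pop (.inl j) (fun v o => (o, v.2)) <|
      .branch (fun v => v.1.isSome)
        (.push (.inr M.tm.k₀) (fun v => M.inputAlphabet.symm (v.1.getD default)) <|
          .load (fun v => (none, v.2)) <| .goto fun _ => label c M [])
        (.goto fun _ => .inr M.tm.main)
  | .skip :: r => .goto fun _ => label c M r
  | .push k a :: r => .push (.inl k) (fun _ => a) <| .goto fun _ => label c M r
  | .seq d e :: r => .goto fun _ => label c M (d :: e :: r)
  | .case k f :: r =>
      .pop (.inl k) (fun v o => (o, v.2)) <| .goto fun v => label c M (f v.1 :: r)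
  | .loop k leave f :: r =>
      .pop (.inl k) (fun v o => (o, v.2)) <| .goto fun v => label c M <|
        match v.1 with
        | none => r
        | some a => if leave a then r else f a :: .loop k leave f :: r

/-- The program of the machine that first runs `c` and then `M`. -/
noncomputable def program [Inhabited A] : Label c M → Stmt c M
  | .inl l => pendingStmt c j M l.1
  | .inr l => liftStmt c M (M.tm.m l)

/-- The stacks of the combined machine, given those of `c` and those of `M`. -/
def joinStacks (s : K → List A) (S : ∀ k, List (M.tm.Γ k)) : ∀ k, List (Alphabet (K := K) M k)
  | .inl k => s k
  | .inr k => S k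

/-- The machine that first runs `c`, with its input on stack `i`, and then runs `M` on the reversal
of stack `j`. -/
noncomputable def machine [DecidableEq K] [Fintype K] [Fintype A] [Inhabited A] :
    TM2ComputableAux A B where
  tm :=
    { K := K ⊕ M.tm.K
      kDecidableEq := inferInstance
      kFin := @instFintypeSum _ _ _ M.tm.kFin
      k₀ := .inl i
      k₁ := .inr M.tm.k₁
      Γ := Alphabet M
      Λ := Label c M
      main := .inl ⟨[c], c.cons_mem_pending []⟩
      ΛFin := @instFintypeSum _ _ (c.finite_pending []).fintype M.tm.ΛFin
      σ := Option A × M.tm.σ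
      initialState := (none, M.tm.initialState)
      σFin := @instFintypeProd _ _ inferInstance M.tm.σFin
      Γk₀Fin := inferInstanceAs (Fintype A)
      m := program c j M }
  inputAlphabet := Equiv.refl A
  outputAlphabet := M.outputAlphabet

/-- The configuration of the combined machine while the programs in `l` are pending. -/
noncomputable def pendingCfg (l : List (Cmd K A)) (o : Option A) (s : K → List A)
    (S : ∀ k, List (M.tm.Γ k)) : Cfg c M where
  l := some (label c M l)
  var := (o, M.tm.initialState)
  stk := joinStacks M s S

/-- The configuration of the combined machine while `M` is running. -/
def liftCfg (C : TM2.Cfg M.tm.Γ M.tm.Λ M.tm.σ) : Cfg c M where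
  l := C.l.map .inr
  var := (none, C.var)
  stk := joinStacks M (fun _ => []) C.stk

section Stacks

variable {M}

variable (M) in
theorem joinStacks_nil : joinStacks M (fun _ : K => []) (fun _ => []) = fun _ => [] := by
  funext k
  cases k <;> rfl

variable (s : K → List A) (S : ∀ k, List (M.tm.Γ k))

@[simp]
theorem joinStacks_inl (k : K) : joinStacks M s S (.inl k) = s k := rfl

@[simp]
theorem joinStacks_inr (k : M.tm.K) : joinStacks M s S (.inr k) = S k := rfl

@[simp]
theorem update_joinStacks_inl [DecidableEq K] (k : K) (a : List A) :
    Function.update (joinStacks M s S) (.inl k) a = joinStacks M (Function.update s k a) S := by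
  funext k'
  rcases k' with k' | k'
  · by_cases h : k' = k
    · subst h; simp
    · simp [h]
  · simp

@[simp]
theorem update_joinStacks_inr [DecidableEq K] (k : M.tm.K) (a : List (M.tm.Γ k)) :
    Function.update (joinStacks M s S) (.inr k) a = joinStacks M s (Function.update S k a) := by
  funext k'
  rcases k' with k' | k'
  · simp
  · by_cases h : k' = k
    · subst h; simp
    · simp [h]

end Stacks

variable {c} in
theorem label_of_mem {l : List (Cmd K A)} (h : l ∈ c.pending []) : label c M l = .inl ⟨l, h⟩ :=
  dif_pos h

variable [DecidableEq K]

theorem stepAux_liftStmt (q : TM2.Stmt M.tm.Γ M.tm.Λ M.tm.σ) (v : M.tm.σ)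
    (S : ∀ k, List (M.tm.Γ k)) :
    TM2.stepAux (liftStmt c M q) (none, v) (joinStacks M (fun _ => []) S) =
      liftCfg c M (TM2.stepAux q v S) := by
  induction q generalizing v S with
  | branch f q₁ q₂ ih₁ ih₂ =>
    simp only [liftStmt, TM2.stepAux]
    cases f v
    · exact ih₂ _ _
    · exact ih₁ _ _
  | goto f => rfl
  | halt => rfl
  | _ => simp [liftStmt, TM2.stepAux, *]

variable [Inhabited A]

theorem step_liftCfg (C : TM2.Cfg M.tm.Γ M.tm.Λ M.tm.σ) :
    TM2.step (program c j M) (liftCfg c M C) = (TM2.step M.tm.m C).map (liftCfg c M) := by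
  obtain ⟨_ | l, v, S⟩ := C
  · rfl
  · exact congrArg some (stepAux_liftStmt c M _ _ _)

variable {c}

theorem exists_step_pendingCfg {l : List (Cmd K A)} (hl : l ∈ c.pending []) (hne : l ≠ [])
    (o : Option A) (s : K → List A) (S : ∀ k, List (M.tm.Γ k)) :
    ∃ o', TM2.step (program c j M) (pendingCfg c M l o s S) =
      some (pendingCfg c M (Cmd.step (l, s)).1 o' (Cmd.step (l, s)).2 S) := by
  simp only [pendingCfg, label_of_mem M hl, TM2.step, program]
  match l, hne with
  | .skip :: r, _ => exact ⟨o, rfl⟩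
  | .push k a :: r, _ => exact ⟨o, by simp [pendingStmt, TM2.stepAux, Cmd.step]⟩
  | .seq d e :: r, _ => exact ⟨o, rfl⟩
  | .case k f :: r, _ => exact ⟨(s k).head?, by simp [pendingStmt, TM2.stepAux, Cmd.step]⟩
  | .loop k leave f :: r, _ =>
    exact ⟨(s k).head?, by
      simp only [pendingStmt, TM2.stepAux, Cmd.step, update_joinStacks_inl, joinStacks_inl]⟩

theorem exists_reachesIn_iterate_step (t : ℕ) {l : List (Cmd K A)} (hl : l ∈ c.pending [])
    (o : Option A) (s : K → List A) (S : ∀ k, List (M.tm.Γ k)) :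
    ∃ o', ReachesIn (TM2.step (program c j M)) t (pendingCfg c M l o s S)
      (pendingCfg c M (Cmd.step^[t] (l, s)).1 o' (Cmd.step^[t] (l, s)).2 S) := by
  induction t generalizing l o s with
  | zero => exact ⟨o, .refl _ _⟩
  | succ t ih =>
    rw [Function.iterate_succ_apply]
    rcases eq_or_ne l [] with rfl | hne
    · obtain ⟨o', h⟩ := ih hl o s
      exact ⟨o', h.mono (Nat.le_succ t)⟩
    · obtain ⟨o₁, first_step⟩ := exists_step_pendingCfg j M hl hne o s S
      obtain ⟨o', h⟩ := ih (Cmd.step_mem_pending s hl hne) o₁ (Cmd.step (l, s)).2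
      exact ⟨o', (ReachesIn.single first_step).trans h⟩

theorem reachesIn_main (w : List A) (o : Option A) (S : ∀ k, List (M.tm.Γ k)) :
    ReachesIn (TM2.step (program c j M)) (w.length + 1)
      (pendingCfg c M [] o (Function.update (fun _ => []) j w) S)
      (liftCfg c M ⟨some M.tm.main, M.tm.initialState, Function.update S M.tm.k₀
        (w.reverse.map M.inputAlphabet.symm ++ S M.tm.k₀)⟩) := by
  have nil_mem := c.self_mem_pending []
  induction w generalizing o S with
  | nil =>
    refine .single ?_
    simp only [TM2.step, pendingCfg, label_of_mem M nil_mem, program, pendingStmt, TM2.stepAux,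
      liftCfg]
    simp
  | cons a w ih =>
    have move_symbol : TM2.step (program c j M)
        (pendingCfg c M [] o (Function.update (fun _ => []) j (a :: w)) S) =
          some (pendingCfg c M [] none (Function.update (fun _ => []) j w)
            (Function.update S M.tm.k₀ (M.inputAlphabet.symm a :: S M.tm.k₀))) := by
      simp only [TM2.step, pendingCfg, label_of_mem M nil_mem, program, pendingStmt, TM2.stepAux]
      simp
    simpa using (ReachesIn.single move_symbol).trans (ih none _)

variable (c) [Fintype K] [Fintype A]

theorem initList_machine (s : List A) :
    initList (machine c i j M).tm (s.map (machine c i j M).inputAlphabet.symm) =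
      pendingCfg c M [c] none (Function.update (fun _ => []) i s) (fun _ => []) := by
  rw [initList_eq_update, pendingCfg, label_of_mem M (c.cons_mem_pending []),
    ← update_joinStacks_inl, joinStacks_nil]
  exact congrArg (fun s => TM2.Cfg.mk _ _ (Function.update _ _ s)) (List.map_id s)

theorem liftCfg_haltList (y : List B) :
    liftCfg c M (haltList M.tm (y.map M.outputAlphabet.symm)) =
      haltList (machine c i j M).tm (y.map (machine c i j M).outputAlphabet.symm) := by
  rw [haltList_eq_update, haltList_eq_update, liftCfg, ← update_joinStacks_inr, joinStacks_nil]
  rfl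

variable {c i j M}

theorem outputsInTime_machine {c : Cmd K Sym} {M : TM2ComputableAux Sym Bool} {s s' : List Sym}
    {T m : ℕ} {y : List Bool} (h : c.Runs (Function.update (fun _ => []) i s)
      (Function.update (fun _ => []) j s'.reverse) T) (hM : OutputsInTime M s' y m) :
    OutputsInTime (machine c i j M) s y (m + (T + s'.length + 1)) := by
  obtain ⟨t, ht, h⟩ := h
  obtain ⟨o, run_c⟩ := exists_reachesIn_iterate_step j M t (c.cons_mem_pending []) none
    (Function.update (fun _ => []) i s) (fun _ => [])
  rw [h [], ← initList_machine c i j] at run_c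
  have run_move := reachesIn_main j M (c := c) s'.reverse o (fun _ => [])
  rw [List.reverse_reverse, List.append_nil, ← initList_eq_update] at run_move
  have run_M := (outputsInTime_iff_reachesIn.1 hM).map (step_liftCfg c j M)
  rw [liftCfg_haltList c i j] at run_M
  refine ReachesIn.mono ((run_c.trans run_move).trans run_M) ?_
  rw [List.length_reverse]
  omega

end Preprocess

/-! ### Binary trees on a stack -/

/-- Binary trees, the universal data type of the programs below. -/
inductive Tree : Type
  | nil : Tree
  | cons (a b : Tree) : Tree

namespace Tree

/-- The Polish form of a tree. -/
def code : Tree → List Sym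
  | nil => [Sym.rpar]
  | cons a b => Sym.lpar :: (a.code ++ b.code)

/-- The length of the Polish form. -/
def size : Tree → ℕ
  | nil => 1
  | cons a b => a.size + b.size + 1

@[simp] theorem length_code (a : Tree) : a.code.length = a.size := by
  induction a with
  | nil => rfl
  | cons a b iha ihb => simp [code, size, iha, ihb]

theorem size_pos (a : Tree) : 0 < a.size := by
  cases a <;> simp [size]

theorem zero_notMem_code (a : Tree) : Sym.zero ∉ a.code := by
  induction a with
  | nil => simp [code]
  | cons a b iha ihb => simp [code, iha, ihb]

end Tree

namespace Cmd

theorem update_vec_zero (a b c d e : List Sym) :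
    Function.update ![a, b, c, d] 0 e = ![e, b, c, d] := by
  funext i; fin_cases i <;> rfl

theorem update_vec_one (a b c d e : List Sym) :
    Function.update ![a, b, c, d] 1 e = ![a, e, c, d] := by
  funext i; fin_cases i <;> rfl

theorem update_vec_two (a b c d e : List Sym) :
    Function.update ![a, b, c, d] 2 e = ![a, b, e, d] := by
  funext i; fin_cases i <;> rfl

theorem update_vec_three (a b c d e : List Sym) :
    Function.update ![a, b, c, d] 3 e = ![a, b, c, e] := by
  funext i; fin_cases i <;> rfl

section Vec

variable {m x y z : List Sym} {s' : Fin 4 → List Sym} {T : ℕ} (a : Sym)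

theorem runs_push_zero : Runs (push 0 a) ![m, x, y, z] ![a :: m, x, y, z] 1 := by
  simpa [update_vec_zero] using runs_push 0 a ![m, x, y, z]

theorem runs_push_one : Runs (push 1 a) ![m, x, y, z] ![m, a :: x, y, z] 1 := by
  simpa [update_vec_one] using runs_push 1 a ![m, x, y, z]

theorem runs_push_two : Runs (push 2 a) ![m, x, y, z] ![m, x, a :: y, z] 1 := by
  simpa [update_vec_two] using runs_push 2 a ![m, x, y, z]

theorem runs_push_three : Runs (push 3 a) ![m, x, y, z] ![m, x, y, a :: z] 1 := by
  simpa [update_vec_three] using runs_push 3 a ![m, x, y, z]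

variable {a}

theorem Runs.case_zero {f : Option Sym → Cmd (Fin 4) Sym}
    (h : Runs (f (some a)) ![m, x, y, z] s' T) :
    Runs (Cmd.case 0 f) ![a :: m, x, y, z] s' (T + 1) :=
  Runs.case (s := ![a :: m, x, y, z]) (k := 0) (by simpa [update_vec_zero] using h)

variable {leave : Sym → Bool} {f : Sym → Cmd (Fin 4) Sym}

theorem runs_loop_leave_zero (ha : leave a = true) :
    Runs (loop 0 leave f) ![a :: m, x, y, z] ![m, x, y, z] 1 := by
  simpa [update_vec_zero] using runs_loop_leave (k := 0) (s := ![a :: m, x, y, z]) (f := f) rfl ha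

theorem runs_loop_leave_one (ha : leave a = true) :
    Runs (loop 1 leave f) ![m, a :: x, y, z] ![m, x, y, z] 1 := by
  simpa [update_vec_one] using runs_loop_leave (k := 1) (s := ![m, a :: x, y, z]) (f := f) rfl ha

theorem runs_loop_leave_three (ha : leave a = true) :
    Runs (loop 3 leave f) ![m, x, y, a :: z] ![m, x, y, z] 1 := by
  simpa [update_vec_three] using
    runs_loop_leave (k := 3) (s := ![m, x, y, a :: z]) (f := f) rfl ha

theorem Runs.loop_zero {s'' : Fin 4 → List Sym} {U : ℕ} (ha : leave a = false)
    (hf : Runs (f a) ![m, x, y, z] s' T) (hl : Runs (Cmd.loop 0 leave f) s' s'' U) :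
    Runs (Cmd.loop 0 leave f) ![a :: m, x, y, z] s'' (T + U + 1) :=
  Runs.loop (k := 0) (s := ![a :: m, x, y, z]) rfl ha (by simpa [update_vec_zero] using hf) hl

theorem Runs.loop_one {s'' : Fin 4 → List Sym} {U : ℕ} (ha : leave a = false)
    (hf : Runs (f a) ![m, x, y, z] s' T) (hl : Runs (Cmd.loop 1 leave f) s' s'' U) :
    Runs (Cmd.loop 1 leave f) ![m, a :: x, y, z] s'' (T + U + 1) :=
  Runs.loop (k := 1) (s := ![m, a :: x, y, z]) rfl ha (by simpa [update_vec_one] using hf) hl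

theorem Runs.loop_three {s'' : Fin 4 → List Sym} {U : ℕ} (ha : leave a = false)
    (hf : Runs (f a) ![m, x, y, z] s' T) (hl : Runs (Cmd.loop 3 leave f) s' s'' U) :
    Runs (Cmd.loop 3 leave f) ![m, x, y, a :: z] s'' (T + U + 1) :=
  Runs.loop (k := 3) (s := ![m, x, y, a :: z]) rfl ha (by simpa [update_vec_three] using hf) hl

end Vec

/-- Pop the symbols above the topmost `zero` of stack `i`, and this `zero`, running `f` for each of
the former. -/
abbrev transfer (i : Fin 4) (f : Sym → Cmd (Fin 4) Sym) : Cmd (Fin 4) Sym :=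
  loop i (fun a => decide (a = Sym.zero)) f

theorem runs_transfer {i j : Fin 4} (hij : i ≠ j) {w r : List Sym} (hw : Sym.zero ∉ w)
    (s : Fin 4 → List Sym) (hs : s i = w ++ Sym.zero :: r) :
    Runs (transfer i (push j)) s
      (Function.update (Function.update s i r) j (w.reverse ++ s j)) (2 * w.length + 1) := by
  induction w generalizing s with
  | nil =>
    have eq_update : Function.update (Function.update s i r) j ([].reverse ++ s j) =
        Function.update s i r :=
      Function.update_eq_self_iff.2 (by simp [hij.symm])
    rw [eq_update]
    exact runs_loop_leave hs rfl
  | cons a w ih =>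
    rw [List.mem_cons, not_or] at hw
    have push_symbol := runs_push j a (Function.update s i (w ++ Sym.zero :: r))
    have push_rest := ih hw.2 _ (show Function.update (Function.update s i (w ++ Sym.zero :: r)) j
      (a :: Function.update s i (w ++ Sym.zero :: r) j) i = _ by simp [hij])
    have h := Runs.loop hs (leave := fun a => decide (a = Sym.zero))
      (by simpa using Ne.symm hw.1) push_symbol push_rest
    convert h.mono (U := 2 * (a :: w).length + 1) (by rw [List.length_cons]; omega) using 1
    simp [Function.update_comm hij.symm, hij.symm]

section Vec

variable {w m x y z : List Sym}

theorem runs_transfer_one_two (hw : Sym.zero ∉ w) :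
    Runs (transfer 1 (push 2)) ![m, w ++ Sym.zero :: x, y, z]
      ![m, x, w.reverse ++ y, z] (2 * w.length + 1) := by
  simpa [update_vec_one, update_vec_two] using
    runs_transfer (i := 1) (j := 2) (r := x) (by decide) hw ![m, w ++ Sym.zero :: x, y, z] rfl

theorem runs_transfer_two_one (hw : Sym.zero ∉ w) :
    Runs (transfer 2 (push 1)) ![m, x, w ++ Sym.zero :: y, z]
    ![m, w.reverse ++ x, y, z] (2 * w.length + 1) := by
  simpa [update_vec_one, update_vec_two] using
    runs_transfer (i := 2) (j := 1) (r := y) (by decide) hw ![m, x, w ++ Sym.zero :: y, z] rfl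

theorem runs_transfer_one_zero (hw : Sym.zero ∉ w) :
    Runs (transfer 1 (push 0)) ![m, w ++ Sym.zero :: x, y, z]
    ![w.reverse ++ m, x, y, z] (2 * w.length + 1) := by
  simpa [update_vec_one, update_vec_zero] using
    runs_transfer (i := 1) (j := 0) (r := x) (by decide) hw ![m, w ++ Sym.zero :: x, y, z] rfl

theorem runs_discard (hw : Sym.zero ∉ w) :
    Runs (transfer 1 fun _ => skip) ![m, w ++ Sym.zero :: x, y, z]
    ![m, x, y, z] (2 * w.length + 1) := by
  induction w with
  | nil => exact runs_loop_leave_one rfl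
  | cons a w ih =>
    simp only [List.mem_cons, not_or] at hw
    have : Runs (transfer 1 fun _ => skip) ![m, a :: w ++ Sym.zero :: x, y, z] _ _ :=
      Runs.loop_one (by simp [Ne.symm hw.1]) (runs_skip _) (ih hw.2)
    exact this.mono (by simp; omega)

theorem runs_transfer_one_zero_two (hw : Sym.zero ∉ w) :
    Runs (transfer 1 fun a => seq (push 0 a) (push 2 a)) ![m, w ++ Sym.zero :: x, y, z]
      ![w.reverse ++ m, x, w.reverse ++ y, z] (4 * w.length + 1) := by
  induction w generalizing m y with
  | nil => exact runs_loop_leave_one rfl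
  | cons a w ih =>
    simp only [List.mem_cons, not_or] at hw
    have : Runs (transfer 1 fun a => seq (push 0 a) (push 2 a))
        ![m, a :: w ++ Sym.zero :: x, y, z] _ _ :=
      Runs.loop_one (by simp [Ne.symm hw.1]) ((runs_push_zero a).seq (runs_push_two a)) (ih hw.2)
    simpa using this.mono (U := 4 * (a :: w).length + 1) (by simp; omega)

end Vec

/-- The body of the loop in `moveTree`: read one symbol of a tree. -/
def moveTreeBody : Cmd (Fin 4) Sym :=
  case 0 fun
    | some Sym.lpar => seq (push 1 Sym.lpar) (seq (push 3 Sym.one) (push 3 Sym.one))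
    | some Sym.rpar => push 1 Sym.rpar
    | _ => skip

/-- Move the topmost tree of stack `0`, reversed and with a separator below it, to stack `1`. The
symbols `one` on top of stack `3` count the subtrees that are still to be read. -/
def moveTree : Cmd (Fin 4) Sym :=
  seq (push 1 Sym.zero) <| seq (push 3 Sym.zero) <| seq (push 3 Sym.one) <|
    loop 3 (fun a => decide (a ≠ Sym.one)) fun _ => moveTreeBody

variable {m x y z : List Sym}

theorem runs_moveTree_loop {s' : Fin 4 → List Sym} {T : ℕ} (v : Tree)
    (h : Runs (loop 3 (fun a => decide (a ≠ Sym.one)) fun _ => moveTreeBody)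
      ![m, v.code.reverse ++ x, y, z] s' T) :
    Runs (loop 3 (fun a => decide (a ≠ Sym.one)) fun _ => moveTreeBody)
      ![v.code ++ m, x, y, Sym.one :: z] s' (T + 7 * v.size) := by
  induction v generalizing m x z T with
  | nil =>
    have read_rpar : Runs moveTreeBody ![Sym.rpar :: m, x, y, z] ![m, Sym.rpar :: x, y, z] 2 :=
      Runs.case_zero (runs_push_one _)
    exact (Runs.loop_three rfl read_rpar h).mono (by simp only [Tree.size]; omega)
  | cons a b iha ihb =>
    have read_lpar : Runs moveTreeBody ![Sym.lpar :: (a.code ++ (b.code ++ m)), x, y, z]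
        ![a.code ++ (b.code ++ m), Sym.lpar :: x, y, Sym.one :: Sym.one :: z] 6 :=
      Runs.case_zero ((runs_push_one _).seq ((runs_push_three _).seq (runs_push_three _)))
    rw [Tree.code, List.cons_append, List.append_assoc]
    refine (Runs.loop_three rfl read_lpar (iha (ihb (T := T) ?_))).mono
      (by simp only [Tree.size]; omega)
    simpa only [Tree.code, List.reverse_cons, List.reverse_append, List.append_assoc,
      List.singleton_append] using h

theorem runs_moveTree (v : Tree) : Runs moveTree ![v.code ++ m, x, y, z]
    ![m, v.code.reverse ++ Sym.zero :: x, y, z] (7 * v.size + 7) :=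
  ((runs_push_one _).seq <| (runs_push_three _).seq <| (runs_push_three _).seq <|
    runs_moveTree_loop v (T := 1) (runs_loop_leave_three rfl)).mono (by omega)

theorem zero_notMem_reverse_code (v : Tree) : Sym.zero ∉ v.code.reverse := by
  simpa using v.zero_notMem_code

/-- Delete the topmost tree of stack `0`. -/
def dropTree : Cmd (Fin 4) Sym := seq moveTree (transfer 1 fun _ => skip)

theorem runs_dropTree (v : Tree) :
    Runs dropTree ![v.code ++ m, x, y, z] ![m, x, y, z] (9 * v.size + 9) :=
  ((runs_moveTree v).seq (runs_discard (zero_notMem_reverse_code v))).mono (by simp; omega)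

/-- Duplicate the topmost tree of stack `0`. -/
def dupTree : Cmd (Fin 4) Sym :=
  seq moveTree <| seq (push 2 Sym.zero) <| seq (transfer 1 fun a => seq (push 0 a) (push 2 a)) <|
    seq (push 1 Sym.zero) <| seq (transfer 2 (push 1)) (transfer 1 (push 0))

theorem runs_dupTree (v : Tree) : Runs dupTree ![v.code ++ m, x, y, z]
    ![v.code ++ (v.code ++ m), x, y, z] (15 * v.size + 17) := by
  have h : Runs dupTree _ _ _ :=
    (runs_moveTree (m := m) (x := x) (y := y) (z := z) v).seq <| (runs_push_two _).seq <|
    (runs_transfer_one_zero_two (zero_notMem_reverse_code v)).seq <| (runs_push_one Sym.zero).seq <|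
    (runs_transfer_two_one (by simpa using v.zero_notMem_code)).seq
    (runs_transfer_one_zero (by simpa using v.zero_notMem_code))
  simpa using h.mono (U := 15 * v.size + 17) (by simp; omega)

/-- Exchange the two topmost trees of stack `0`. -/
def swapTree : Cmd (Fin 4) Sym :=
  seq moveTree <| seq moveTree <| seq (push 2 Sym.zero) <| seq (transfer 1 (push 2)) <|
    seq (transfer 1 (push 0)) <| seq (push 1 Sym.zero) <| seq (transfer 2 (push 1))
      (transfer 1 (push 0))

theorem runs_swapTree (v w : Tree) : Runs swapTree ![v.code ++ (w.code ++ m), x, y, z]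
    ![w.code ++ (v.code ++ m), x, y, z] (9 * v.size + 13 * w.size + 27) := by
  have h : Runs swapTree _ _ _ :=
    (runs_moveTree (m := w.code ++ m) (x := x) (y := y) (z := z) v).seq <|
    (runs_moveTree w).seq <| (runs_push_two Sym.zero).seq <|
    (runs_transfer_one_two (zero_notMem_reverse_code w)).seq <|
    (runs_transfer_one_zero (zero_notMem_reverse_code v)).seq <| (runs_push_one Sym.zero).seq <|
    (runs_transfer_two_one (by simpa using w.zero_notMem_code)).seq
    (runs_transfer_one_zero (by simpa using w.zero_notMem_code))
  simpa using h.mono (U := 9 * v.size + 13 * w.size + 27) (by simp; omega)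

/-- Push the tree `v` to stack `0`. -/
def pushTree : Tree → Cmd (Fin 4) Sym
  | .nil => push 0 Sym.rpar
  | .cons a b => seq (pushTree b) (seq (pushTree a) (push 0 Sym.lpar))

theorem runs_pushTree (v : Tree) :
    Runs (pushTree v) ![m, x, y, z] ![v.code ++ m, x, y, z] (3 * v.size) := by
  induction v generalizing m with
  | nil => exact (runs_push_zero _).mono (by simp [Tree.size])
  | cons a b iha ihb =>
    have : Runs (pushTree (.cons a b)) _ _ _ :=
      (ihb (m := m)).seq (iha.seq (runs_push_zero Sym.lpar))
    simpa [Tree.code] using this.mono (U := 3 * (Tree.cons a b).size) (by simp [Tree.size]; omega)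

end Cmd

/-! ### Functions computable in polynomial time -/

theorem eval_mono (p : Polynomial ℕ) {x y : ℕ} (h : x ≤ y) : p.eval x ≤ p.eval y := by
  rw [Polynomial.eval_eq_sum, Polynomial.eval_eq_sum]
  exact Finset.sum_le_sum fun i _ => Nat.mul_le_mul_left _ (Nat.pow_le_pow_left h i)

/-- Types whose elements are represented by trees. The representation need not be faithful. -/
class TreeRep (α : Type) where
  /-- The tree that represents an element. -/
  enc : α → Tree

open TreeRep

section PolyTimeClosure

/-- The size of the representation of an element. -/
def rsize {α : Type} [TreeRep α] (a : α) : ℕ := (enc a).size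

theorem rsize_pos {α : Type} [TreeRep α] (a : α) : 0 < rsize a := Tree.size_pos _

/-- `f` is computed in polynomial time by a program that replaces the tree on top of stack `0` and
leaves everything else as it was. -/
@[fun_prop]
def PolyTime {α β : Type} [TreeRep α] [TreeRep β] (f : α → β) : Prop :=
  ∃ (c : Cmd (Fin 4) Sym) (p : Polynomial ℕ), ∀ (a : α) (m x y z : List Sym),
    c.Runs ![(enc a).code ++ m, x, y, z] ![(enc (f a)).code ++ m, x, y, z] (p.eval (rsize a))

variable {α β γ δ σ : Type} [TreeRep α] [TreeRep β] [TreeRep γ] [TreeRep δ] [TreeRep σ]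

instance : TreeRep (α × β) := ⟨fun p => .cons (enc p.1) (enc p.2)⟩

instance : TreeRep Unit := ⟨fun _ => .nil⟩

instance : TreeRep Bool := ⟨fun b => cond b (.cons .nil .nil) .nil⟩

/-- Numbers are represented in unary. -/
def encNat : ℕ → Tree
  | 0 => .nil
  | n + 1 => .cons .nil (encNat n)

instance : TreeRep ℕ := ⟨encNat⟩

/-- Lists are represented by right combs. -/
def encList : List α → Tree
  | [] => .nil
  | a :: l => .cons (enc a) (encList l)

instance : TreeRep (List α) := ⟨encList⟩

theorem enc_pair (a : α) (b : β) : enc (a, b) = .cons (enc a) (enc b) := rfl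

theorem enc_cons (a : α) (l : List α) : enc (a :: l) = .cons (enc a) (enc l) := rfl

@[simp]
theorem rsize_pair (a : α) (b : β) : rsize (a, b) = rsize a + rsize b + 1 := rfl

@[simp]
theorem rsize_nil : rsize ([] : List α) = 1 := rfl

@[simp]
theorem rsize_cons (a : α) (l : List α) : rsize (a :: l) = rsize a + rsize l + 1 := rfl

@[simp]
theorem rsize_nat (n : ℕ) : rsize n = 2 * n + 1 := by
  induction n with
  | zero => rfl
  | succ n ih =>
    have : rsize (n + 1) = 1 + rsize n + 1 := rfl
    omega

theorem rsize_bool_le (b : Bool) : rsize b ≤ 3 := by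
  cases b <;> simp [rsize, enc, Tree.size]

theorem length_le_rsize (l : List α) : 2 * l.length + 1 ≤ rsize l := by
  induction l with
  | nil => simp
  | cons a l ih =>
    have := rsize_pos a
    simp only [rsize_cons, List.length_cons]
    omega

theorem rsize_le_of_mem {a : α} {l : List α} (h : a ∈ l) : rsize a ≤ rsize l := by
  induction l with
  | nil => simp at h
  | cons b l ih =>
    rcases List.mem_cons.1 h with rfl | h
    · rw [rsize_cons]
      omega
    · have := ih h
      rw [rsize_cons]
      omega

theorem rsize_list_le {l : List α} {B : ℕ} (h : ∀ a ∈ l, rsize a ≤ B) :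
    rsize l ≤ l.length * (B + 1) + 1 := by
  induction l with
  | nil => simp
  | cons a l ih =>
    obtain ⟨ha, hl⟩ := List.forall_mem_cons.1 h
    have := ih hl
    simp only [rsize_cons, List.length_cons, Nat.succ_mul]
    omega

namespace PolyTime

open Cmd

theorem exists_rsize_le {f : α → β} (hf : PolyTime f) :
    ∃ p : Polynomial ℕ, ∀ a, rsize (f a) ≤ p.eval (rsize a) := by
  obtain ⟨c, p, h⟩ := hf
  refine ⟨.X + p, fun a => ?_⟩
  have := (h a [] [] [] []).length_le 0
  simpa [rsize] using this

theorem of_enc_eq (f : α → β) (h : ∀ a, enc (f a) = enc a) : PolyTime f :=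
  ⟨skip, 1, fun a m x y z => by rw [h]; simpa using runs_skip _⟩

@[fun_prop]
protected theorem id : PolyTime (fun a : α => a) := of_enc_eq _ fun _ => rfl

@[fun_prop]
theorem comp {g : β → γ} {f : α → β} (hg : PolyTime g) (hf : PolyTime f) :
    PolyTime (fun a => g (f a)) := by
  obtain ⟨q, hq⟩ := hf.exists_rsize_le
  obtain ⟨c, p, hf⟩ := hf
  obtain ⟨d, r, hg⟩ := hg
  refine ⟨seq c d, p + r.comp q + 1, fun a m x y z => ?_⟩
  refine ((hf a m x y z).seq (hg (f a) m x y z)).mono ?_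
  have := eval_mono r (hq a)
  simp only [Polynomial.eval_add, Polynomial.eval_comp, Polynomial.eval_one]
  omega

@[fun_prop]
protected theorem const (b : β) : PolyTime (fun _ : α => b) := by
  refine ⟨seq dropTree (pushTree (enc b)), 9 * .X + .C (3 * rsize b + 10), fun a m x y z => ?_⟩
  refine ((runs_dropTree _).seq (runs_pushTree _)).mono ?_
  simp [rsize]; omega

@[fun_prop]
theorem prodMk {f : α → β} {g : α → γ} (hf : PolyTime f) (hg : PolyTime g) :
    PolyTime (fun a => (f a, g a)) := by
  obtain ⟨pf, hpf⟩ := hf.exists_rsize_le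
  obtain ⟨pg, hpg⟩ := hg.exists_rsize_le
  obtain ⟨c, p, hf⟩ := hf
  obtain ⟨d, q, hg⟩ := hg
  refine ⟨seq dupTree <| seq c <| seq swapTree <| seq d <| seq swapTree (push 0 Sym.lpar),
    28 * .X + p + 22 * pf + q + 9 * pg + 77, fun a m x y z => ?_⟩
  have run := (runs_dupTree (m := m) (x := x) (y := y) (z := z) (enc a)).seq <|
    (hf a _ x y z).seq <| (runs_swapTree _ _).seq <| (hg a _ x y z).seq <|
    (runs_swapTree _ _).seq (runs_push_zero Sym.lpar)
  simp only [enc_pair, Tree.code, List.cons_append, List.append_assoc]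
  refine run.mono ?_
  have size_f := hpf a
  have size_g := hpg a
  simp only [rsize] at size_f size_g ⊢
  simp only [Polynomial.eval_add, Polynomial.eval_mul, Polynomial.eval_ofNat, Polynomial.eval_X]
  omega

@[fun_prop]
protected theorem fst : PolyTime (fun p : α × β => p.1) := by
  refine ⟨case 0 fun _ => seq swapTree dropTree, 22 * .X + 60, fun ⟨a, b⟩ m x y z => ?_⟩
  simp only [enc_pair, Tree.code, List.cons_append, List.append_assoc]
  refine (Runs.case_zero ((runs_swapTree _ _).seq (runs_dropTree _))).mono ?_
  simp [rsize, enc, Tree.size]; omega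

@[fun_prop]
protected theorem snd : PolyTime (fun p : α × β => p.2) := by
  refine ⟨case 0 fun _ => dropTree, 9 * .X + 60, fun ⟨a, b⟩ m x y z => ?_⟩
  simp only [enc_pair, Tree.code, List.cons_append, List.append_assoc]
  refine (Runs.case_zero (runs_dropTree _)).mono ?_
  simp [rsize, enc, Tree.size]; omega

theorem casesOn {l : α → σ} {n : α → δ} {c : α × β × γ → δ} {f : α → δ} (hl : PolyTime l)
    (hn : PolyTime n) (hc : PolyTime c)
    (h : ∀ a, (enc (l a) = .nil ∧ f a = n a) ∨
      ∃ b t, enc (l a) = .cons (enc b) (enc t) ∧ f a = c (a, b, t)) : PolyTime f := by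
  obtain ⟨pl, hpl⟩ := hl.exists_rsize_le
  obtain ⟨cl, p, hl⟩ := hl
  obtain ⟨cn, q, hn⟩ := hn
  obtain ⟨cc, r, hc⟩ := hc
  refine ⟨seq dupTree <| seq cl <| case 0 fun
    | some Sym.lpar => seq (push 0 Sym.lpar) <| seq swapTree <| seq (push 0 Sym.lpar) cc
    | _ => cn, 28 * .X + p + q + 9 * pl + r.comp (.X + pl + 1) + 60, fun a m x y z => ?_⟩
  simp only [Polynomial.eval_add, Polynomial.eval_mul, Polynomial.eval_ofNat, Polynomial.eval_X,
    Polynomial.eval_comp, Polynomial.eval_one]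
  have run_dup := runs_dupTree (m := m) (x := x) (y := y) (z := z) (enc a)
  have run_l := hl a ((enc a).code ++ m) x y z
  rcases h a with ⟨hnil, hfa⟩ | ⟨b, t, hcons, hfa⟩
  · rw [hnil] at run_l
    rw [hfa]
    refine (run_dup.seq (run_l.seq (Runs.case_zero (hn a m x y z)))).mono ?_
    simp only [rsize]
    omega
  · have run_swap :=
      runs_swapTree (m := m) (x := x) (y := y) (z := z) (.cons (enc b) (enc t)) (enc a)
    have run_c := hc (a, b, t) m x y z
    rw [hcons] at run_l
    simp only [enc_pair, Tree.code, List.cons_append, List.append_assoc] at run_l run_c run_swap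
    have size_l := hpl a
    simp only [rsize, hcons, Tree.size] at size_l
    have time_c : r.eval (rsize (a, b, t)) ≤ r.eval (rsize a + pl.eval (rsize a) + 1) :=
      eval_mono r (by simp only [rsize, enc_pair, Tree.size]; omega)
    rw [hfa]
    refine (run_dup.seq (run_l.seq (Runs.case_zero ((runs_push_zero _).seq (run_swap.seq
      ((runs_push_zero _).seq run_c)))))).mono ?_
    simp only [rsize, Tree.size] at time_c ⊢
    omega

theorem runs_countLoop (l : List β) (m x y z : List Sym) :
    Runs (loop 0 (fun a => decide (a ≠ Sym.lpar)) fun _ => seq dropTree (push 3 Sym.one))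
      ![(enc l).code ++ m, x, y, z]
      ![m, x, y, List.replicate l.length Sym.one ++ z] (21 * rsize l) := by
  induction l generalizing z with
  | nil => exact (runs_loop_leave_zero (a := Sym.rpar) rfl).mono (by simp)
  | cons a l ih =>
    rw [enc_cons, Tree.code, List.cons_append, List.append_assoc, List.length_cons,
      List.replicate_succ', List.append_assoc, List.singleton_append]
    refine (Runs.loop_zero (a := Sym.lpar) rfl ((runs_dropTree (enc a)).seq (runs_push_three _))
      (ih (Sym.one :: z))).mono ?_
    have := rsize_pos a
    rw [rsize_cons]
    simp only [rsize] at this ⊢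
    omega

theorem runs_iterateLoop {g : σ → σ} {c : Cmd (Fin 4) Sym} {B : ℕ} (n : ℕ) (s : σ)
    (hc : ∀ i < n, ∀ m x y z, Runs c ![(enc (g^[i] s)).code ++ m, x, y, z]
      ![(enc (g^[i + 1] s)).code ++ m, x, y, z] B) (m x y z : List Sym) :
    Runs (loop 3 (fun a => decide (a ≠ Sym.one)) fun _ => c)
      ![(enc s).code ++ m, x, y, List.replicate n Sym.one ++ Sym.zero :: z]
      ![(enc (g^[n] s)).code ++ m, x, y, z] (n * (B + 1) + 1) := by
  induction n generalizing s with
  | zero => exact (runs_loop_leave_three rfl).mono (by omega)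
  | succ n ih =>
    refine (Runs.loop_three (a := Sym.one) rfl (hc 0 n.succ_pos _ _ _ _)
      (ih (g s) fun i hi => hc (i + 1) (Nat.succ_lt_succ hi))).mono ?_
    rw [Nat.succ_mul]
    omega

theorem iterate {l : α → List β} {s : α → σ} {g : σ → σ} (hl : PolyTime l) (hs : PolyTime s)
    (hg : PolyTime g) (hb : ∃ p : Polynomial ℕ, ∀ a, ∀ i ≤ (l a).length,
      rsize (g^[i] (s a)) ≤ p.eval (rsize a)) : PolyTime (fun a => g^[(l a).length] (s a)) := by
  obtain ⟨B, hB⟩ := hb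
  obtain ⟨pl, hpl⟩ := hl.exists_rsize_le
  obtain ⟨c, p, hc⟩ := hl.prodMk hs
  obtain ⟨d, r, hd⟩ := hg
  refine ⟨seq c <| case 0 fun _ => seq (push 3 Sym.zero) <|
    seq (loop 0 (fun a => decide (a ≠ Sym.lpar)) fun _ => seq dropTree (push 3 Sym.one)) <|
    loop 3 (fun a => decide (a ≠ Sym.one)) fun _ => d,
    p + 21 * pl + pl * (r.comp B + 1) + 60, fun a m x y z => ?_⟩
  have run_prepare := hc a m x y z
  simp only [enc_pair, Tree.code, List.cons_append, List.append_assoc] at run_prepare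
  have run_iterate := runs_iterateLoop (B := r.eval (B.eval (rsize a))) (l a).length (s a)
    (fun i hi m x y z => by
      rw [Function.iterate_succ_apply']
      exact (hd _ m x y z).mono (eval_mono r (hB a i hi.le))) m x y z
  refine (run_prepare.seq (Runs.case_zero ((runs_push_three _).seq
    ((runs_countLoop _ _ _ _ _).seq run_iterate)))).mono ?_
  have size_l := hpl a
  have length_le : (l a).length ≤ pl.eval (rsize a) := by
    have := length_le_rsize (l a)
    omega
  have := Nat.mul_le_mul_right (r.eval (B.eval (rsize a)) + 1) length_le
  simp only [Polynomial.eval_add, Polynomial.eval_mul, Polynomial.eval_ofNat, Polynomial.eval_comp,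
    Polynomial.eval_one]
  omega

theorem cond {b : α → Bool} {f g : α → β} (hb : PolyTime b) (hf : PolyTime f) (hg : PolyTime g) :
    PolyTime (fun a => bif b a then f a else g a) := by
  refine casesOn (β := Unit) (γ := Unit) (c := fun q => f q.1) hb hg (by fun_prop) fun a => ?_
  cases h : b a
  · exact Or.inl ⟨rfl, rfl⟩
  · exact Or.inr ⟨(), (), rfl, rfl⟩

theorem ite {p : α → Prop} [DecidablePred p] {f g : α → β} (hp : PolyTime (fun a => decide (p a)))
    (hf : PolyTime f) (hg : PolyTime g) : PolyTime (fun a => if p a then f a else g a) := by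
  convert cond hp hf hg using 2 with a
  by_cases h : p a <;> simp [h]

@[fun_prop]
theorem and {f g : α → Bool} (hf : PolyTime f) (hg : PolyTime g) :
    PolyTime (fun a => f a && g a) := by
  convert cond hf hg (PolyTime.const false) using 2 with a
  cases f a <;> rfl

@[fun_prop]
theorem or {f g : α → Bool} (hf : PolyTime f) (hg : PolyTime g) :
    PolyTime (fun a => f a || g a) := by
  convert cond hf (PolyTime.const true) hg using 2 with a
  cases f a <;> rfl

@[fun_prop]
theorem not {f : α → Bool} (hf : PolyTime f) : PolyTime (fun a => !f a) := by
  convert cond hf (PolyTime.const false) (PolyTime.const true) using 2 with a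
  cases f a <;> rfl

theorem decide_and {p q : α → Prop} [DecidablePred p] [DecidablePred q]
    (hp : PolyTime (fun a => decide (p a))) (hq : PolyTime (fun a => decide (q a))) :
    PolyTime (fun a => decide (p a ∧ q a)) := by
  simpa using hp.and hq

@[fun_prop]
theorem cons {f : α → β} {g : α → List β} (hf : PolyTime f) (hg : PolyTime g) :
    PolyTime (fun a => f a :: g a) :=
  comp (of_enc_eq (fun q : β × List β => q.1 :: q.2) fun _ => rfl) (hf.prodMk hg)

@[fun_prop]
theorem tail {f : α → List β} (hf : PolyTime f) : PolyTime (fun a => (f a).tail) := by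
  refine casesOn (β := β) (γ := List β) (c := fun q => q.2.2) hf (PolyTime.const []) (by fun_prop)
    fun a => ?_
  cases h : f a with
  | nil => exact Or.inl ⟨rfl, rfl⟩
  | cons b t => exact Or.inr ⟨b, t, rfl, rfl⟩

@[fun_prop]
theorem headD {f : α → List β} {d : α → β} (hf : PolyTime f) (hd : PolyTime d) :
    PolyTime (fun a => (f a).headD (d a)) := by
  refine casesOn (β := β) (γ := List β) (c := fun q => q.2.1) hf hd (by fun_prop) fun a => ?_
  cases h : f a with
  | nil => exact Or.inl ⟨rfl, rfl⟩
  | cons b t => exact Or.inr ⟨b, t, rfl, rfl⟩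

/-- One step of a fold: the state consists of the parameter, the rest of the list, and the
accumulator. -/
def foldStep {α β σ : Type} (f : α → σ → β → σ) : α × List β × σ → α × List β × σ
  | (a, [], s) => (a, [], s)
  | (a, b :: t, s) => (a, t, f a s b)

theorem iterate_foldStep {α β σ : Type} (f : α → σ → β → σ) (a : α) (l : List β) (s : σ) (i : ℕ) :
    (foldStep f)^[i] (a, l, s) = (a, l.drop i, (l.take i).foldl (f a) s) := by
  induction i generalizing l s with
  | zero => simp
  | succ i ih =>
    rw [Function.iterate_succ_apply]
    cases l with
    | nil => simp [foldStep, ih]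
    | cons b t => simp [foldStep, ih]

theorem rsize_drop_le (l : List β) (i : ℕ) : rsize (l.drop i) ≤ rsize l := by
  induction l generalizing i with
  | nil => simp
  | cons b l ih =>
    cases i with
    | zero => simp
    | succ i =>
      have := ih i
      simp only [List.drop_succ_cons, rsize_cons]
      omega

theorem foldl {l : α → List β} {s : α → σ} {f : α → σ → β → σ} (hl : PolyTime l) (hs : PolyTime s)
    (hf : PolyTime (fun q : α × σ × β => f q.1 q.2.1 q.2.2))
    (hb : ∃ p : Polynomial ℕ, ∀ a, ∀ i ≤ (l a).length,
      rsize (((l a).take i).foldl (f a) (s a)) ≤ p.eval (rsize a)) :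
    PolyTime (fun a => (l a).foldl (f a) (s a)) := by
  have polyTime_step : PolyTime (foldStep f) := by
    refine casesOn (l := fun q : α × List β × σ => q.2.1) (β := β) (γ := List β)
      (c := fun q => (q.1.1, q.2.2, f q.1.1 q.1.2.2 q.2.1)) (by fun_prop) PolyTime.id
      (prodMk (by fun_prop) (prodMk (by fun_prop)
        (comp hf (f := fun q : (α × List β × σ) × β × List β => (q.1.1, q.1.2.2, q.2.1))
          (by fun_prop)))) ?_
    rintro ⟨a, _ | ⟨b, t⟩, s⟩
    · exact Or.inl ⟨rfl, rfl⟩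
    · exact Or.inr ⟨b, t, rfl, rfl⟩
  obtain ⟨p, hp⟩ := hb
  obtain ⟨pl, hpl⟩ := hl.exists_rsize_le
  have polyTime_iterate : PolyTime (fun a => (foldStep f)^[(l a).length] (a, l a, s a)) := by
    refine iterate hl (by fun_prop) polyTime_step ⟨.X + pl + p + 2, fun a i hi => ?_⟩
    rw [iterate_foldStep]
    have := hp a i hi
    have := hpl a
    have := rsize_drop_le (l a) i
    simp only [rsize_pair, Polynomial.eval_add, Polynomial.eval_X, Polynomial.eval_ofNat]
    omega
  have polyTime_accumulator :
      PolyTime (fun a => ((foldStep f)^[(l a).length] (a, l a, s a)).2.2) := by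
    fun_prop
  simpa [iterate_foldStep] using polyTime_accumulator

theorem foldl_of_add_le {l : α → List β} {s : α → σ} {f : α → σ → β → σ} (hl : PolyTime l)
    (hs : PolyTime s) (hf : PolyTime (fun q : α × σ × β => f q.1 q.2.1 q.2.2))
    (hb : ∃ p : Polynomial ℕ, ∀ a, ∀ b ∈ l a, ∀ t,
      rsize (f a t b) ≤ rsize t + p.eval (rsize a)) :
    PolyTime (fun a => (l a).foldl (f a) (s a)) := by
  obtain ⟨p, hp⟩ := hb
  obtain ⟨pl, hpl⟩ := hl.exists_rsize_le
  obtain ⟨ps, hps⟩ := hs.exists_rsize_le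
  refine foldl hl hs hf ⟨ps + pl * p, fun a i _ => ?_⟩
  have rsize_foldl_le (l' : List β) (t : σ) (hl' : ∀ b ∈ l', b ∈ l a) :
      rsize (l'.foldl (f a) t) ≤ rsize t + l'.length * p.eval (rsize a) := by
    induction l' generalizing t with
    | nil => simp
    | cons b l' ih =>
      obtain ⟨hb, hl'⟩ := List.forall_mem_cons.1 hl'
      have := hp a b hb t
      have := ih (f a t b) hl'
      rw [List.foldl_cons, List.length_cons, Nat.succ_mul]
      omega
  have size_take := rsize_foldl_le ((l a).take i) (s a) fun b hb => List.mem_of_mem_take hb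
  have length_take_le : ((l a).take i).length ≤ pl.eval (rsize a) := by
    have := length_le_rsize (l a)
    have := hpl a
    have := List.length_take_le' i (l a)
    omega
  have := Nat.mul_le_mul_right (p.eval (rsize a)) length_take_le
  have := hps a
  simp only [Polynomial.eval_add, Polynomial.eval_mul]
  omega

@[fun_prop]
theorem reverse {f : α → List β} (hf : PolyTime f) : PolyTime (fun a => (f a).reverse) := by
  have : PolyTime (fun a => (f a).foldl (fun t b => b :: t) []) := by
    obtain ⟨p, hp⟩ := hf.exists_rsize_le
    refine foldl_of_add_le hf (PolyTime.const []) (by fun_prop) ⟨p + 1, fun a b hb t => ?_⟩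
    have := rsize_le_of_mem hb
    have := hp a
    simp only [rsize_cons, Polynomial.eval_add, Polynomial.eval_one]
    omega
  simpa using this

@[fun_prop]
theorem append {f g : α → List β} (hf : PolyTime f) (hg : PolyTime g) :
    PolyTime (fun a => f a ++ g a) := by
  have : PolyTime (fun a => (f a).reverse.foldl (fun t b => b :: t) (g a)) := by
    obtain ⟨p, hp⟩ := hf.exists_rsize_le
    refine foldl_of_add_le hf.reverse hg (by fun_prop) ⟨p + 1, fun a b hb t => ?_⟩
    have := rsize_le_of_mem (List.mem_reverse.1 hb)
    have := hp a
    simp only [rsize_cons, Polynomial.eval_add, Polynomial.eval_one]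
    omega
  simpa using this

theorem exists_rsize_le_of_mem {l : α → List β} {f : α → β → γ} (hl : PolyTime l)
    (hf : PolyTime (fun q : α × β => f q.1 q.2)) :
    ∃ p : Polynomial ℕ, ∀ a, ∀ b ∈ l a, rsize (f a b) ≤ p.eval (rsize a) := by
  obtain ⟨pl, hpl⟩ := hl.exists_rsize_le
  obtain ⟨p, hp⟩ := hf.exists_rsize_le
  refine ⟨p.comp (.X + pl + 1), fun a b hb => (hp (a, b)).trans ?_⟩
  rw [Polynomial.eval_comp]
  apply eval_mono
  have := rsize_le_of_mem hb
  have := hpl a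
  simp only [rsize_pair, Polynomial.eval_add, Polynomial.eval_X, Polynomial.eval_one]
  omega

@[fun_prop]
theorem map {l : α → List β} {f : α → β → γ} (hl : PolyTime l)
    (hf : PolyTime (fun q : α × β => f q.1 q.2)) : PolyTime (fun a => (l a).map (f a)) := by
  have : PolyTime (fun a => ((l a).foldl (fun t b => f a b :: t) []).reverse) := by
    obtain ⟨p, hp⟩ := exists_rsize_le_of_mem hl hf
    refine reverse (foldl_of_add_le hl (PolyTime.const []) (cons
      (comp hf (f := fun q : α × List γ × β => (q.1, q.2.2)) (by fun_prop)) (by fun_prop))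
      ⟨p + 1, fun a b hb t => ?_⟩)
    have := hp a b hb
    simp only [rsize_cons, Polynomial.eval_add, Polynomial.eval_one]
    omega
  convert this using 2 with a
  simp

@[fun_prop]
theorem filter {l : α → List β} {f : α → β → Bool} (hl : PolyTime l)
    (hf : PolyTime (fun q : α × β => f q.1 q.2)) : PolyTime (fun a => (l a).filter (f a)) := by
  have : PolyTime (fun a =>
      ((l a).foldl (fun t b => bif f a b then b :: t else t) []).reverse) := by
    obtain ⟨p, hp⟩ := hl.exists_rsize_le
    refine reverse (foldl_of_add_le hl (PolyTime.const []) (cond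
      (comp hf (f := fun q : α × List β × β => (q.1, q.2.2)) (by fun_prop)) (by fun_prop)
      (by fun_prop)) ⟨p + 1, fun a b hb t => ?_⟩)
    have := rsize_le_of_mem hb
    have := hp a
    simp only [Polynomial.eval_add, Polynomial.eval_one]
    cases f a b
    · simp
    · simp only [cond_true, rsize_cons]
      omega
  convert this using 2 with a
  simp only [Bool.cond_eq_ite]
  rw [← List.foldl_filter (f := fun t b => b :: t)]
  simp

theorem rsize_append (l l' : List β) : rsize (l ++ l') + 1 = rsize l + rsize l' := by
  induction l with
  | nil => simp only [List.nil_append, rsize_nil]; omega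
  | cons b l ih => simp only [List.cons_append, rsize_cons]; omega

@[fun_prop]
theorem flatten {l : α → List (List β)} (hl : PolyTime l) : PolyTime (fun a => (l a).flatten) := by
  have : PolyTime (fun a => (l a).foldl (fun t b => t ++ b) []) := by
    obtain ⟨p, hp⟩ := hl.exists_rsize_le
    refine foldl_of_add_le hl (PolyTime.const []) (by fun_prop) ⟨p, fun a b hb t => ?_⟩
    have := rsize_le_of_mem hb
    have := hp a
    have := rsize_append t b
    omega
  simpa [List.foldl_append_eq_append (f := fun b : List β => b)] using this

@[fun_prop]
theorem flatMap {l : α → List β} {f : α → β → List γ} (hl : PolyTime l)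
    (hf : PolyTime (fun q : α × β => f q.1 q.2)) : PolyTime (fun a => (l a).flatMap (f a)) := by
  simp only [List.flatMap_def]
  exact flatten (map hl hf)

@[fun_prop]
theorem all {l : α → List β} {f : α → β → Bool} (hl : PolyTime l)
    (hf : PolyTime (fun q : α × β => f q.1 q.2)) : PolyTime (fun a => (l a).all (f a)) := by
  have : PolyTime (fun a => (l a).foldl (fun t b => t && f a b) true) := by
    refine foldl_of_add_le hl (PolyTime.const true) (and (by fun_prop)
      (comp hf (f := fun q : α × Bool × β => (q.1, q.2.2)) (by fun_prop)))
      ⟨3, fun a b _ t => ?_⟩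
    have := rsize_bool_le (t && f a b)
    simp only [Polynomial.eval_ofNat]
    omega
  convert this using 2 with a
  have foldl_and (l' : List β) (t : Bool) :
      l'.foldl (fun t b => t && f a b) t = (t && l'.all (f a)) := by
    induction l' generalizing t with
    | nil => simp
    | cons b l' ih => simp [ih, Bool.and_assoc]
  simp [foldl_and]

@[fun_prop]
theorem any {l : α → List β} {f : α → β → Bool} (hl : PolyTime l)
    (hf : PolyTime (fun q : α × β => f q.1 q.2)) : PolyTime (fun a => (l a).any (f a)) := by
  have := (hl.all (f := fun a b => !f a b) hf.not).not
  convert this using 2 with a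
  simp [List.not_all_eq_any_not]

@[fun_prop]
theorem succ {f : α → ℕ} (hf : PolyTime f) : PolyTime (fun a => f a + 1) :=
  comp (g := fun q : Unit × ℕ => q.2 + 1) (of_enc_eq _ fun _ => rfl)
    ((PolyTime.const ()).prodMk hf)

@[fun_prop]
theorem length {f : α → List β} (hf : PolyTime f) : PolyTime (fun a => (f a).length) := by
  have : PolyTime (fun a => (f a).foldl (fun t _ => t + 1) 0) :=
    foldl_of_add_le hf (PolyTime.const 0) (by fun_prop) ⟨2, fun a b _ t => by
      simp only [rsize_nat, Polynomial.eval_ofNat]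
      omega⟩
  simpa using this

theorem enc_replicate_unit (n : ℕ) : enc (List.replicate n ()) = enc n := by
  induction n with
  | zero => rfl
  | succ n ih => rw [List.replicate_succ, enc_cons, ih]; rfl

theorem replicate_unit {f : α → ℕ} (hf : PolyTime f) :
    PolyTime (fun a => List.replicate (f a) ()) :=
  comp (of_enc_eq _ enc_replicate_unit) hf

@[fun_prop]
theorem range {f : α → ℕ} (hf : PolyTime f) : PolyTime (fun a => List.range (f a)) := by
  have foldl_eq_range (n : ℕ) :
      (List.replicate n ()).foldl (fun t _ => t ++ [t.length]) [] = List.range n := by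
    induction n with
    | zero => rfl
    | succ n ih => rw [List.replicate_succ', List.foldl_append, ih, List.range_succ]; simp
  have rsize_range_le {i B : ℕ} (hi : i ≤ B) : rsize (List.range i) ≤ B * (2 * B + 2) + 1 := by
    have : rsize (List.range i) ≤ (List.range i).length * (2 * B + 2) + 1 :=
      rsize_list_le (B := 2 * B + 1) fun b hb => by
        have := List.mem_range.1 hb
        rw [rsize_nat]
        omega
    have := Nat.mul_le_mul_right (2 * B + 2) hi
    rw [List.length_range] at *
    omega
  have : PolyTime (fun a => (List.replicate (f a) ()).foldl (fun t _ => t ++ [t.length]) []) := by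
    obtain ⟨p, hp⟩ := hf.exists_rsize_le
    refine foldl (replicate_unit hf) (PolyTime.const []) (by fun_prop)
      ⟨p * (2 * p + 2) + 1, fun a i hi => ?_⟩
    rw [List.length_replicate] at hi
    rw [List.take_replicate, Nat.min_eq_left hi, foldl_eq_range]
    have := hp a
    rw [rsize_nat] at this
    simpa using rsize_range_le (i := i) (B := p.eval (rsize a)) (by omega)
  simpa only [foldl_eq_range] using this

@[fun_prop]
theorem add {f g : α → ℕ} (hf : PolyTime f) (hg : PolyTime g) : PolyTime (fun a => f a + g a) := by
  have : PolyTime (fun a => (List.range (f a) ++ List.range (g a)).length) := by fun_prop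
  simpa using this

@[fun_prop]
theorem mul {f g : α → ℕ} (hf : PolyTime f) (hg : PolyTime g) : PolyTime (fun a => f a * g a) := by
  have : PolyTime (fun a => ((List.range (f a)).flatMap fun _ => List.range (g a)).length) := by
    fun_prop
  simpa using this

@[fun_prop]
theorem drop {f : α → ℕ} {l : α → List β} (hf : PolyTime f) (hl : PolyTime l) :
    PolyTime (fun a => (l a).drop (f a)) := by
  have foldl_tail (n : ℕ) (t : List β) :
      (List.replicate n ()).foldl (fun t _ => t.tail) t = t.drop n := by
    induction n generalizing t with
    | zero => simp
    | succ n ih => simp [List.replicate_succ, ih]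
  have : PolyTime (fun a => (List.replicate (f a) ()).foldl (fun t _ => t.tail) (l a)) := by
    refine foldl_of_add_le (replicate_unit hf) hl (by fun_prop) ⟨0, fun a b _ t => ?_⟩
    simpa using rsize_drop_le t 1
  simpa only [foldl_tail] using this

@[fun_prop]
theorem sub {f g : α → ℕ} (hf : PolyTime f) (hg : PolyTime g) : PolyTime (fun a => f a - g a) := by
  have : PolyTime (fun a => ((List.range (f a)).drop (g a)).length) := by fun_prop
  simpa using this

@[fun_prop]
theorem decide_eq_zero {f : α → ℕ} (hf : PolyTime f) : PolyTime (fun a => decide (f a = 0)) := by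
  refine casesOn (β := Unit) (γ := ℕ) (c := fun _ => false) hf (PolyTime.const true)
    (by fun_prop) fun a => ?_
  cases h : f a with
  | zero => exact Or.inl ⟨rfl, rfl⟩
  | succ n => exact Or.inr ⟨(), n, rfl, rfl⟩

@[fun_prop]
theorem decide_le {f g : α → ℕ} (hf : PolyTime f) (hg : PolyTime g) :
    PolyTime (fun a => decide (f a ≤ g a)) := by
  have : PolyTime (fun a => decide (f a - g a = 0)) := by fun_prop
  simpa only [Nat.sub_eq_zero_iff_le] using this

@[fun_prop]
theorem decide_lt {f g : α → ℕ} (hf : PolyTime f) (hg : PolyTime g) :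
    PolyTime (fun a => decide (f a < g a)) :=
  decide_le (f := fun a => f a + 1) (by fun_prop) hg

@[fun_prop]
theorem decide_eq {f g : α → ℕ} (hf : PolyTime f) (hg : PolyTime g) :
    PolyTime (fun a => decide (f a = g a)) := by
  simpa only [← Nat.le_antisymm_iff] using decide_and (decide_le hf hg) (decide_le hg hf)

@[fun_prop]
theorem getD {l : α → List β} {i : α → ℕ} {d : α → β} (hl : PolyTime l) (hi : PolyTime i)
    (hd : PolyTime d) : PolyTime (fun a => (l a).getD (i a) (d a)) := by
  have : PolyTime (fun a => ((l a).drop (i a)).headD (d a)) := by fun_prop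
  convert this using 2 with a
  simp [List.getD_eq_getElem?_getD, List.headD_eq_head?_getD]

theorem decide_eq_bits {f g : α → List Bool} (hf : PolyTime f) (hg : PolyTime g) :
    PolyTime (fun a => decide (f a = g a)) := by
  have : PolyTime (fun a => decide ((f a).length = (g a).length) &&
      (List.range (f a).length).all fun i =>
        bif (f a).getD i false then (g a).getD i false else !(g a).getD i false) :=
    and (by fun_prop) (all (by fun_prop) (cond (by fun_prop) (by fun_prop) (by fun_prop)))
  convert this using 2 with a
  rw [Bool.eq_iff_iff]
  simp only [decide_eq_true_eq, Bool.and_eq_true, List.all_eq_true, List.mem_range]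
  constructor
  · intro h
    refine ⟨congrArg _ h, fun i _ => ?_⟩
    rw [h]
    cases (g a).getD i false <;> rfl
  · rintro ⟨length_eq, getD_eq⟩
    refine List.ext_getElem length_eq fun i hi hi' => ?_
    have := getD_eq i hi
    rw [List.getD_eq_getElem _ _ hi, List.getD_eq_getElem _ _ hi'] at this
    cases h : (f a)[i] <;> simp_all

end PolyTime

end PolyTimeClosure

/-! ### Reading and writing strings -/

namespace Tree

/-- A tree as a balanced string of parentheses. -/
def flat : Tree → List Sym
  | nil => []
  | cons a b => paren a.flat ++ b.flat

theorem code_eq_flat (a : Tree) : a.code = a.flat ++ [Sym.rpar] := by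
  induction a with
  | nil => rfl
  | cons a b iha ihb => simp [code, flat, paren, iha, ihb]

end Tree

/-- The string of parentheses that represents a symbol. -/
def Sym.flat : Sym → List Sym
  | .zero => [.lpar, .rpar]
  | .one => [.lpar, .lpar, .rpar, .rpar]
  | .lpar => [.lpar]
  | .rpar => [.rpar]

theorem length_flatMap_flat_le (s : List Sym) : (s.flatMap Sym.flat).length ≤ 4 * s.length := by
  induction s with
  | nil => simp
  | cons b s ih =>
    have : b.flat.length ≤ 4 := by cases b <;> simp [Sym.flat]
    simp only [List.flatMap_cons, List.length_append, List.length_cons]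
    omega

/-- The string `s` represents `a`, provided that bits are replaced by groups of parentheses. -/
def Represents {α : Type} [TreeRep α] (s : List Sym) (a : α) : Prop :=
  s.flatMap Sym.flat = paren (enc a).flat

section

variable {α β : Type} [TreeRep α] [TreeRep β]

theorem represents_paren {s : List Sym} {a : α} (h : s.flatMap Sym.flat = (enc a).flat) :
    Represents (paren s) a := by
  simp [Represents, paren, Sym.flat, h]

theorem represents_encodeBits (b : List Bool) : Represents (encodeBits b) b := by
  refine represents_paren ?_
  induction b with
  | nil => rfl
  | cons x b ih =>
    rw [List.map_cons, List.flatMap_cons, ih, enc_cons, Tree.flat]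
    cases x <;> rfl

theorem represents_encodeNat (n : ℕ) : Represents (encodeNat n) (List.replicate n true) := by
  have : encodeNat n = encodeBits (List.replicate n true) := by simp [encodeNat, encodeBits]
  rw [this]
  exact represents_encodeBits _

theorem represents_encodeList {ι : Type} {f : ι → List Sym} {g : ι → β} {l : List ι}
    (h : ∀ a ∈ l, Represents (f a) (g a)) : Represents (encodeList (l.map f)) (l.map g) := by
  refine represents_paren ?_
  induction l with
  | nil => rfl
  | cons a l ih =>
    obtain ⟨ha, hl⟩ := List.forall_mem_cons.1 h
    simp only [List.map_cons, List.flatten_cons, List.flatMap_append, enc_cons, Tree.flat, ih hl]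
    rw [ha]

theorem represents_encodeList_pair {s t : List Sym} {a : α} {b : List β} (hs : Represents s a)
    (ht : Represents t b) : Represents (encodeList [s, t]) (a, b, ()) := by
  refine represents_paren ?_
  simp only [Represents] at hs ht
  simp [hs, ht, enc, Tree.flat]

theorem represents_encodeList_triple {γ : Type} [TreeRep γ] {s t u : List Sym} {a : α} {b : β}
    {c : γ} (hs : Represents s a) (ht : Represents t b) (hu : Represents u c) :
    Represents (encodeList [s, t, u]) (a, b, c, ()) := by
  refine represents_paren ?_
  simp only [Represents] at hs ht hu
  simp [hs, ht, hu, enc, Tree.flat]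

end

namespace Cmd

/-- Push the parentheses that represent a symbol to stack `1`, the first one first. -/
def readSymbol : Sym → Cmd (Fin 4) Sym
  | .zero => seq (push 1 .lpar) (push 1 .rpar)
  | .one => seq (push 1 .lpar) (seq (push 1 .lpar) (seq (push 1 .rpar) (push 1 .rpar)))
  | .lpar => push 1 .lpar
  | .rpar => push 1 .rpar

/-- Replace every symbol on stack `0` by its group of parentheses, and delete the first one, so that
a representation of `a` becomes the Polish form of `enc a`. -/
def readTree : Cmd (Fin 4) Sym :=
  seq (loop 0 (fun _ => false) readSymbol) <|
  seq (loop 1 (fun _ => false) fun a => push 0 a) (case 0 fun _ => skip)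

variable {m x y z : List Sym}

theorem runs_readSymbol (b : Sym) :
    Runs (readSymbol b) ![m, x, y, z] ![m, b.flat.reverse ++ x, y, z] 7 := by
  cases b
  · exact ((runs_push_one _).seq (runs_push_one _)).mono (by omega)
  · exact ((runs_push_one _).seq ((runs_push_one _).seq ((runs_push_one _).seq
      (runs_push_one _)))).mono (by omega)
  · exact (runs_push_one _).mono (by omega)
  · exact (runs_push_one _).mono (by omega)

theorem runs_loop_readSymbol (s : List Sym) :
    Runs (loop 0 (fun _ => false) readSymbol) ![s, x, y, z]
      ![[], (s.flatMap Sym.flat).reverse ++ x, y, z] (8 * s.length + 1) := by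
  induction s generalizing x with
  | nil => exact runs_loop_nil rfl
  | cons b s ih =>
    have := Runs.loop_zero (leave := fun _ => false) rfl (runs_readSymbol b) (ih (x := _ ++ x))
    simpa using this.mono (U := 8 * (b :: s).length + 1) (by rw [List.length_cons]; omega)

theorem runs_loop_push_zero :
    Runs (loop 1 (fun _ => false) fun a => push 0 a) ![m, x, y, z] ![x.reverse ++ m, [], y, z]
      (2 * x.length + 1) := by
  induction x generalizing m with
  | nil => exact runs_loop_nil rfl
  | cons b x ih =>
    have := Runs.loop_one (leave := fun _ => false) rfl (runs_push_zero b) (ih (m := b :: m))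
    simpa using this.mono (U := 2 * (b :: x).length + 1) (by rw [List.length_cons]; omega)

theorem runs_readTree {α : Type} [TreeRep α] {s : List Sym} {a : α} (h : Represents s a) :
    Runs readTree ![s, [], [], []] ![(enc a).code, [], [], []] (20 * s.length + 20) := by
  have expand := runs_loop_readSymbol (x := []) (y := []) (z := []) s
  have move_back := runs_loop_push_zero (m := []) (x := (s.flatMap Sym.flat).reverse) (y := [])
    (z := [])
  rw [List.append_nil] at expand
  have drop_first : Runs (case 0 fun _ => skip) ![paren (enc a).flat, [], [], []]
      ![(enc a).code, [], [], []] 2 := by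
    rw [Tree.code_eq_flat]
    exact Runs.case_zero (runs_skip _)
  rw [List.reverse_reverse, List.append_nil, List.length_reverse] at move_back
  rw [← h] at drop_first
  refine (expand.seq (move_back.seq drop_first)).mono ?_
  have := length_flatMap_flat_le s
  omega

end Cmd

/-- Symbols are represented like the numbers `0, 1, 2, 3`. -/
def Sym.toNat : Sym → ℕ
  | .zero => 0
  | .one => 1
  | .lpar => 2
  | .rpar => 3

instance : TreeRep Sym := ⟨fun a => enc a.toNat⟩

namespace Cmd

/-- Pop the rest of the Polish form of a symbol, without the first parenthesis of the cell that
holds it, from stack `0` and push the symbol to stack `1`. -/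
def writeSymbol : Cmd (Fin 4) Sym :=
  case 0 fun
    | some .lpar => case 0 fun _ => case 0 fun
      | some .lpar => case 0 fun _ => case 0 fun
        | some .lpar => case 0 fun _ => case 0 fun _ => push 1 .rpar
        | _ => push 1 .lpar
      | _ => push 1 .one
    | _ => push 1 .zero

/-- Move the list of symbols represented on stack `0` to stack `1`. -/
def writeSymbols : Cmd (Fin 4) Sym :=
  loop 0 (fun a => decide (a ≠ Sym.lpar)) fun _ => writeSymbol

theorem runs_writeSymbol (b : Sym) {m x y z : List Sym} :
    Runs writeSymbol ![(enc b).code ++ m, x, y, z] ![m, b :: x, y, z] 8 := by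
  cases b
  · exact (Runs.case_zero (a := .rpar) (runs_push_one _)).mono (by omega)
  · exact (Runs.case_zero (a := .lpar) (Runs.case_zero (a := .rpar) (Runs.case_zero
      (a := .rpar) (runs_push_one _)))).mono (by omega)
  · exact (Runs.case_zero (a := .lpar) (Runs.case_zero (a := .rpar) (Runs.case_zero
      (a := .lpar) (Runs.case_zero (a := .rpar) (Runs.case_zero (a := .rpar)
      (runs_push_one _)))))).mono (by omega)
  · exact (Runs.case_zero (a := .lpar) (Runs.case_zero (a := .rpar) (Runs.case_zero
      (a := .lpar) (Runs.case_zero (a := .rpar) (Runs.case_zero (a := .lpar)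
      (Runs.case_zero (a := .rpar) (Runs.case_zero (a := .rpar)
      (runs_push_one _)))))))).mono (by omega)

theorem runs_writeSymbols (w : List Sym) {x y z : List Sym} :
    Runs writeSymbols ![(enc w).code, x, y, z] ![[], w.reverse ++ x, y, z]
      (9 * w.length + 1) := by
  induction w generalizing x with
  | nil => exact (runs_loop_leave_zero (a := Sym.rpar) rfl).mono (by simp)
  | cons b w ih =>
    have := Runs.loop_zero (leave := fun a => decide (a ≠ Sym.lpar)) (a := Sym.lpar) rfl
      (runs_writeSymbol b (m := (enc w).code) (y := y) (z := z)) (ih (x := b :: x))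
    rw [List.reverse_cons, List.append_assoc]
    exact this.mono (by rw [List.length_cons]; omega)

end Cmd

theorem PolyTime.encodeBits {α : Type} [TreeRep α] {f : α → List Bool} (hf : PolyTime f) :
    PolyTime (fun a => encodeBits (f a)) := by
  unfold MsgPass.encodeBits paren
  exact cons (by fun_prop) (append (map hf (cond (by fun_prop) (by fun_prop) (by fun_prop)))
    (by fun_prop))

theorem PolyTime.encodeList {α : Type} [TreeRep α] {f : α → List (List Sym)} (hf : PolyTime f) :
    PolyTime (fun a => encodeList (f a)) := by
  unfold MsgPass.encodeList paren
  fun_prop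

theorem PolyTime.encodeNat {α : Type} [TreeRep α] {f : α → ℕ} (hf : PolyTime f) :
    PolyTime (fun a => encodeNat (f a)) := by
  have : PolyTime (fun a => MsgPass.encodeBits ((List.range (f a)).map fun _ => true)) :=
    encodeBits (by fun_prop)
  convert this using 2 with a
  simp [MsgPass.encodeNat, MsgPass.encodeBits, List.map_const']

theorem Represents.rsize_le {α : Type} [TreeRep α] {s : List Sym} {a : α} (h : Represents s a) :
    rsize a ≤ 4 * s.length := by
  have length_flatMap_le := length_flatMap_flat_le s
  have length_code := (enc a).length_code
  rw [h, paren] at length_flatMap_le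
  rw [Tree.code_eq_flat] at length_code
  rw [List.length_cons] at length_flatMap_le
  rw [rsize]
  omega

theorem PolyTime.exists_runs {α : Type} [TreeRep α] {f : α → List Sym} (hf : PolyTime f) :
    ∃ (c : Cmd (Fin 4) Sym) (p : Polynomial ℕ), ∀ (s : List Sym) (a : α), Represents s a →
      c.Runs ![s, [], [], []] ![[], (f a).reverse, [], []] (p.eval s.length) ∧
        (f a).length ≤ p.eval s.length := by
  obtain ⟨q, hq⟩ := hf.exists_rsize_le
  obtain ⟨c, p, runs_c⟩ := hf
  refine ⟨.seq Cmd.readTree (.seq c Cmd.writeSymbols),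
    20 * .X + p.comp (4 * .X) + 9 * q.comp (4 * .X) + 30, fun s a hs => ?_⟩
  have compute := runs_c a [] [] [] []
  have write := Cmd.runs_writeSymbols (f a) (x := []) (y := []) (z := [])
  rw [List.append_nil, List.append_nil] at compute
  rw [List.append_nil] at write
  have := length_le_rsize (f a)
  have := (hq a).trans (eval_mono q hs.rsize_le)
  have := eval_mono p hs.rsize_le
  simp only [Polynomial.eval_add, Polynomial.eval_mul, Polynomial.eval_ofNat, Polynomial.eval_comp,
    Polynomial.eval_X]
  refine ⟨((Cmd.runs_readTree hs).seq (compute.seq write)).mono ?_, ?_⟩ <;> omega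

/-! ### Stability of the message-passing colours -/

theorem persistent_of_bounded {n : ℕ} {P : ℕ → Prop} {g : ℕ → ℕ} (hpos : 1 ≤ g 0)
    (hn : ∀ t, g t ≤ n) (hg : ∀ t, ¬P t → g t < g (t + 1)) (hP : ∀ t, P t → P (t + 1)) {t : ℕ}
    (ht : n - 1 ≤ t) : P t := by
  by_contra h
  have not_of_le (r : ℕ) (hr : r ≤ t) : ¬P r := fun hPr =>
    h (Nat.le_induction hPr (fun s _ => hP s) t hr)
  have succ_le_of_le (r : ℕ) (hr : r ≤ t + 1) : r + 1 ≤ g r := by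
    induction r with
    | zero => exact hpos
    | succ r ih => exact (Nat.succ_le_succ (ih (by omega))).trans (hg r (not_of_le r (by omega)))
  have := succ_le_of_le (t + 1) le_rfl
  have := hn (t + 1)
  omega

section FeaturedGraph

variable {G : FeaturedGraph}

theorem mpc_prev (t : ℕ) (v : Fin G.order) : (mpc G (t + 1) v).prev = mpc G t v := rfl

open Classical in
theorem mpc_nbrs (t : ℕ) (v : Fin G.order) : (mpc G (t + 1) v).nbrs =
    (Finset.univ.filter (G.graph.Adj v)).val.map (mpc G t) := rfl

theorem mem_mpc_nbrs {t : ℕ} {v : Fin G.order} {e : Color t} :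
    e ∈ (mpc G (t + 1) v).nbrs ↔ ∃ w, G.graph.Adj v w ∧ mpc G t w = e := by
  simp [mpc_nbrs]

open Classical in
theorem count_mpc_nbrs (t : ℕ) (v w : Fin G.order) :
    (mpc G (t + 1) v).nbrs.count (mpc G t w) =
      (Finset.univ.filter fun y => G.graph.Adj v y ∧ mpc G t y = mpc G t w).card := by
  rw [mpc_nbrs, Multiset.count_map, ← Finset.filter_filter]
  simp only [Finset.filter_val, Finset.card_def, eq_comm]

theorem mpc_succ_eq_iff {t : ℕ} {u w : Fin G.order} : mpc G (t + 1) u = mpc G (t + 1) w ↔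
    mpc G t u = mpc G t w ∧ (mpc G (t + 1) u).nbrs = (mpc G (t + 1) w).nbrs :=
  Prod.ext_iff

theorem mpc_eq_of_le {s t : ℕ} (h : s ≤ t) {u w : Fin G.order} (e : mpc G t u = mpc G t w) :
    mpc G s u = mpc G s w := by
  induction t, h using Nat.le_induction with
  | base => exact e
  | succ t _ ih => exact ih (mpc_succ_eq_iff.1 e).1

/-- The partition into colour classes is the same after `t` and after `t + 1` rounds. -/
def StableAt (G : FeaturedGraph) (t : ℕ) : Prop :=
  ∀ u w, mpc G t u = mpc G t w → mpc G (t + 1) u = mpc G (t + 1) w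

theorem StableAt.succ {t : ℕ} (h : StableAt G t) : StableAt G (t + 1) := by
  classical
  intro u w e
  have factorsThrough : Function.FactorsThrough (mpc G (t + 1)) (mpc G t) := fun u w => h u w
  have nbrs_eq_map (u : Fin G.order) : (mpc G (t + 2) u).nbrs = (mpc G (t + 1) u).nbrs.map
      (Function.extend (mpc G t) (mpc G (t + 1)) fun _ => mpc G (t + 1) w) := by
    rw [mpc_nbrs, mpc_nbrs, Multiset.map_map]
    congr 1
    funext y
    exact (factorsThrough.extend_apply _ _).symm
  exact mpc_succ_eq_iff.2 ⟨e, by rw [nbrs_eq_map, nbrs_eq_map, e]⟩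

open Classical in
theorem card_image_mpc_lt {t : ℕ} (h : ¬StableAt G t) :
    (Finset.univ.image (mpc G t)).card < (Finset.univ.image (mpc G (t + 1))).card := by
  by_contra hle
  have image_prev : (Finset.univ.image (mpc G (t + 1))).image Color.prev =
      Finset.univ.image (mpc G t) := by
    rw [Finset.image_image]
    rfl
  have prev_injOn := Finset.card_image_iff.1 <| Finset.card_image_le.antisymm <|
    (not_lt.1 hle).trans_eq (congrArg Finset.card image_prev.symm)
  exact h fun u w e => prev_injOn (by simp) (by simp) e

theorem stableAt_of_le {t : ℕ} (ht : G.order - 1 ≤ t) : StableAt G t := by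
  classical
  intro u
  refine persistent_of_bounded (n := G.order) (P := StableAt G)
    (g := fun t => (Finset.univ.image (mpc G t)).card) ?_ (fun t => ?_)
    (fun t => card_image_mpc_lt) (fun t => StableAt.succ) ht u
  · exact Finset.card_pos.2 ⟨_, Finset.mem_image_of_mem _ (Finset.mem_univ u)⟩
  · exact Finset.card_image_le.trans (by simp)

theorem mpc_eq_of_stable {t : ℕ} (ht : G.order - 1 ≤ t) {u w : Fin G.order}
    (e : mpc G t u = mpc G t w) (s : ℕ) : mpc G s u = mpc G s w := by
  rcases le_total s t with h | h
  · exact mpc_eq_of_le h e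
  · induction s, h using Nat.le_induction with
    | base => exact e
    | succ s hs ih => exact stableAt_of_le (ht.trans hs) u w ih

/-! ### The nodes of the dag of a colour -/

/-- `Near v r u`: the vertex `u` belongs to the ball of radius `r` around `v`. -/
def Near (v : Fin G.order) (r : ℕ) (u : Fin G.order) : Prop :=
  ∃ p : G.graph.Walk v u, p.length ≤ r

theorem near_self (v : Fin G.order) (r : ℕ) : Near v r v := ⟨.nil, Nat.zero_le r⟩

theorem Near.mono {v u : Fin G.order} {r s : ℕ} (h : Near v r u) (hrs : r ≤ s) : Near v s u :=
  h.imp fun _ hp => hp.trans hrs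

theorem near_zero_iff {v u : Fin G.order} : Near v 0 u ↔ u = v :=
  ⟨fun ⟨_, hp⟩ => (SimpleGraph.Walk.eq_of_length_eq_zero (Nat.le_zero.1 hp)).symm,
    fun h => h ▸ near_self v 0⟩

theorem near_succ_iff {v u : Fin G.order} {r : ℕ} :
    Near v (r + 1) u ↔ Near v r u ∨ ∃ w, Near v r w ∧ G.graph.Adj w u := by
  constructor
  · rintro ⟨_ | ⟨h, p⟩, hp⟩
    · exact Or.inl (near_self _ r)
    · obtain ⟨w, q, h', eq_concat⟩ := SimpleGraph.Walk.exists_cons_eq_concat h p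
      rw [eq_concat, SimpleGraph.Walk.length_concat] at hp
      exact Or.inr ⟨w, ⟨q, Nat.le_of_succ_le_succ hp⟩, h'⟩
  · rintro (⟨p, hp⟩ | ⟨w, ⟨p, hp⟩, h⟩)
    · exact ⟨p, hp.trans (Nat.le_succ r)⟩
    · exact ⟨p.concat h, by rw [SimpleGraph.Walk.length_concat]; exact Nat.succ_le_succ hp⟩

theorem near_of_near {v : Fin G.order} {r : ℕ} (hr : G.order - 1 ≤ r) {s : ℕ} {u : Fin G.order}
    (hu : Near v s u) : Near v r u := by
  classical
  obtain ⟨p, -⟩ := hu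
  have := p.toPath.2.length_lt
  rw [Fintype.card_fin] at this
  exact ⟨p.toPath, by omega⟩

theorem near_closed {v : Fin G.order} {r : ℕ} (hr : G.order - 1 ≤ r) {u w : Fin G.order}
    (hu : Near v r u) (h : G.graph.Adj u w) : Near v r w :=
  near_of_near hr (near_succ_iff.2 (Or.inr ⟨u, hu, h⟩))

theorem occurs_of_near {v u : Fin G.order} {r i t : ℕ} (h : Near v r u) (ht : t = i + r) :
    Occurs (mpc G t v) i (mpc G i u) := by
  subst ht
  induction r generalizing u i with
  | zero => rw [near_zero_iff.1 h]; exact Occurs.top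
  | succ r ih =>
    rw [show i + (r + 1) = i + 1 + r by omega]
    rcases near_succ_iff.1 h with h | ⟨w, hw, hwu⟩
    · exact (ih h).prev
    · exact (ih hw).nbr (mem_mpc_nbrs.2 ⟨u, hwu, rfl⟩)

theorem exists_near_of_occurs {v : Fin G.order} {t i : ℕ} {d : Color i}
    (h : Occurs (mpc G t v) i d) : ∃ u, Near v (t - i) u ∧ mpc G i u = d := by
  induction h with
  | top => exact ⟨v, near_self _ _, rfl⟩
  | @prev i d h ih =>
    obtain ⟨u, hu, rfl⟩ := ih
    rw [show t - i = t - (i + 1) + 1 by have := h.le; omega]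
    exact ⟨u, near_succ_iff.2 (Or.inl hu), rfl⟩
  | @nbr i d e h he ih =>
    obtain ⟨u, hu, rfl⟩ := ih
    obtain ⟨w, hw, rfl⟩ := mem_mpc_nbrs.1 he
    rw [show t - i = t - (i + 1) + 1 by have := h.le; omega]
    exact ⟨w, near_succ_iff.2 (Or.inr ⟨u, hu, hw⟩), rfl⟩

section ColorDag

variable {v : Fin G.order} {t i : ℕ}

/-- A vertex whose colour is represented by a node. -/
noncomputable def nodeVertex (x : (colorDag (mpc G t v)).Node i) : Fin G.order :=
  (exists_near_of_occurs x.2).choose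

theorem near_nodeVertex (x : (colorDag (mpc G t v)).Node i) : Near v (t - i) (nodeVertex x) :=
  (exists_near_of_occurs x.2).choose_spec.1

theorem mpc_nodeVertex (x : (colorDag (mpc G t v)).Node i) : mpc G i (nodeVertex x) = x.1 :=
  (exists_near_of_occurs x.2).choose_spec.2

theorem nodeVertex_injective :
    Function.Injective (nodeVertex (G := G) (v := v) (t := t) (i := i)) := by
  intro x y h
  apply Subtype.ext
  rw [← mpc_nodeVertex x, ← mpc_nodeVertex y, h]

theorem width_le (N : Numbering (colorDag (mpc G t v))) (i : ℕ) : N.width i ≤ G.order := by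
  simpa using Fintype.card_le_of_injective (fun q => nodeVertex ((N.num i).symm q))
    (nodeVertex_injective.comp (N.num i).symm.injective)

instance : Finite ((colorDag (mpc G t v)).Node i) :=
  Finite.of_injective _ (nodeVertex_injective (G := G))

theorem nonempty_numbering (t : ℕ) (v : Fin G.order) :
    Nonempty (Numbering (colorDag (mpc G t v))) :=
  ⟨⟨fun _ => _, fun i => Finite.equivFin ((colorDag (mpc G t v)).Node i)⟩⟩

open Classical in
theorem edgeLabels_colorDag (c : Color t) (i : ℕ) (x : (colorDag c).Node (i + 1))
    (y : (colorDag c).Node i) : (colorDag c).edgeLabels i x y =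
      (if y.1 = x.1.prev then {0} else ∅) ∪
      (if y.1 ∈ x.1.nbrs then {x.1.nbrs.count y.1} else ∅) := by
  unfold colorDag
  congr!

theorem card_edgeLabels_le_two (c : Color t) (x : (colorDag c).Node (i + 1))
    (y : (colorDag c).Node i) : ((colorDag c).edgeLabels i x y).card ≤ 2 := by
  classical
  rw [edgeLabels_colorDag]
  refine (Finset.card_union_le _ _).trans ?_
  split_ifs <;> simp

theorem le_order_of_mem_edgeLabels {x : (colorDag (mpc G t v)).Node (i + 1)}
    {y : (colorDag (mpc G t v)).Node i} {m : ℕ}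
    (hm : m ∈ (colorDag (mpc G t v)).edgeLabels i x y) : m ≤ G.order := by
  classical
  have count_le : x.1.nbrs.count y.1 ≤ G.order := by
    refine (Multiset.count_le_card _ _).trans ?_
    rw [← mpc_nodeVertex x, mpc_nbrs, Multiset.card_map]
    exact (Finset.card_le_univ _).trans (by simp)
  rw [edgeLabels_colorDag, Finset.mem_union] at hm
  rcases hm with hm | hm <;> split_ifs at hm
  · exact (Finset.mem_singleton.1 hm).trans_le (Nat.zero_le _)
  · exact absurd hm (Finset.notMem_empty m)
  · exact (Finset.mem_singleton.1 hm).trans_le count_le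
  · exact absurd hm (Finset.notMem_empty m)

theorem length_leafLabel_le {k : ℕ} (hk : FeatureBound G k)
    (x : (colorDag (mpc G t v)).Node 0) : ((colorDag (mpc G t v)).leafLabel x).length ≤ k := by
  have leafLabel_eq : (colorDag (mpc G t v)).leafLabel x = G.feature (nodeVertex x) :=
    (mpc_nodeVertex x).symm
  exact leafLabel_eq ▸ hk _

end ColorDag

/-! ### Bounds for the lengths of the encodings -/

theorem length_encodeBits (b : List Bool) : (encodeBits b).length = b.length + 2 := by
  simp [encodeBits, paren]

theorem length_encodeNat (n : ℕ) : (encodeNat n).length = n + 2 := by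
  simp [encodeNat, paren]

theorem length_encodeList_le {l : List (List Sym)} {n B : ℕ} (hn : l.length ≤ n)
    (h : ∀ s ∈ l, s.length ≤ B) : (encodeList l).length ≤ n * B + 2 := by
  have length_flatten_le : l.flatten.length ≤ l.length * B := by
    rw [List.length_flatten]
    simpa using List.sum_le_card_nsmul (l.map List.length) B (by simpa using h)
  have := Nat.mul_le_mul_right B hn
  simp only [encodeList, paren, List.length_cons, List.length_append, List.length_nil]
  omega

theorem length_encodeList_ofFn_le {m n B : ℕ} {f : Fin m → List Sym} (hm : m ≤ n)
    (h : ∀ q, (f q).length ≤ B) : (encodeList (List.ofFn f)).length ≤ n * B + 2 :=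
  length_encodeList_le (by simpa using hm) (List.forall_mem_ofFn_iff.2 h)

theorem length_encodeDag_le {v : Fin G.order} {t : ℕ} (N : Numbering (colorDag (mpc G t v)))
    {k : ℕ} (hk : FeatureBound G k) : (encodeDag (colorDag (mpc G t v)) N).length ≤
      2 * ((G.order * (k + 2) + 2) +
        (t * (G.order * (G.order * (2 * (G.order + 2) + 2) + 2) + 2) + 2)) + 2 := by
  refine length_encodeList_le le_rfl ?_
  simp only [List.forall_mem_cons, List.not_mem_nil, false_imp_iff, implies_true, and_true]
  constructor
  · refine le_add_right (length_encodeList_ofFn_le (width_le N 0) fun q => ?_)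
    rw [length_encodeBits]
    exact Nat.add_le_add_right (length_leafLabel_le hk _) 2
  · refine le_add_left (length_encodeList_le (by simp [colorDag]) (List.forall_mem_map.2 ?_))
    refine fun i _ => length_encodeList_ofFn_le (width_le N (i + 1)) fun p =>
      length_encodeList_ofFn_le (width_le N i) fun q => length_encodeList_le ?_ ?_
    · rw [List.length_map, Finset.length_sort]
      exact card_edgeLabels_le_two _ _ _
    · refine List.forall_mem_map.2 fun m hm => ?_
      rw [length_encodeNat]
      exact Nat.add_le_add_right (le_order_of_mem_edgeLabels ((Finset.mem_sort _).1 hm)) 2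

theorem length_encodeRooted_le (v : Fin G.order) {k : ℕ} (hk : FeatureBound G k) :
    (encodeRooted G v).length ≤ 3 * ((G.order + 2) + (G.order * (k + 2) + 2) +
      (G.order * (G.order + 2) + 2)) + 2 := by
  refine length_encodeList_le le_rfl ?_
  simp only [List.forall_mem_cons, length_encodeBits, List.length_ofFn]
  refine ⟨by omega, (length_encodeList_ofFn_le (B := k + 2) le_rfl fun u => ?_).trans (by omega),
    (length_encodeList_ofFn_le (B := G.order + 2) le_rfl fun u => ?_).trans (by omega), by simp⟩
  · rw [length_encodeBits]
    exact Nat.add_le_add_right (hk u) 2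
  · rw [length_encodeBits, List.length_ofFn]

end FeaturedGraph

/-! ### Computing the dag from the graph -/

/-- The entry of a Boolean matrix. -/
def entry (E : List (List Bool)) (u w : ℕ) : Bool := (E.getD u []).getD w false

/-- The Boolean matrix with given entries. -/
def matrix (n : ℕ) (f : ℕ → ℕ → Bool) : List (List Bool) :=
  (List.range n).map fun u => (List.range n).map (f u)

/-- The number of neighbours of `u` in the graph with adjacency matrix `A` that are
equivalent to `x` with respect to `E`. -/
def classDegree (A E : List (List Bool)) (n u x : ℕ) : ℕ :=
  ((List.range n).filter fun y => entry A u y && entry E y x).length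

/-- One round of colour refinement; `E` is the matrix of the equivalence of vertices. -/
def refineStep (A : List (List Bool)) (n : ℕ) (E : List (List Bool)) : List (List Bool) :=
  matrix n fun u w => entry E u w &&
    (List.range n).all fun x => decide (classDegree A E n u x = classDegree A E n w x)

/-- The equivalence of vertices after `i` rounds. -/
def refined (B A : List (List Bool)) (n i : ℕ) : List (List Bool) :=
  (List.range i).foldl (fun E _ => refineStep A n E)
    (matrix n fun u w => decide (B.getD u [] = B.getD w []))

/-- Adding all neighbours to a set of vertices. -/
def ballStep (A : List (List Bool)) (n : ℕ) (R : List Bool) : List Bool :=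
  (List.range n).map fun u => R.getD u false ||
    (List.range n).any fun w => R.getD w false && entry A w u

/-- The vertices at distance at most `r` from the set `R`. -/
def ballList (R : List Bool) (A : List (List Bool)) (n r : ℕ) : List Bool :=
  (List.range r).foldl (fun R _ => ballStep A n R) R

/-- The first vertices of the equivalence classes in a set of vertices. -/
def representatives (R : List Bool) (E : List (List Bool)) (n : ℕ) : List ℕ :=
  (List.range n).filter fun u => R.getD u false &&
    (List.range u).all fun w => !(R.getD w false && entry E w u)

/-- The vertices that represent the nodes on level `i` of the dag. -/
def levelVertices (R : List Bool) (B A : List (List Bool)) (n i : ℕ) : List ℕ :=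
  representatives (ballList R A n (2 * n - i)) (refined B A n i) n

/-- The labels of the edges between two nodes of the dag. -/
def edgeList (A E : List (List Bool)) (n p q : ℕ) : List ℕ :=
  (bif entry E p q then [0] else []) ++
    (if classDegree A E n p q = 0 then [] else [classDegree A E n p q])

/-- The string for the dag, computed from the indicator list `R` of the root, the list `B` of the
features and the adjacency matrix `A`. -/
def dagString (R : List Bool) (B A : List (List Bool)) : List Sym :=
  encodeList
    [ encodeList ((levelVertices R B A B.length 0).map fun u => encodeBits (B.getD u [])),
      encodeList ((List.range (2 * B.length)).map fun i =>
        encodeList ((levelVertices R B A B.length (i + 1)).map fun p =>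
          encodeList ((levelVertices R B A B.length i).map fun q =>
            encodeList ((edgeList A (refined B A B.length i) B.length p q).map encodeNat)))) ]

section PolyTime

variable {α : Type} [TreeRep α]

@[fun_prop]
theorem polyTime_entry {E : α → List (List Bool)} {u w : α → ℕ} (hE : PolyTime E)
    (hu : PolyTime u) (hw : PolyTime w) : PolyTime (fun a => entry (E a) (u a) (w a)) := by
  unfold entry; fun_prop

theorem polyTime_matrix {n : α → ℕ} {f : α → ℕ → ℕ → Bool} (hn : PolyTime n)
    (hf : PolyTime (fun q : (α × ℕ) × ℕ => f q.1.1 q.1.2 q.2)) :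
    PolyTime (fun a => matrix (n a) (f a)) := by
  unfold matrix
  exact .map (by fun_prop) (.map (by fun_prop) hf)

theorem rsize_bits_le (l : List Bool) : rsize l ≤ 4 * l.length + 1 :=
  (rsize_list_le fun a _ => rsize_bool_le a).trans_eq (by rw [mul_comm])

theorem rsize_matrix_le (n : ℕ) (f : ℕ → ℕ → Bool) :
    rsize (matrix n f) ≤ n * (4 * n + 2) + 1 := by
  have rsize_row_le : ∀ a ∈ matrix n f, rsize a ≤ 4 * n + 1 := by
    refine List.forall_mem_map.2 fun u _ => ?_
    simpa using rsize_bits_le ((List.range n).map (f u))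
  simpa [matrix] using rsize_list_le rsize_row_le

theorem PolyTime.exists_le {n : α → ℕ} (hn : PolyTime n) :
    ∃ p : Polynomial ℕ, ∀ a, n a ≤ p.eval (rsize a) := by
  obtain ⟨p, hp⟩ := hn.exists_rsize_le
  refine ⟨p, fun a => ?_⟩
  have := hp a
  rw [rsize_nat] at this
  omega

@[fun_prop]
theorem polyTime_classDegree {A E : α → List (List Bool)} {n u x : α → ℕ} (hA : PolyTime A)
    (hE : PolyTime E) (hn : PolyTime n) (hu : PolyTime u) (hx : PolyTime x) :
    PolyTime (fun a => classDegree (A a) (E a) (n a) (u a) (x a)) := by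
  unfold classDegree; fun_prop

@[fun_prop]
theorem polyTime_refineStep {A E : α → List (List Bool)} {n : α → ℕ} (hA : PolyTime A)
    (hE : PolyTime E) (hn : PolyTime n) : PolyTime (fun a => refineStep (A a) (n a) (E a)) := by
  unfold refineStep
  exact polyTime_matrix hn (by fun_prop)

@[fun_prop]
theorem polyTime_refined {A B : α → List (List Bool)} {n i : α → ℕ} (hB : PolyTime B)
    (hA : PolyTime A) (hn : PolyTime n) (hi : PolyTime i) :
    PolyTime (fun a => refined (B a) (A a) (n a) (i a)) := by
  obtain ⟨p, hp⟩ := hn.exists_le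
  refine PolyTime.foldl_of_add_le (by fun_prop)
    (polyTime_matrix hn (PolyTime.decide_eq_bits (by fun_prop) (by fun_prop))) (by fun_prop)
    ⟨p * (4 * p + 2) + 1, fun a b _ t => ?_⟩
  refine (rsize_matrix_le _ _).trans (le_add_left ?_)
  simp only [Polynomial.eval_add, Polynomial.eval_mul, Polynomial.eval_ofNat, Polynomial.eval_one]
  gcongr <;> exact hp a

@[fun_prop]
theorem polyTime_ballList {R : α → List Bool} {A : α → List (List Bool)} {n r : α → ℕ}
    (hR : PolyTime R) (hA : PolyTime A) (hn : PolyTime n) (hr : PolyTime r) :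
    PolyTime (fun a => ballList (R a) (A a) (n a) (r a)) := by
  obtain ⟨p, hp⟩ := hn.exists_le
  refine PolyTime.foldl_of_add_le (by fun_prop) hR (by unfold ballStep; fun_prop)
    ⟨4 * p + 1, fun a b _ t => ?_⟩
  refine (rsize_bits_le _).trans (le_add_left ?_)
  simp only [ballStep, List.length_map, List.length_range, Polynomial.eval_add,
    Polynomial.eval_mul, Polynomial.eval_ofNat, Polynomial.eval_one]
  gcongr
  exact hp a

@[fun_prop]
theorem polyTime_levelVertices {R : α → List Bool} {B A : α → List (List Bool)} {n i : α → ℕ}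
    (hR : PolyTime R) (hB : PolyTime B) (hA : PolyTime A) (hn : PolyTime n) (hi : PolyTime i) :
    PolyTime (fun a => levelVertices (R a) (B a) (A a) (n a) (i a)) := by
  unfold levelVertices representatives
  fun_prop

theorem polyTime_edgeList {A E : α → List (List Bool)} {n p q : α → ℕ} (hA : PolyTime A)
    (hE : PolyTime E) (hn : PolyTime n) (hp : PolyTime p) (hq : PolyTime q) :
    PolyTime (fun a => edgeList (A a) (E a) (n a) (p a) (q a)) := by
  unfold edgeList
  exact .append (.cond (by fun_prop) (by fun_prop) (by fun_prop))
    (.ite (by fun_prop) (by fun_prop) (by fun_prop))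

theorem polyTime_dagString {R : α → List Bool} {B A : α → List (List Bool)} (hR : PolyTime R)
    (hB : PolyTime B) (hA : PolyTime A) : PolyTime (fun a => dagString (R a) (B a) (A a)) := by
  unfold dagString
  refine .encodeList (.cons (.encodeList (.map (by fun_prop) (.encodeBits (by fun_prop))))
    (.cons (.encodeList (.map (by fun_prop) (.encodeList (.map (by fun_prop) (.encodeList
      (.map (by fun_prop) (.encodeList (.map (polyTime_edgeList ?_ ?_ ?_ ?_ ?_)
        (.encodeNat (by fun_prop)))))))))) (by fun_prop))) <;> fun_prop

end PolyTime

theorem entry_matrix {n u w : ℕ} (f : ℕ → ℕ → Bool) (hu : u < n) (hw : w < n) :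
    entry (matrix n f) u w = f u w := by
  simp [entry, matrix, hu, hw]

theorem entry_ofFn {n : ℕ} (f : Fin n → Fin n → Bool) (u w : Fin n) :
    entry (List.ofFn fun u => List.ofFn (f u)) u w = f u w := by
  simp [entry]

theorem length_filter_range_eq_card_fin (n : ℕ) (f : ℕ → Bool) :
    ((List.range n).filter f).length = (Finset.univ.filter fun y : Fin n => f y = true).card := by
  rw [← List.map_coe_finRange_eq_range, List.filter_map, List.length_map,
    ← List.toFinset_card_of_nodup ((List.nodup_finRange n).filter _)]
  congr 1
  ext y
  simp

section Correct

variable (G : FeaturedGraph) (v : Fin G.order)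

open Classical in
/-- The adjacency matrix of `G`. -/
noncomputable def adjList : List (List Bool) :=
  List.ofFn fun u => List.ofFn fun w => decide (G.graph.Adj u w)

/-- The data represented by the string for a rooted graph. -/
noncomputable def rootedData : List Bool × List (List Bool) × List (List Bool) × Unit :=
  (List.ofFn fun u => decide (u = v), List.ofFn G.feature, adjList G, ())

theorem represents_encodeRooted : Represents (encodeRooted G v) (rootedData G v) := by
  refine represents_encodeList_triple ?_ ?_ ?_
  · convert represents_encodeBits _
  · simp only [List.ofFn_eq_map]
    exact represents_encodeList fun _ _ => represents_encodeBits _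
  · simp only [adjList, List.ofFn_eq_map (f := fun _ => encodeBits _),
      List.ofFn_eq_map (f := fun _ => List.ofFn _)]
    exact represents_encodeList fun _ _ => represents_encodeBits _

open Classical in
theorem entry_adjList (u w : Fin G.order) : entry (adjList G) u w = decide (G.graph.Adj u w) :=
  entry_ofFn _ u w

variable {G v}

open Classical in
theorem classDegree_eq {E : List (List Bool)} {i : ℕ}
    (hE : ∀ u w : Fin G.order, entry E u w = decide (mpc G i u = mpc G i w)) (u x : Fin G.order) :
    classDegree (adjList G) E G.order u x = (mpc G (i + 1) u).nbrs.count (mpc G i x) := by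
  rw [classDegree, length_filter_range_eq_card_fin, count_mpc_nbrs]
  simp [entry_adjList, hE]

open Classical in
theorem mpc_nbrs_eq_iff {i : ℕ} {u w : Fin G.order} :
    (mpc G (i + 1) u).nbrs = (mpc G (i + 1) w).nbrs ↔
      ∀ x, (mpc G (i + 1) u).nbrs.count (mpc G i x) =
        (mpc G (i + 1) w).nbrs.count (mpc G i x) := by
  refine ⟨fun h x => by rw [h], fun h => Multiset.ext.2 fun c => ?_⟩
  by_cases hc : ∃ x, mpc G i x = c
  · obtain ⟨x, rfl⟩ := hc
    exact h x
  · have notMem (u : Fin G.order) : c ∉ (mpc G (i + 1) u).nbrs := fun hm =>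
      hc ((mem_mpc_nbrs.1 hm).imp fun _ => And.right)
    rw [Multiset.count_eq_zero_of_notMem (notMem u), Multiset.count_eq_zero_of_notMem (notMem w)]

theorem refined_succ (B A : List (List Bool)) (n i : ℕ) :
    refined B A n (i + 1) = refineStep A n (refined B A n i) := by
  rw [refined, List.range_succ, List.foldl_concat, refined]

theorem ballList_succ (R : List Bool) (A : List (List Bool)) (n r : ℕ) :
    ballList R A n (r + 1) = ballStep A n (ballList R A n r) := by
  rw [ballList, List.range_succ, List.foldl_concat, ballList]

open Classical in
theorem entry_refined (i : ℕ) (u w : Fin G.order) :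
    entry (refined (List.ofFn G.feature) (adjList G) G.order i) u w =
      decide (mpc G i u = mpc G i w) := by
  induction i generalizing u w with
  | zero =>
    rw [refined, List.range_zero, List.foldl_nil, entry_matrix _ u.2 w.2]
    simp only [List.getD_eq_getElem?_getD, List.getElem?_ofFn, Fin.is_lt, dite_true, Fin.eta,
      Option.getD_some]
    congr!
  | succ i ih =>
    rw [refined_succ, refineStep, entry_matrix _ u.2 w.2, ih, Bool.eq_iff_iff]
    simp only [Bool.and_eq_true, decide_eq_true_eq, List.all_eq_true, List.mem_range]
    rw [mpc_succ_eq_iff, mpc_nbrs_eq_iff]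
    rw [Fin.forall_iff]
    refine and_congr_right' (forall₂_congr fun x hx => ?_)
    rw [← classDegree_eq ih, ← classDegree_eq ih]

open Classical in
theorem getD_ballList (r : ℕ) (u : Fin G.order) :
    (ballList (List.ofFn fun u => decide (u = v)) (adjList G) G.order r).getD u false =
      decide (Near v r u) := by
  induction r generalizing u with
  | zero => simp [ballList, near_zero_iff]
  | succ r ih =>
    rw [ballList_succ, ballStep, List.getD_eq_getElem _ _ (by simp), List.getElem_map,
      List.getElem_range, ih, Bool.eq_iff_iff]
    simp only [Bool.or_eq_true, decide_eq_true_eq, List.any_eq_true, List.mem_range,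
      Bool.and_eq_true, near_succ_iff]
    simp only [Fin.exists_iff, ← exists_prop (a := _ < G.order)]
    refine or_congr_right (exists₂_congr fun w hw => ?_)
    lift w to Fin G.order using hw
    rw [ih, entry_adjList, decide_eq_true_iff, decide_eq_true_iff]

open Classical in
/-- The first vertices with the colours that occur on level `i` of the dag of height `t`. -/
noncomputable def nodeList (v : Fin G.order) (t i : ℕ) : List (Fin G.order) :=
  (List.finRange G.order).filter fun u => i ≤ t ∧ Near v (t - i) u ∧
    ∀ w < u, ¬(Near v (t - i) w ∧ mpc G i w = mpc G i u)

theorem levelVertices_eq {i : ℕ} (hi : i ≤ 2 * G.order) :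
    levelVertices (List.ofFn fun u => decide (u = v)) (List.ofFn G.feature) (adjList G) G.order i =
      (nodeList v (2 * G.order) i).map Fin.val := by
  rw [levelVertices, representatives, nodeList, ← List.map_coe_finRange_eq_range, List.filter_map]
  congr 1
  refine List.filter_congr fun u _ => ?_
  simp only [Function.comp_apply, getD_ballList]
  rw [Bool.eq_iff_iff]
  simp only [hi, true_and, Bool.and_eq_true, decide_eq_true_eq, List.all_eq_true, List.mem_range]
  refine and_congr_right' ⟨fun h w hw => ?_, fun h w hw => ?_⟩
  · have := h w hw
    rw [getD_ballList, entry_refined] at this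
    simpa [imp_iff_not_or] using this
  · lift w to Fin G.order using hw.trans u.2
    rw [getD_ballList, entry_refined]
    simpa [imp_iff_not_or] using h w hw

theorem mem_nodeList {t i : ℕ} {u : Fin G.order} : u ∈ nodeList v t i ↔ i ≤ t ∧ Near v (t - i) u ∧
    ∀ w < u, ¬(Near v (t - i) w ∧ mpc G i w = mpc G i u) := by
  simp [nodeList]

theorem occurs_of_mem_nodeList {t i : ℕ} {u : Fin G.order} (h : u ∈ nodeList v t i) :
    Occurs (mpc G t v) i (mpc G i u) :=
  occurs_of_near (mem_nodeList.1 h).2.1 (by have := (mem_nodeList.1 h).1; omega)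

/-- The node that represents the colour of the `q`-th vertex of `nodeList v t i`. -/
noncomputable def nodeOf (v : Fin G.order) (t i : ℕ) (q : Fin (nodeList v t i).length) :
    (colorDag (mpc G t v)).Node i :=
  ⟨mpc G i (nodeList v t i)[q], occurs_of_mem_nodeList (List.getElem_mem _)⟩

theorem nodeOf_bijective (v : Fin G.order) (t i : ℕ) : Function.Bijective (nodeOf v t i) := by
  constructor
  · intro p q h
    have mpc_eq : mpc G i (nodeList v t i)[p] = mpc G i (nodeList v t i)[q] :=
      congrArg Subtype.val h
    obtain ⟨-, p_near, p_first⟩ := mem_nodeList.1 (List.getElem_mem p.2)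
    obtain ⟨-, q_near, q_first⟩ := mem_nodeList.1 (List.getElem_mem q.2)
    have nodup : (nodeList v t i).Nodup := (List.nodup_finRange _).filter _
    refine Fin.ext ((nodup.getElem_inj_iff (hi := p.2) (hj := q.2)).1 ?_)
    rcases lt_trichotomy (nodeList v t i)[p] (nodeList v t i)[q] with hlt | heq | hlt
    · exact absurd ⟨p_near, mpc_eq⟩ (q_first _ hlt)
    · exact heq
    · exact absurd ⟨q_near, mpc_eq.symm⟩ (p_first _ hlt)
  · rintro ⟨d, hd⟩
    obtain ⟨u₀, hu₀, hd₀⟩ := exists_near_of_occurs hd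
    obtain ⟨u, ⟨hu, hdu⟩, u_min⟩ := WellFounded.has_min (wellFounded_lt (α := Fin G.order))
      {u | Near v (t - i) u ∧ mpc G i u = d} ⟨u₀, hu₀, hd₀⟩
    have u_mem : u ∈ nodeList v t i :=
      mem_nodeList.2 ⟨hd.le, hu, fun w hw h => u_min w ⟨h.1, h.2.trans hdu⟩ hw⟩
    obtain ⟨q, hq, e⟩ := List.getElem_of_mem u_mem
    exact ⟨⟨q, hq⟩, Subtype.ext (by simp only [nodeOf, Fin.getElem_fin, e, hdu])⟩

/-- The numbering of the nodes by the first vertices with their colours. -/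
noncomputable def nodeNumbering (v : Fin G.order) (t : ℕ) : Numbering (colorDag (mpc G t v)) where
  width i := (nodeList v t i).length
  num i := (Equiv.ofBijective _ (nodeOf_bijective v t i)).symm

theorem ofFn_getElem_eq_map {α β : Type*} (l : List α) (f : Fin l.length → β) (g : α → β)
    (h : ∀ q, f q = g l[q]) : List.ofFn f = l.map g :=
  List.ext_getElem (by simp) (by simp [h])

theorem sort_edgeLabels {i t : ℕ} (x : (colorDag (mpc G t v)).Node (i + 1))
    (y : (colorDag (mpc G t v)).Node i) {p q : Fin G.order} (hx : x.1 = mpc G (i + 1) p)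
    (hy : y.1 = mpc G i q) : ((colorDag (mpc G t v)).edgeLabels i x y).sort (· ≤ ·) =
      edgeList (adjList G) (refined (List.ofFn G.feature) (adjList G) G.order i) G.order p q := by
  classical
  rw [edgeLabels_colorDag, edgeList, classDegree_eq (entry_refined i), entry_refined, hx, hy,
    mpc_prev, eq_comm (a := mpc G i q)]
  set c := (mpc G (i + 1) p).nbrs.count (mpc G i q) with hc
  have mem_iff : mpc G i q ∈ (mpc G (i + 1) p).nbrs ↔ c ≠ 0 := by
    rw [hc, Ne, Multiset.count_eq_zero, not_not]
  by_cases same_color : mpc G i p = mpc G i q <;> by_cases c_zero : c = 0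
  · simp [same_color, c_zero, mem_iff]
  · simp only [same_color, mem_iff, c_zero, if_true, ne_eq, not_false_eq_true, decide_true,
      cond_true, if_false]
    have pair_eq : ({0} ∪ {c} : Finset ℕ) = [0, c].toFinset := by
      ext
      simp
    rw [pair_eq]
    exact (List.toFinset_sort (r := (· ≤ ·)) (by simp; omega)).2 (by simp)
  · simp [same_color, c_zero, mem_iff]
  · simp [same_color, c_zero, mem_iff]

theorem dagString_eq (G : FeaturedGraph) (v : Fin G.order) :
    dagString (List.ofFn fun u => decide (u = v)) (List.ofFn G.feature) (adjList G) =
      encodeDag (colorDag (finalColor G v)) (nodeNumbering v (2 * G.order)) := by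
  simp only [dagString, encodeDag, List.length_ofFn]
  congr 2
  · congr 1
    rw [levelVertices_eq (by omega), List.map_map]
    refine (ofFn_getElem_eq_map (nodeList v (2 * G.order) 0) _ _ fun q => ?_).symm
    rw [Function.comp_apply, List.getD_eq_getElem _ _ (by simp), List.getElem_ofFn]
    rfl
  · congr 2
    refine List.map_congr_left fun i hi => ?_
    have hi : i < 2 * G.order := List.mem_range.1 hi
    congr 1
    rw [levelVertices_eq (by omega), levelVertices_eq (by omega), List.map_map]
    refine (ofFn_getElem_eq_map (nodeList v (2 * G.order) (i + 1)) _ _ fun p => ?_).symm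
    rw [Function.comp_apply, List.map_map]
    congr 1
    refine ofFn_getElem_eq_map (nodeList v (2 * G.order) i) _ _ fun q => ?_
    rw [Function.comp_apply]
    congr 2
    exact sort_edgeLabels (t := 2 * G.order) _ _ rfl rfl

end Correct

/-! ### Regular and biregular graphs -/

theorem length_filter_range_eq_card (n : ℕ) (f : ℕ → Bool) :
    ((List.range n).filter f).length = ((Finset.range n).filter fun y => f y = true).card := by
  rw [← List.countP_eq_length_filter, ← Nat.count_eq_card_filter_range, Nat.count]
  simp

/-- The adjacency of a bipartite graph with parts of sizes `N` and `N'` and degrees `d` and `e`,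
where `N * d = N' * e`: the `i`-th of these `N * d` edges joins `i / d` to `i % N'`. -/
def between (d e N' a b : ℕ) : Bool :=
  (List.range e).any fun j => decide (a * d ≤ b + j * N') && decide (b + j * N' < a * d + d)

theorem between_iff {d e N' a b : ℕ} :
    between d e N' a b = true ↔ ∃ j < e, a * d ≤ b + j * N' ∧ b + j * N' < a * d + d := by
  simp [between]

theorem card_between_left {N N' d e a : ℕ} (h : N * d = N' * e) (hd : d ≤ N') (ha : a < N) :
    ((List.range N').filter (between d e N' a)).length = d := by
  rw [length_filter_range_eq_card]
  have edge_lt (i : ℕ) (hi : i < d) : a * d + i < N' * e := by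
    have : (a + 1) * d ≤ N * d := Nat.mul_le_mul_right d ha
    rw [Nat.succ_mul] at this
    omega
  conv_rhs => rw [← Finset.card_range d]
  symm
  refine Finset.card_bij (fun i _ => (a * d + i) % N') (fun i hi => ?_) (fun i hi j hj hij => ?_)
    fun b hb => ?_
  · have hi := Finset.mem_range.1 hi
    simp only [Finset.mem_filter, Finset.mem_range, between_iff]
    refine ⟨Nat.mod_lt _ (by omega), (a * d + i) / N', Nat.div_lt_of_lt_mul (edge_lt i hi), ?_⟩
    have := Nat.mod_add_div (a * d + i) N'
    rw [mul_comm N'] at this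
    omega
  · have hi := Finset.mem_range.1 hi
    have hj := Finset.mem_range.1 hj
    have i_modEq_j : i ≡ j [MOD N'] := Nat.ModEq.add_left_cancel' (a * d) hij
    exact i_modEq_j.eq_of_lt_of_lt (by omega) (by omega)
  · simp only [Finset.mem_filter, Finset.mem_range, between_iff] at hb
    obtain ⟨hb, j, _, hle, hlt⟩ := hb
    refine ⟨b + j * N' - a * d, Finset.mem_range.2 (by omega), ?_⟩
    rw [Nat.add_sub_cancel' hle, Nat.add_mul_mod_self_right, Nat.mod_eq_of_lt hb]

theorem strictMono_add_mul_div {d n : ℕ} (hd : 0 < d) (h : d ≤ n) (b : ℕ) :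
    StrictMono fun j => (b + j * n) / d :=
  strictMono_nat_of_lt_succ fun j => by
    rw [← Nat.succ_le_iff, Nat.succ_eq_add_one, ← Nat.add_div_right _ hd, Nat.succ_mul]
    exact Nat.div_le_div_right (by omega)

theorem card_between_right {N N' d e b : ℕ} (h : N * d = N' * e) (hd : d ≤ N') (hb : b < N') :
    ((List.range N).filter fun a => between d e N' a b).length = e := by
  rw [length_filter_range_eq_card]
  have edge_lt (j : ℕ) (hj : j < e) : b + j * N' < N * d := by
    have : (j + 1) * N' ≤ e * N' := Nat.mul_le_mul_right N' hj
    rw [Nat.succ_mul, mul_comm e, ← h] at this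
    omega
  have d_pos (j : ℕ) (hj : j < e) : 0 < d :=
    Nat.pos_of_mul_pos_left (Nat.zero_lt_of_lt (edge_lt j hj))
  conv_rhs => rw [← Finset.card_range e]
  symm
  refine Finset.card_bij (fun j _ => (b + j * N') / d) (fun j hj => ?_) (fun i hi j _ hij => ?_)
    fun a ha => ?_
  · have hj := Finset.mem_range.1 hj
    simp only [Finset.mem_filter, Finset.mem_range, between_iff]
    refine ⟨Nat.div_lt_of_lt_mul ((edge_lt j hj).trans_eq (mul_comm N d)), j, hj,
      Nat.div_mul_le_self _ _, ?_⟩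
    exact Nat.lt_div_mul_add (d_pos j hj)
  · exact (strictMono_add_mul_div (d_pos i (Finset.mem_range.1 hi)) hd b).injective hij
  · simp only [Finset.mem_filter, Finset.mem_range, between_iff] at ha
    obtain ⟨_, j, hj, hle, hlt⟩ := ha
    exact ⟨j, Finset.mem_range.2 hj, Nat.div_eq_of_lt_le hle (hlt.trans_eq (Nat.succ_mul a d).symm)⟩

/-- The jumps of a `d`-regular circulant graph with `N` vertices, where `N * d` is even: the numbers
up to `d / 2`, their negatives modulo `N`, and `N / 2` if `d` is odd. -/
def isJump (N d x : ℕ) : Bool :=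
  decide (x ≠ 0) && (decide (2 * x ≤ d) || (decide (2 * (N - x) ≤ d) ||
    (decide (2 * x = N) && decide (d % 2 = 1))))

theorem isJump_iff {N d x : ℕ} : isJump N d x = true ↔
    x ≠ 0 ∧ (2 * x ≤ d ∨ 2 * (N - x) ≤ d ∨ (2 * x = N ∧ d % 2 = 1)) := by
  simp only [isJump, Bool.and_eq_true, Bool.or_eq_true, decide_eq_true_eq]

/-- The adjacency of a circulant graph with `N` vertices of degree `d`. -/
def within (N d a b : ℕ) : Bool := isJump N d (Nat.dist a b)

theorem within_comm (N d a b : ℕ) : within N d a b = within N d b a := by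
  rw [within, within, Nat.dist_comm]

theorem card_jumps {N d : ℕ} (hd : d < N) (hparity : Even (N * d)) :
    ((Finset.range N).filter fun x => isJump N d x = true).card = d := by
  have hodd : d % 2 = 1 → N % 2 = 0 := by
    rw [Nat.even_mul, Nat.even_iff, Nat.even_iff] at hparity
    omega
  have jumps_eq : ((Finset.range N).filter fun x => isJump N d x = true) =
      (Finset.Ico 1 (d / 2 + 1) ∪ Finset.Ico (N - d / 2) N) ∪
        (Finset.Ico (N / 2) (N / 2 + d % 2)) := by
    ext x
    simp only [Finset.mem_filter, Finset.mem_range, Finset.mem_union, Finset.mem_Ico, isJump_iff]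
    omega
  rw [jumps_eq, Finset.card_union_of_disjoint, Finset.card_union_of_disjoint]
  · simp only [Nat.card_Ico]
    omega
  · rw [Finset.disjoint_left]
    intro x
    simp only [Finset.mem_Ico]
    omega
  · rw [Finset.disjoint_left]
    intro x
    simp only [Finset.mem_union, Finset.mem_Ico]
    omega

theorem card_within {N d a : ℕ} (hd : d < N) (hparity : Even (N * d)) (ha : a < N) :
    ((List.range N).filter (within N d a)).length = d := by
  rw [length_filter_range_eq_card]
  refine Eq.trans ?_ (card_jumps hd hparity)
  refine Finset.card_nbij' (fun b => if a ≤ b then b - a else b + N - a)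
    (fun x => if a + x < N then a + x else a + x - N) ?_ ?_ ?_ ?_ <;> intro b hb <;>
    simp only [Finset.coe_filter, Finset.mem_range, Set.mem_ofPred_eq, within, isJump_iff,
      Nat.dist] at hb ⊢ <;>
    split_ifs <;> omega

/-! ### Graphs with a prescribed degree matrix -/

/-- The conditions under which there is a graph with `f c` vertices in the class `c`, for `c < m`,
in which every vertex of the class `c` has `d c c'` neighbours in the class `c'`. -/
structure Admissible (m : ℕ) (d : ℕ → ℕ → ℕ) (f : ℕ → ℕ) : Prop where
  balance : ∀ c < m, ∀ c' < m, f c * d c c' = f c' * d c' c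
  le : ∀ c < m, ∀ c' < m, d c' c ≤ f c
  lt : ∀ c < m, d c c < f c
  even : ∀ c < m, Even (f c * d c c)

section Admissible

variable {m : ℕ} {d : ℕ → ℕ → ℕ} {f : ℕ → ℕ}

/-- The adjacency of the graph whose vertices are the pairs `(c, a)` with `c < m` and `a < f c`. -/
def cellAdj (m : ℕ) (d : ℕ → ℕ → ℕ) (f : ℕ → ℕ) (x y : ℕ × ℕ) : Bool :=
  decide (x.1 < m) && (decide (y.1 < m) &&
    (if x.1 = y.1 then within (f x.1) (d x.1 x.1) x.2 y.2
      else if x.1 < y.1 then between (d x.1 y.1) (d y.1 x.1) (f y.1) x.2 y.2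
      else between (d y.1 x.1) (d x.1 y.1) (f x.1) y.2 x.2))

theorem cellAdj_comm (m : ℕ) (d : ℕ → ℕ → ℕ) (f : ℕ → ℕ) (x y : ℕ × ℕ) :
    cellAdj m d f x y = cellAdj m d f y x := by
  unfold cellAdj
  rcases lt_trichotomy x.1 y.1 with h | h | h
  · simp [h, h.ne, h.ne', h.not_gt, Bool.and_left_comm]
  · simp [h, within_comm]
  · simp [h, h.ne, h.ne', h.not_gt, Bool.and_left_comm]

theorem cellAdj_self (m : ℕ) (d : ℕ → ℕ → ℕ) (f : ℕ → ℕ) (x : ℕ × ℕ) :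
    cellAdj m d f x x = false := by
  simp [cellAdj, within, isJump]

theorem Admissible.card_cellAdj (h : Admissible m d f) {c a c' : ℕ} (hc : c < m) (ha : a < f c)
    (hc' : c' < m) :
    ((List.range (f c')).filter fun b => cellAdj m d f (c, a) (c', b)).length = d c c' := by
  rcases lt_trichotomy c c' with hlt | rfl | hlt
  · simp only [cellAdj, hc, hc', hlt, hlt.ne, decide_true, Bool.true_and, if_false, if_true]
    exact card_between_left (h.balance c hc c' hc') (h.le c' hc' c hc) ha
  · simp only [cellAdj, hc, decide_true, Bool.true_and, if_true]
    exact card_within (h.lt c hc) (h.even c hc) ha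
  · simp only [cellAdj, hc, hc', hlt.not_gt, hlt.ne', decide_true, Bool.true_and, if_false]
    exact card_between_right (h.balance c' hc' c hc) (h.le c hc c' hc') ha

/-! ### Finding the sizes of the classes -/

/-- The size `f c` of the class `c` is too small to be admissible together with the sizes `f c'` or
larger ones of the other classes. -/
def tooSmall (m : ℕ) (d : ℕ → ℕ → ℕ) (f : ℕ → ℕ) (c : ℕ) : Bool :=
  ((List.range m).any fun c' =>
    decide (f c * d c c' < f c' * d c' c) || decide (f c < d c' c)) ||
  (decide (f c ≤ d c c) || decide ((f c * d c c) % 2 = 1))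

theorem tooSmall_iff {c : ℕ} : tooSmall m d f c = true ↔
    (∃ c' < m, f c * d c c' < f c' * d c' c ∨ f c < d c' c) ∨
      f c ≤ d c c ∨ (f c * d c c) % 2 = 1 := by
  simp [tooSmall]

theorem tooSmall_congr {f' : ℕ → ℕ} (h : ∀ c < m, f c = f' c) {c : ℕ} (hc : c < m) :
    tooSmall m d f c = tooSmall m d f' c := by
  rw [Bool.eq_iff_iff, tooSmall_iff, tooSmall_iff, h c hc]
  refine or_congr_left (exists_congr fun c' => and_congr_right fun hc' => ?_)
  rw [h c' hc']

theorem admissible_of_not_tooSmall (h : ∀ c < m, tooSmall m d f c = false) :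
    Admissible m d f := by
  have large_enough (c : ℕ) (hc : c < m) :
      (∀ c' < m, f c' * d c' c ≤ f c * d c c' ∧ d c' c ≤ f c) ∧
        d c c < f c ∧ Even (f c * d c c) := by
    have := h c hc
    rw [← Bool.not_eq_true, tooSmall_iff] at this
    push Not at this
    exact ⟨this.1, this.2.1, Nat.not_odd_iff_even.1 (this.2.2 ∘ Nat.odd_iff.1)⟩
  exact ⟨fun c hc c' hc' => le_antisymm ((large_enough c' hc').1 c hc).1
      ((large_enough c hc).1 c' hc').1,
    fun c hc c' hc' => ((large_enough c hc).1 c' hc').2, fun c hc => (large_enough c hc).2.1,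
    fun c hc => (large_enough c hc).2.2⟩

theorem Admissible.lt_of_tooSmall {g : ℕ → ℕ} (hg : Admissible m d g)
    (hfg : ∀ c < m, f c ≤ g c) {c : ℕ} (hc : c < m) (h : tooSmall m d f c = true) : f c < g c := by
  refine lt_of_le_of_ne (hfg c hc) fun e => ?_
  rw [tooSmall_iff, e] at h
  rcases h with ⟨c', hc', h | h⟩ | h | h
  · rw [hg.balance c hc c' hc'] at h
    exact absurd (Nat.mul_le_mul_right _ (hfg c' hc')) (not_le.2 h)
  · exact absurd (hg.le c hc c' hc') (not_le.2 h)
  · exact absurd (hg.lt c hc) (not_lt.2 h)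
  · exact Nat.not_even_iff.2 h (hg.even c hc)

/-- Increase all sizes that are too small. -/
def growStep (m : ℕ) (d : ℕ → ℕ → ℕ) (N : List ℕ) : List ℕ :=
  (List.range m).map fun c =>
    bif tooSmall m d (fun c => N.getD c 0) c then N.getD c 0 + 1 else N.getD c 0

/-- The sizes after `n` rounds of increasing, beginning with `1`. -/
def classSizes (m : ℕ) (d : ℕ → ℕ → ℕ) (n : ℕ) : List ℕ :=
  (List.range n).foldl (fun N _ => growStep m d N) ((List.range m).map fun _ => 1)

/-- The size of the class `c` after `n` rounds of increasing. -/
def classSize (m : ℕ) (d : ℕ → ℕ → ℕ) (n c : ℕ) : ℕ := (classSizes m d n).getD c 0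

theorem classSize_zero {c : ℕ} (hc : c < m) : classSize m d 0 c = 1 := by
  simp [classSize, classSizes, hc]

theorem classSize_succ (n : ℕ) {c : ℕ} (hc : c < m) : classSize m d (n + 1) c =
    bif tooSmall m d (classSize m d n) c then classSize m d n c + 1 else classSize m d n c := by
  rw [classSize, classSizes, List.range_succ, List.foldl_concat, growStep,
    List.getD_eq_getElem _ _ (by simpa using hc), List.getElem_map, List.getElem_range]
  rfl

theorem Admissible.classSize_le {g : ℕ → ℕ} (hg : Admissible m d g) (n : ℕ) {c : ℕ} (hc : c < m) :
    classSize m d n c ≤ g c := by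
  induction n generalizing c with
  | zero =>
    rw [classSize_zero hc]
    exact Nat.zero_lt_of_lt (hg.lt c hc)
  | succ n ih =>
    rw [classSize_succ n hc]
    cases h : tooSmall m d (classSize m d n) c
    · exact ih hc
    · exact hg.lt_of_tooSmall (fun c hc => ih hc) hc h

theorem Admissible.admissible_classSize {g : ℕ → ℕ} (hg : Admissible m d g) {n : ℕ}
    (hn : ∑ c ∈ Finset.range m, g c ≤ n) : Admissible m d (classSize m d n) := by
  -- A round that changes some size increases their sum, which is bounded by that of `g`.
  refine admissible_of_not_tooSmall (persistent_of_bounded (n := n + 1)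
    (P := fun i => ∀ c < m, tooSmall m d (classSize m d i) c = false)
    (g := fun i => ∑ c ∈ Finset.range m, classSize m d i c + 1)
    (Nat.le_add_left 1 _) (fun i => ?_) (fun i h => ?_) (fun i h c hc => ?_) le_rfl)
  · refine Nat.add_le_add_right (le_trans (Finset.sum_le_sum fun c hc => ?_) hn) 1
    exact hg.classSize_le i (Finset.mem_range.1 hc)
  · push Not at h
    obtain ⟨c, hc, h⟩ := h
    refine Nat.add_lt_add_right (Finset.sum_lt_sum (fun c hc => ?_)
      ⟨c, Finset.mem_range.2 hc, ?_⟩) 1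
    · rw [classSize_succ i (Finset.mem_range.1 hc)]
      cases tooSmall m d (classSize m d i) c
      · exact le_rfl
      · exact Nat.le_succ _
    · rw [classSize_succ i hc, Bool.ne_false_iff.1 h]
      exact Nat.lt_succ_self _
  · refine (tooSmall_congr (fun c hc => ?_) hc).trans (h c hc)
    rw [classSize_succ i hc, h c hc, cond_false]

end Admissible

/-! ### Equitable partitions -/

open Classical in
theorem even_card_mul_of_regular {V : Type*} (G : SimpleGraph V) {s : Finset V} {d : ℕ}
    (h : ∀ y ∈ s, (s.filter (G.Adj y)).card = d) : Even (s.card * d) := by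
  have degree_eq (y : s) : (G.induce (s : Set V)).degree y = d := by
    rw [← h y y.2, ← SimpleGraph.card_neighborFinset_eq_degree,
      ← Finset.card_map (Function.Embedding.subtype _)]
    congr 1
    ext z
    simp [and_comm]
  have sum_degrees := (G.induce (s : Set V)).sum_degrees_eq_twice_card_edges
  simp only [degree_eq, Finset.sum_const, Finset.card_univ, smul_eq_mul] at sum_degrees
  rw [← Fintype.card_coe s]
  exact even_iff_two_dvd.2 ⟨_, sum_degrees⟩

open Classical in
/-- A partition of a set of vertices closed under adjacency into `m` nonempty classes such that
every vertex of the class `c` has `d c c'` neighbours in the class `c'`. Outside of `domain` the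
values of `index` are irrelevant. -/
structure EquitablePartition (G : FeaturedGraph) where
  domain : Fin G.order → Prop
  index : Fin G.order → ℕ
  m : ℕ
  d : ℕ → ℕ → ℕ
  closed : ∀ y z, domain y → G.graph.Adj y z → domain z
  index_lt : ∀ y, domain y → index y < m
  exists_index_eq : ∀ c < m, ∃ y, domain y ∧ index y = c
  degree : ∀ y, domain y → ∀ c < m,
    (Finset.univ.filter fun z => G.graph.Adj y z ∧ index z = c).card = d (index y) c

namespace EquitablePartition

variable {G : FeaturedGraph} (P : EquitablePartition G)

open Classical in
/-- The class with a given index. -/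
noncomputable def vertices (c : ℕ) : Finset (Fin G.order) :=
  Finset.univ.filter fun y => P.domain y ∧ P.index y = c

/-- The number of vertices in a class. -/
noncomputable def size (c : ℕ) : ℕ := (P.vertices c).card

theorem mem_vertices {c : ℕ} {y : Fin G.order} :
    y ∈ P.vertices c ↔ P.domain y ∧ P.index y = c := by
  simp [vertices]

theorem sum_size_le : ∑ c ∈ Finset.range P.m, P.size c ≤ G.order := by
  classical
  have card_domain := Finset.card_eq_sum_card_fiberwise (f := P.index) (t := Finset.range P.m)
    (s := Finset.univ.filter P.domain) fun y hy => by simpa using P.index_lt y (by simpa using hy)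
  simp only [Finset.filter_filter] at card_domain
  exact card_domain.ge.trans ((Finset.card_le_univ _).trans_eq (Fintype.card_fin _))

open Classical in
theorem card_filter_adj_vertices {c c' : ℕ} (hc' : c' < P.m) {y : Fin G.order}
    (hy : y ∈ P.vertices c) : ((P.vertices c').filter (G.graph.Adj y)).card = P.d c c' := by
  obtain ⟨hdomain, rfl⟩ := P.mem_vertices.1 hy
  rw [← P.degree y hdomain c' hc']
  congr 1
  ext z
  simp only [Finset.mem_filter, mem_vertices, Finset.mem_univ, true_and]
  exact ⟨fun h => ⟨h.2, h.1.2⟩, fun h => ⟨⟨P.closed y z hdomain h.1, h.2⟩, h.1⟩⟩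

theorem admissible : Admissible P.m P.d P.size := by
  classical
  have exists_mem (c : ℕ) (hc : c < P.m) : ∃ y, y ∈ P.vertices c :=
    (P.exists_index_eq c hc).imp fun y hy => P.mem_vertices.2 hy
  refine ⟨fun c hc c' hc' => ?_, fun c hc c' hc' => ?_, fun c hc => ?_, fun c hc => ?_⟩
  · refine Finset.card_mul_eq_card_mul G.graph.Adj
      (fun y hy => P.card_filter_adj_vertices hc' hy) fun y hy => ?_
    rw [← P.card_filter_adj_vertices hc hy, Finset.bipartiteBelow]
    simp only [G.graph.adj_comm]
  · obtain ⟨y, hy⟩ := exists_mem c' hc'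
    rw [← P.card_filter_adj_vertices hc hy]
    exact Finset.card_filter_le _ _
  · obtain ⟨y, hy⟩ := exists_mem c hc
    rw [← P.card_filter_adj_vertices hc hy]
    exact Finset.card_lt_card (Finset.filter_ssubset.2 ⟨y, hy, G.graph.irrefl⟩)
  · exact even_card_mul_of_regular G.graph fun y hy => P.card_filter_adj_vertices hc hy

end EquitablePartition

theorem multiset_map_eq_map_of_map_eq_map {α β ι X : Type*} {s : Multiset α} {t : Multiset β}
    {κ : α → ι} {κ' : β → ι} {f : α → X} {g : β → X} (h : s.map κ = t.map κ')
    (hfg : ∀ a ∈ s, ∀ b ∈ t, κ a = κ' b → f a = g b) : s.map f = t.map g := by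
  rw [← Multiset.rel_eq, Multiset.rel_map] at h ⊢
  exact h.mono hfg

open Classical in
theorem EquitablePartition.mpc_eq_mpc {G H : FeaturedGraph} (P : EquitablePartition G)
    {κ : Fin H.order → ℕ} (hadj : ∀ i j, H.graph.Adj i j → κ j < P.m)
    (hdeg : ∀ i, κ i < P.m → ∀ c < P.m,
      (Finset.univ.filter fun j => H.graph.Adj i j ∧ κ j = c).card = P.d (κ i) c)
    (hfeat : ∀ i y, P.domain y → κ i = P.index y → H.feature i = G.feature y) (t : ℕ)
    {y : Fin G.order} (hy : P.domain y) {i : Fin H.order} (hi : κ i = P.index y) :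
    mpc H t i = mpc G t y := by
  induction t generalizing y i with
  | zero => exact hfeat i y hy hi
  | succ t ih =>
    have closed {z : Fin G.order} (hz : z ∈ Finset.univ.filter (G.graph.Adj y)) : P.domain z :=
      P.closed y z hy (Finset.mem_filter.1 hz).2
    refine Prod.ext (ih hy hi) (multiset_map_eq_map_of_map_eq_map (κ := κ) (κ' := P.index)
      (s := (Finset.univ.filter (H.graph.Adj i)).val)
      (t := (Finset.univ.filter (G.graph.Adj y)).val) ?_ fun j _ z hz hjz => ih (closed hz) hjz)
    ext c
    rw [Multiset.count_map, Multiset.count_map]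
    simp only [eq_comm (a := c), ← Finset.filter_val, Finset.card_val, Finset.filter_filter]
    by_cases hc : c < P.m
    · rw [hdeg i (hi ▸ P.index_lt y hy) c hc, P.degree y hy c hc, hi]
    · rw [Finset.filter_false_of_mem fun j _ (hj : H.graph.Adj i j ∧ κ j = c) =>
          hc (hj.2 ▸ hadj i j hj.1),
        Finset.filter_false_of_mem fun z _ (hz : G.graph.Adj y z ∧ P.index z = c) =>
          hc (hz.2 ▸ P.index_lt z (P.closed y z hy hz.1)), Finset.card_empty, Finset.card_empty]

/-! ### Realizing an equitable partition -/

theorem length_flatMap_range {X : Type*} (m : ℕ) (g : ℕ → List X) :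
    ((List.range m).flatMap g).length = ∑ c ∈ Finset.range m, (g c).length :=
  List.length_flatMap

/-- The vertices `(c, a)` with `c < m` and `a < f c`. -/
def blockCells (m : ℕ) (f : ℕ → ℕ) : List (ℕ × ℕ) :=
  (List.range m).flatMap fun c => (List.range (f c)).map fun a => (c, a)

/-- The vertices `(c, a)` with `c < m` and `a < f c`, and further vertices `(m, j)` to get `n`. -/
def cells (m : ℕ) (f : ℕ → ℕ) (n : ℕ) : List (ℕ × ℕ) :=
  blockCells m f ++ (List.range (n - (blockCells m f).length)).map fun j => (m, j)

section Cells

variable {m : ℕ} {d : ℕ → ℕ → ℕ} {f : ℕ → ℕ} {n : ℕ}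

theorem length_cells (h : ∑ c ∈ Finset.range m, f c ≤ n) : (cells m f n).length = n := by
  have length_blockCells : (blockCells m f).length = ∑ c ∈ Finset.range m, f c := by
    simp [blockCells, length_flatMap_range, -List.length_flatMap]
  rw [cells, List.length_append, List.length_map, List.length_range]
  omega

theorem mem_blockCells {x : ℕ × ℕ} : x ∈ blockCells m f ↔ x.1 < m ∧ x.2 < f x.1 := by
  simp [blockCells, Prod.ext_iff]

theorem lt_of_mem_cells {x : ℕ × ℕ} (h : x ∈ cells m f n) (hx : x.1 < m) : x.2 < f x.1 := by
  rcases List.mem_append.1 h with h | h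
  · exact (mem_blockCells.1 h).2
  · obtain ⟨j, _, rfl⟩ := List.mem_map.1 h
    exact absurd hx (lt_irrefl _)

theorem nodup_cells (m : ℕ) (f : ℕ → ℕ) (n : ℕ) : (cells m f n).Nodup := by
  have nodup_row (c b : ℕ) : ((List.range b).map fun a => (c, a)).Nodup :=
    List.nodup_range.map (Prod.mk_right_injective c)
  refine List.nodup_append.2
    ⟨List.nodup_flatMap.2 ⟨fun c _ => nodup_row c _, ?_⟩, nodup_row m _, ?_⟩
  · refine List.nodup_range.imp fun {c c'} hne => ?_
    simp only [Function.onFun, List.disjoint_left, List.mem_map]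
    rintro x ⟨a, _, rfl⟩ ⟨b, _, h⟩
    exact hne (congrArg Prod.fst h).symm
  · rintro x hx y hy rfl
    obtain ⟨j, _, rfl⟩ := List.mem_map.1 hy
    exact absurd (mem_blockCells.1 hx).1 (lt_irrefl _)

theorem length_filter_cells {p : ℕ × ℕ → Bool} {c : ℕ} (hc : c < m) :
    ((cells m f n).filter fun y => p y && decide (y.1 = c)).length =
      ((List.range (f c)).filter fun b => p (c, b)).length := by
  have filter_row (c' b : ℕ) :
      (((List.range b).map fun a => (c', a)).filter fun y => p y && decide (y.1 = c)).length =
        if c' = c then ((List.range b).filter fun a => p (c, a)).length else 0 := by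
    rw [List.filter_map, List.length_map]
    split_ifs with h <;> simp [Function.comp_def, h]
  rw [cells, blockCells, List.filter_append, List.length_append, List.filter_flatMap,
    length_flatMap_range]
  simp only [filter_row, hc.ne', if_false, add_zero, Finset.sum_ite_eq', Finset.mem_range, hc,
    if_true]

/-- The graph whose vertices are the pairs in the list `L`. -/
def cellGraph (m : ℕ) (d : ℕ → ℕ → ℕ) (f : ℕ → ℕ) (L : List (ℕ × ℕ)) (φ : ℕ → List Bool) :
    FeaturedGraph where
  order := L.length
  graph :=
    { Adj := fun i j => cellAdj m d f L[i] L[j] = true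
      symm := ⟨fun i j h => by rwa [cellAdj_comm]⟩
      loopless := ⟨fun i h => by simp [cellAdj_self] at h⟩ }
  feature i := φ L[i].1

theorem card_filter_getElem {X : Type*} (L : List X) (p : X → Bool) :
    (Finset.univ.filter fun j : Fin L.length => p L[j] = true).card = (L.filter p).length := by
  conv_rhs => rw [← List.map_getElem_finRange L, List.filter_map, List.length_map]
  simp [Finset.card_def, Finset.filter_val, Fin.univ_def, Function.comp_def]

theorem EquitablePartition.mpc_cellGraph {G : FeaturedGraph} (P : EquitablePartition G)
    (hf : Admissible P.m P.d f) {φ : ℕ → List Bool}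
    (hφ : ∀ y, P.domain y → φ (P.index y) = G.feature y) (t : ℕ) {y : Fin G.order}
    (hy : P.domain y) {i : Fin (cells P.m f n).length} (hi : (cells P.m f n)[i].1 = P.index y) :
    mpc (cellGraph P.m P.d f (cells P.m f n) φ) t i = mpc G t y := by
  classical
  refine P.mpc_eq_mpc (H := cellGraph P.m P.d f (cells P.m f n) φ)
    (κ := fun j : Fin (cells P.m f n).length => (cells P.m f n)[j].1) ?_ ?_ ?_ t hy hi
  · intro i j (hij : cellAdj P.m P.d f (cells P.m f n)[i] (cells P.m f n)[j] = true)
    simp only [cellAdj, Bool.and_eq_true, decide_eq_true_eq] at hij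
    exact hij.2.1
  · intro (i : Fin (cells P.m f n).length) him c hc
    refine Eq.trans ?_ ((length_filter_cells (n := n) (p := cellAdj P.m P.d f (cells P.m f n)[i])
      hc).trans
      (hf.card_cellAdj him (lt_of_mem_cells (List.getElem_mem _) him) hc))
    rw [← card_filter_getElem]
    refine congrArg Finset.card (Finset.ext fun j => Finset.mem_filter.trans
      (Iff.trans (and_congr Iff.rfl ?_) Finset.mem_filter.symm))
    rw [Bool.and_eq_true, decide_eq_true_eq]
    exact Iff.rfl
  · intro i y hy hi
    exact (congrArg φ hi).trans (hφ y hy)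

end Cells

/-! ### Computing a graph from the dag -/

/-- The edges between two consecutive levels of a dag: the entry at `p`, `q` lists the labels of
the edges from the node `p` of the upper level to the node `q` of the lower level, in unary. -/
abbrev LevelMatrix : Type := List (List (List (List Bool)))

/-- The labels of the edges from `p` to `q`. -/
def labelsAt (M : LevelMatrix) (p q : ℕ) : List (List Bool) :=
  (M.getD p []).getD q []

/-- The sum of the labels of the edges from `p` to `q`. -/
def multiplicity (M : LevelMatrix) (p q : ℕ) : ℕ :=
  (labelsAt M p q).flatten.length

/-- The target of the edge from `p` with label `0`. -/
def prevIndex (M : LevelMatrix) (p : ℕ) : ℕ :=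
  ((List.range (M.getD p []).length).filter fun q =>
    (labelsAt M p q).any fun b => decide (b.length = 0)).headD 0

/-- The node reached from the node `p` on level `j` by `k` edges with label `0`. -/
def descend (Ms : List LevelMatrix) (j k p : ℕ) : ℕ :=
  (List.range k).foldl (fun p s => prevIndex (Ms.getD (j - 1 - s) []) p) p

/-- The number of neighbours in the class `e` of a vertex in the class `c`, where the classes are
numbered as the nodes of the upper level of `M`. -/
def degreeOf (M : LevelMatrix) (c e : ℕ) : ℕ :=
  multiplicity M c (prevIndex M e)

/-- The feature of the vertices in a class, where the classes are numbered as the nodes on level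
`n + 1` and `B` lists the labels on level `0`. -/
def classFeature (B : List (List Bool)) (Ms : List LevelMatrix) (n c : ℕ) : List Bool :=
  B.getD (descend Ms (n + 1) (n + 1) c) []

/-- The string for a graph on given cells, rooted at the first vertex of the class `r`. -/
def cellString (L : List (ℕ × ℕ)) (r m : ℕ) (d : ℕ → ℕ → ℕ) (f : ℕ → ℕ) (φ : ℕ → List Bool) :
    List Sym :=
  encodeList
    [ encodeBits (L.map fun x => decide (x.1 = r) && decide (x.2 = 0)),
      encodeList (L.map fun x => encodeBits (φ x.1)),
      encodeList (L.map fun x => encodeBits (L.map fun y => cellAdj m d f x y)) ]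

/-- The string for a rooted graph of order `n`, computed from the data of the dag of the final
colour of the root, where `M` belongs to the edges from level `n + 1` to level `n`. -/
def realizationString (B : List (List Bool)) (Ms : List LevelMatrix) (M : LevelMatrix) (n : ℕ) :
    List Sym :=
  cellString (cells M.length (classSize M.length (degreeOf M) n) n) (descend Ms (2 * n) (n - 1) 0)
    M.length (degreeOf M) (classSize M.length (degreeOf M) n) (classFeature B Ms n)

/-- The string for a rooted graph, computed from the data of the dag of the final colour of the
root. The order is half the number of levels below the root of the dag. -/
def graphString (B : List (List Bool)) (Ms : List LevelMatrix) : List Sym :=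
  realizationString B Ms (Ms.getD (Ms.length / 2) []) (Ms.length / 2)

section PolyTime

variable {α : Type} [TreeRep α]

@[fun_prop]
theorem polyTime_mod_two {f : α → ℕ} (hf : PolyTime f) : PolyTime (fun a => f a % 2) := by
  have : PolyTime fun a =>
      bif (List.range (f a)).any fun j => decide (2 * j + 1 = f a) then 1 else 0 :=
    .cond (by fun_prop) (by fun_prop) (by fun_prop)
  convert this using 2 with a
  have any_iff : ((List.range (f a)).any fun j => decide (2 * j + 1 = f a)) = true ↔
      f a % 2 = 1 := by
    simp only [List.any_eq_true, List.mem_range, decide_eq_true_eq]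
    exact ⟨fun ⟨j, _, hj⟩ => by omega, fun h => ⟨f a / 2, by omega, by omega⟩⟩
  rw [Bool.cond_eq_ite, if_congr any_iff rfl rfl]
  split <;> omega

@[fun_prop]
theorem polyTime_div_two {f : α → ℕ} (hf : PolyTime f) : PolyTime (fun a => f a / 2) := by
  have : PolyTime fun a =>
      ((List.range (f a)).filter fun j => decide (2 * j + 1 < f a)).length := by fun_prop
  convert this using 2 with a
  have filter_eq : ((Finset.range (f a)).filter fun j => decide (2 * j + 1 < f a) = true) =
      Finset.range (f a / 2) := by
    ext j
    simp only [Finset.mem_filter, Finset.mem_range, decide_eq_true_eq]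
    omega
  rw [length_filter_range_eq_card, filter_eq, Finset.card_range]

@[fun_prop]
theorem polyTime_decide_ne {f g : α → ℕ} (hf : PolyTime f) (hg : PolyTime g) :
    PolyTime (fun a => decide (f a ≠ g a)) := by
  simp only [ne_eq, decide_not]
  fun_prop

@[fun_prop]
theorem polyTime_labelsAt {M : α → LevelMatrix} {p q : α → ℕ} (hM : PolyTime M)
    (hp : PolyTime p) (hq : PolyTime q) : PolyTime (fun a => labelsAt (M a) (p a) (q a)) := by
  unfold labelsAt; fun_prop

@[fun_prop]
theorem polyTime_prevIndex {M : α → LevelMatrix} {p : α → ℕ} (hM : PolyTime M)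
    (hp : PolyTime p) : PolyTime (fun a => prevIndex (M a) (p a)) := by
  unfold prevIndex; fun_prop

@[fun_prop]
theorem polyTime_degreeOf {M : α → LevelMatrix} {p q : α → ℕ} (hM : PolyTime M)
    (hp : PolyTime p) (hq : PolyTime q) : PolyTime (fun a => degreeOf (M a) (p a) (q a)) := by
  unfold degreeOf multiplicity; fun_prop

theorem rsize_getD_le {β : Type} [TreeRep β] (l : List β) (i : ℕ) (d : β) :
    rsize (l.getD i d) ≤ rsize l + rsize d := by
  by_cases h : i < l.length
  · rw [List.getD_eq_getElem _ _ h]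
    exact le_add_right (rsize_le_of_mem (List.getElem_mem h))
  · rw [List.getD_eq_default _ _ (by omega)]
    omega

theorem headD_filter_range_le (n : ℕ) (f : ℕ → Bool) : ((List.range n).filter f).headD 0 ≤ n := by
  cases h : (List.range n).filter f with
  | nil => simp
  | cons x l =>
    have : x ∈ (List.range n).filter f := by simp [h]
    exact (List.mem_range.1 (List.mem_filter.1 this).1).le

@[fun_prop]
theorem polyTime_descend {Ms : α → List LevelMatrix} {j k p : α → ℕ} (hMs : PolyTime Ms)
    (hj : PolyTime j) (hk : PolyTime k) (hp : PolyTime p) :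
    PolyTime (fun a => descend (Ms a) (j a) (k a) (p a)) := by
  unfold descend
  obtain ⟨q, hq⟩ := hMs.exists_rsize_le
  refine .foldl_of_add_le (by fun_prop) hp (by fun_prop) ⟨q + 2, fun a s _ t => ?_⟩
  set M := (Ms a).getD (j a - 1 - s) []
  have : prevIndex M t ≤ (M.getD t []).length := headD_filter_range_le _ _
  have := length_le_rsize (M.getD t [])
  have : rsize (M.getD t []) ≤ rsize M + rsize _ := rsize_getD_le M t []
  have : rsize M ≤ rsize (Ms a) + rsize _ := rsize_getD_le (Ms a) (j a - 1 - s) []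
  have := hq a
  simp only [rsize_nil, rsize_nat, Polynomial.eval_add, Polynomial.eval_ofNat] at *
  omega

theorem length_classSizes (m : ℕ) (d : ℕ → ℕ → ℕ) (n : ℕ) : (classSizes m d n).length = m := by
  cases n with
  | zero => simp [classSizes]
  | succ n => simp [classSizes, List.range_succ, growStep]

theorem classSize_le (m : ℕ) (d : ℕ → ℕ → ℕ) (n : ℕ) {c : ℕ} (hc : c < m) :
    classSize m d n c ≤ n + 1 := by
  induction n with
  | zero => rw [classSize_zero hc]
  | succ n ih =>
    rw [classSize_succ n hc]
    cases tooSmall m d (classSize m d n) c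
    · exact ih.trans (Nat.le_succ _)
    · exact Nat.succ_le_succ ih

theorem rsize_classSizes_le (m : ℕ) (d : ℕ → ℕ → ℕ) (n : ℕ) :
    rsize (classSizes m d n) ≤ m * (2 * n + 4) + 1 := by
  have := rsize_list_le (l := classSizes m d n) (B := 2 * n + 3) fun x hx => by
    obtain ⟨c, hc, rfl⟩ := List.getElem_of_mem hx
    have := classSize_le m d n (length_classSizes m d n ▸ hc)
    rw [classSize, List.getD_eq_getElem _ _ hc] at this
    rw [rsize_nat]
    omega
  rwa [length_classSizes] at this

section Classes

variable {m n : α → ℕ} {d : α → ℕ → ℕ → ℕ} {f : α → ℕ → ℕ}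

@[fun_prop]
theorem polyTime_tooSmall {c : α → ℕ} (hm : PolyTime m)
    (hd : PolyTime fun x : α × ℕ × ℕ => d x.1 x.2.1 x.2.2)
    (hf : PolyTime fun x : α × ℕ => f x.1 x.2) (hc : PolyTime c) :
    PolyTime (fun a => tooSmall (m a) (d a) (f a) (c a)) := by
  unfold tooSmall
  fun_prop

@[fun_prop]
theorem polyTime_classSizes (hm : PolyTime m)
    (hd : PolyTime fun x : α × ℕ × ℕ => d x.1 x.2.1 x.2.2) (hn : PolyTime n) :
    PolyTime (fun a => classSizes (m a) (d a) (n a)) := by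
  obtain ⟨p, hp⟩ := hm.exists_le
  obtain ⟨q, hq⟩ := hn.exists_le
  refine .foldl (by fun_prop) (by fun_prop) ?_ ⟨p * (2 * q + 4) + 1, fun a i hi => ?_⟩
  · unfold growStep
    exact .map (by fun_prop) (.cond (by fun_prop) (by fun_prop) (by fun_prop))
  · rw [List.length_range] at hi
    rw [List.take_range, Nat.min_eq_left hi]
    refine (rsize_classSizes_le (m a) (d a) i).trans ?_
    simp only [Polynomial.eval_add, Polynomial.eval_mul, Polynomial.eval_ofNat,
      Polynomial.eval_one]
    gcongr
    exacts [hp a, hi.trans (hq a)]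

@[fun_prop]
theorem polyTime_classSize {c : α → ℕ} (hm : PolyTime m)
    (hd : PolyTime fun x : α × ℕ × ℕ => d x.1 x.2.1 x.2.2) (hn : PolyTime n) (hc : PolyTime c) :
    PolyTime (fun a => classSize (m a) (d a) (n a) (c a)) := by
  unfold classSize
  fun_prop

@[fun_prop]
theorem polyTime_cells (hm : PolyTime m) (hf : PolyTime fun x : α × ℕ => f x.1 x.2)
    (hn : PolyTime n) : PolyTime (fun a => cells (m a) (f a) (n a)) := by
  unfold cells blockCells
  fun_prop

@[fun_prop]
theorem polyTime_within {N d x y : α → ℕ} (hN : PolyTime N) (hd : PolyTime d) (hx : PolyTime x)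
    (hy : PolyTime y) : PolyTime (fun a => within (N a) (d a) (x a) (y a)) := by
  unfold within isJump Nat.dist
  fun_prop

@[fun_prop]
theorem polyTime_between {d e N x y : α → ℕ} (hd : PolyTime d) (he : PolyTime e) (hN : PolyTime N)
    (hx : PolyTime x) (hy : PolyTime y) :
    PolyTime (fun a => between (d a) (e a) (N a) (x a) (y a)) := by
  unfold between
  fun_prop

@[fun_prop]
theorem polyTime_cellAdj {x y : α → ℕ × ℕ} (hm : PolyTime m)
    (hd : PolyTime fun x : α × ℕ × ℕ => d x.1 x.2.1 x.2.2)
    (hf : PolyTime fun x : α × ℕ => f x.1 x.2) (hx : PolyTime x) (hy : PolyTime y) :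
    PolyTime (fun a => cellAdj (m a) (d a) (f a) (x a) (y a)) := by
  unfold cellAdj
  exact .and (by fun_prop) (.and (by fun_prop)
    (.ite (by fun_prop) (by fun_prop) (.ite (by fun_prop) (by fun_prop) (by fun_prop))))

theorem polyTime_cellString {L : α → List (ℕ × ℕ)} {r : α → ℕ} {φ : α → ℕ → List Bool}
    (hL : PolyTime L) (hr : PolyTime r) (hm : PolyTime m)
    (hd : PolyTime fun x : α × ℕ × ℕ => d x.1 x.2.1 x.2.2)
    (hf : PolyTime fun x : α × ℕ => f x.1 x.2) (hφ : PolyTime fun x : α × ℕ => φ x.1 x.2) :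
    PolyTime (fun a => cellString (L a) (r a) (m a) (d a) (f a) (φ a)) := by
  unfold cellString
  exact .encodeList (.cons (.encodeBits (by fun_prop))
    (.cons (.encodeList (.map (by fun_prop) (.encodeBits (by fun_prop))))
    (.cons (.encodeList (.map (by fun_prop) (.encodeBits (by fun_prop)))) (by fun_prop))))

end Classes

theorem polyTime_realizationString {B : α → List (List Bool)} {Ms : α → List LevelMatrix}
    {M : α → LevelMatrix} {n : α → ℕ} (hB : PolyTime B) (hMs : PolyTime Ms) (hM : PolyTime M)
    (hn : PolyTime n) : PolyTime (fun a => realizationString (B a) (Ms a) (M a) (n a)) := by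
  unfold realizationString classFeature
  apply polyTime_cellString <;> fun_prop

theorem polyTime_graphString {B : α → List (List Bool)} {Ms : α → List LevelMatrix}
    (hB : PolyTime B) (hMs : PolyTime Ms) : PolyTime (fun a => graphString (B a) (Ms a)) := by
  unfold graphString
  apply polyTime_realizationString <;> fun_prop

end PolyTime

/-! ### The data of a numbered dag -/

section DagData

variable {D : LevelDag} (N : Numbering D)

/-- The labels of the nodes on level `0`, in the order of their numbers. -/
def leafLabels : List (List Bool) :=
  List.ofFn fun q => D.leafLabel ((N.num 0).symm q)

/-- The matrix of the edge labels (in unary) from level `i + 1` to level `i`. -/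
def levelMatrix (i : ℕ) : LevelMatrix :=
  List.ofFn fun p => List.ofFn fun q =>
    ((D.edgeLabels i ((N.num (i + 1)).symm p) ((N.num i).symm q)).sort (· ≤ ·)).map
      fun l => List.replicate l true

/-- The matrices of the edge labels for all levels, beginning with the edges to level `0`. -/
def levelMatrices : List LevelMatrix :=
  (List.range D.height).map (levelMatrix N)

theorem represents_encodeDag :
    Represents (encodeDag D N) (leafLabels N, levelMatrices N, ()) := by
  refine represents_encodeList_pair ?_ (represents_encodeList fun i _ => ?_)
  · rw [leafLabels, List.ofFn_eq_map, List.ofFn_eq_map]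
    exact represents_encodeList fun q _ => represents_encodeBits _
  · rw [levelMatrix, List.ofFn_eq_map, List.ofFn_eq_map]
    refine represents_encodeList fun p _ => ?_
    rw [List.ofFn_eq_map, List.ofFn_eq_map]
    refine represents_encodeList fun q _ => ?_
    exact represents_encodeList fun l _ => represents_encodeNat l

theorem length_levelMatrix (i : ℕ) : (levelMatrix N i).length = N.width (i + 1) :=
  List.length_ofFn

theorem length_levelMatrices : (levelMatrices N).length = D.height := by
  simp [levelMatrices]

theorem getD_levelMatrices {i : ℕ} (hi : i < D.height) :
    (levelMatrices N).getD i [] = levelMatrix N i := by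
  rw [List.getD_eq_getElem _ _ (by rwa [length_levelMatrices])]
  simp [levelMatrices]

theorem getD_ofFn {X : Type*} {n : ℕ} (f : Fin n → X) (i : Fin n) (d : X) :
    (List.ofFn f).getD i d = f i := by
  rw [List.getD_eq_getElem _ _ (by simp)]
  simp

theorem getD_leafLabels (x : D.Node 0) :
    (leafLabels N).getD (N.num 0 x) [] = D.leafLabel x := by
  rw [leafLabels, getD_ofFn, Equiv.symm_apply_apply]

theorem labelsAt_levelMatrix {i : ℕ} (x : D.Node (i + 1)) (y : D.Node i) :
    labelsAt (levelMatrix N i) (N.num (i + 1) x) (N.num i y) =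
      ((D.edgeLabels i x y).sort (· ≤ ·)).map fun l => List.replicate l true := by
  rw [labelsAt, levelMatrix, getD_ofFn, getD_ofFn, Equiv.symm_apply_apply, Equiv.symm_apply_apply]

theorem multiplicity_levelMatrix {i : ℕ} (x : D.Node (i + 1)) (y : D.Node i) :
    multiplicity (levelMatrix N i) (N.num (i + 1) x) (N.num i y) =
      ∑ l ∈ D.edgeLabels i x y, l := by
  have sum_sort := List.sum_toFinset (fun l : ℕ => l) ((D.edgeLabels i x y).sort_nodup (· ≤ ·))
  rw [Finset.sort_toFinset] at sum_sort
  rw [sum_sort, multiplicity, labelsAt_levelMatrix, List.length_flatten, List.map_map]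
  simp [Function.comp_def]

end DagData

section ColorDag

variable {t i : ℕ} {c : Color t}

open Classical in
theorem sum_edgeLabels (x : (colorDag c).Node (i + 1)) (y : (colorDag c).Node i) :
    ∑ l ∈ (colorDag c).edgeLabels i x y, l = x.1.nbrs.count y.1 := by
  rw [edgeLabels_colorDag, Finset.sum_union_eq_right fun l hl _ => by split_ifs at hl <;> simp_all]
  split_ifs with h
  · rw [Finset.sum_singleton]
  · rw [Finset.sum_empty, Multiset.count_eq_zero_of_notMem h]

theorem zero_mem_edgeLabels {x : (colorDag c).Node (i + 1)} {y : (colorDag c).Node i} :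
    0 ∈ (colorDag c).edgeLabels i x y ↔ y.1 = x.1.prev := by
  classical
  rw [edgeLabels_colorDag, Finset.mem_union, or_iff_left]
  · split_ifs with h <;> simp [h]
  · split_ifs with h
    · rw [Finset.mem_singleton]
      exact (Multiset.count_pos.2 h).ne
    · simp

theorem headD_filter_range {n q : ℕ} {f : ℕ → Bool} (hq : q < n)
    (h : ∀ q' < n, f q' = true ↔ q' = q) : ((List.range n).filter f).headD 0 = q := by
  have mem_filter_iff (x : ℕ) : x ∈ (List.range n).filter f ↔ x = q := by
    rw [List.mem_filter, List.mem_range]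
    exact ⟨fun hx => (h x hx.1).1 hx.2, fun e => e ▸ ⟨hq, (h q hq).2 rfl⟩⟩
  cases hl : (List.range n).filter f with
  | nil => simp [hl] at mem_filter_iff
  | cons x l => exact (mem_filter_iff x).1 (by simp [hl])

/-- The target of the edge with label `0`. -/
def prevNode (x : (colorDag c).Node (i + 1)) : (colorDag c).Node i :=
  ⟨x.1.prev, x.2.prev⟩

theorem prevIndex_levelMatrix (N : Numbering (colorDag c)) (x : (colorDag c).Node (i + 1)) :
    prevIndex (levelMatrix N i) (N.num (i + 1) x) = N.num i (prevNode x) := by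
  have length_row : ((levelMatrix N i).getD (N.num (i + 1) x) []).length = N.width i := by
    rw [levelMatrix, getD_ofFn, List.length_ofFn]
  rw [prevIndex, length_row]
  refine headD_filter_range (Fin.is_lt _) fun q hq => ?_
  obtain ⟨y, hy⟩ := (N.num i).surjective ⟨q, hq⟩
  obtain rfl : q = N.num i y := by rw [hy]
  have eq_prevNode_iff : y = prevNode x ↔ y.1 = x.1.prev := Subtype.ext_iff
  rw [labelsAt_levelMatrix, Fin.val_inj, (N.num i).apply_eq_iff_eq, eq_prevNode_iff,
    ← zero_mem_edgeLabels]
  simp [List.any_eq_true]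

end ColorDag

section VertexIndex

variable {G : FeaturedGraph} {v : Fin G.order} {t : ℕ} (N : Numbering (colorDag (mpc G t v)))

/-- The node on level `i` for the colour of a vertex. -/
noncomputable def vertexNode {i : ℕ} (hi : i ≤ t) {y : Fin G.order} (hy : Near v (t - i) y) :
    (colorDag (mpc G t v)).Node i :=
  ⟨mpc G i y, occurs_of_near hy (by omega)⟩

open Classical in
/-- The number of the node on level `i` for the colour of a vertex, or `0` if there is none. -/
noncomputable def vertexIndex (i : ℕ) (y : Fin G.order) : ℕ :=
  if h : i ≤ t ∧ Near v (t - i) y then N.num i (vertexNode h.1 h.2) else 0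

variable {i : ℕ} {y z : Fin G.order}

theorem vertexIndex_eq (hi : i ≤ t) (hy : Near v (t - i) y) :
    vertexIndex N i y = N.num i (vertexNode hi hy) :=
  dif_pos ⟨hi, hy⟩

theorem vertexIndex_lt (hi : i ≤ t) (hy : Near v (t - i) y) : vertexIndex N i y < N.width i := by
  rw [vertexIndex_eq N hi hy]
  exact Fin.is_lt _

theorem vertexIndex_inj (hi : i ≤ t) (hy : Near v (t - i) y) (hz : Near v (t - i) z) :
    vertexIndex N i y = vertexIndex N i z ↔ mpc G i y = mpc G i z := by
  rw [vertexIndex_eq N hi hy, vertexIndex_eq N hi hz, Fin.val_inj, (N.num i).apply_eq_iff_eq]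
  exact Subtype.ext_iff

theorem exists_vertexIndex_eq (hi : i ≤ t) {q : ℕ} (hq : q < N.width i) :
    ∃ y, Near v (t - i) y ∧ vertexIndex N i y = q := by
  set x := (N.num i).symm ⟨q, hq⟩ with hx
  have vertexNode_eq : vertexNode hi (near_nodeVertex x) = x := Subtype.ext (mpc_nodeVertex x)
  refine ⟨_, near_nodeVertex x, ?_⟩
  rw [vertexIndex_eq N hi (near_nodeVertex x), vertexNode_eq, hx, Equiv.apply_symm_apply]

theorem vertexIndex_top : vertexIndex N t v = 0 := by
  obtain ⟨y, hy, index_eq⟩ := exists_vertexIndex_eq N le_rfl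
    (Nat.zero_lt_of_lt (vertexIndex_lt N le_rfl (near_self v (t - t))))
  rw [Nat.sub_self, near_zero_iff] at hy
  rwa [hy] at index_eq

theorem getD_leafLabels_vertexIndex (hy : Near v t y) :
    (leafLabels N).getD (vertexIndex N 0 y) [] = G.feature y := by
  rw [vertexIndex_eq N (Nat.zero_le t) hy, getD_leafLabels]
  rfl

theorem prevIndex_vertexIndex (hi : i + 1 ≤ t) (hy : Near v (t - (i + 1)) y) :
    prevIndex (levelMatrix N i) (vertexIndex N (i + 1) y) = vertexIndex N i y := by
  rw [vertexIndex_eq N hi hy, vertexIndex_eq N (by omega) (hy.mono (by omega)),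
    prevIndex_levelMatrix]
  rfl

theorem descend_vertexIndex {j k : ℕ} (hj : j ≤ t) (hk : k ≤ j) (hy : Near v (t - j) y) :
    descend (levelMatrices N) j k (vertexIndex N j y) = vertexIndex N (j - k) y := by
  induction k with
  | zero => rfl
  | succ k ih =>
    have sub_eq : j - k = j - 1 - k + 1 := by omega
    have sub_succ_eq : j - (k + 1) = j - 1 - k := by omega
    have height_eq : (colorDag (mpc G t v)).height = t := rfl
    rw [descend, List.range_succ, List.foldl_append, ← descend, ih (by omega), List.foldl_cons,
      List.foldl_nil, getD_levelMatrices N (by omega), sub_eq, sub_succ_eq,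
      prevIndex_vertexIndex N (by omega) (hy.mono (by omega))]

theorem degreeOf_vertexIndex (hi : i + 1 ≤ t) (hy : Near v (t - (i + 1)) y)
    (hz : Near v (t - (i + 1)) z) [DecidableEq (Color i)] :
    degreeOf (levelMatrix N i) (vertexIndex N (i + 1) y) (vertexIndex N (i + 1) z) =
      (mpc G (i + 1) y).nbrs.count (mpc G i z) := by
  rw [degreeOf, prevIndex_vertexIndex N hi hz, vertexIndex_eq N hi hy,
    vertexIndex_eq N (by omega) (hz.mono (by omega)), multiplicity_levelMatrix, sum_edgeLabels]
  congr!

end VertexIndex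

/-! ### A graph for the dag of a final colour -/

section Realization

variable {G : FeaturedGraph} {v : Fin G.order} (N : Numbering (colorDag (mpc G (2 * G.order) v)))

theorem near_two_mul_order_sub {i : ℕ} (hi : i ≤ G.order + 1) {s : ℕ} {y : Fin G.order}
    (hy : Near v s y) : Near v (2 * G.order - i) y :=
  near_of_near (by omega) hy

/-- The partition of the connected component of `v` into the colour classes after `n + 1` rounds,
numbered as the nodes on level `n + 1` of the dag. -/
noncomputable def dagPartition : EquitablePartition G where
  domain := Near v (G.order - 1)
  index := vertexIndex N (G.order + 1)
  m := (levelMatrix N G.order).length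
  d := degreeOf (levelMatrix N G.order)
  closed _ _ hy h := near_closed le_rfl hy h
  index_lt y hy := by
    have := v.pos
    rw [length_levelMatrix]
    exact vertexIndex_lt N (by omega) (near_two_mul_order_sub le_rfl hy)
  exists_index_eq c hc := by
    have := v.pos
    rw [length_levelMatrix] at hc
    obtain ⟨y, hy, index_eq⟩ := exists_vertexIndex_eq N (by omega) hc
    exact ⟨y, near_of_near le_rfl hy, index_eq⟩
  degree y hy c hc := by
    classical
    have := v.pos
    rw [length_levelMatrix] at hc
    obtain ⟨z₀, hz₀, rfl⟩ := exists_vertexIndex_eq N (by omega) hc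
    rw [degreeOf_vertexIndex N (by omega) (near_two_mul_order_sub le_rfl hy) hz₀, count_mpc_nbrs]
    congr 1
    ext z
    simp only [Finset.mem_filter, Finset.mem_univ, true_and]
    refine and_congr_right fun hyz => ?_
    rw [vertexIndex_inj N (by omega)
      (near_two_mul_order_sub le_rfl (near_closed le_rfl hy hyz)) hz₀]
    exact ⟨fun h => mpc_eq_of_le (by omega) h, fun h => mpc_eq_of_stable (by omega) h _⟩

theorem cellString_eq_encodeRooted {m : ℕ} {d : ℕ → ℕ → ℕ} {f : ℕ → ℕ} {φ : ℕ → List Bool}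
    {L : List (ℕ × ℕ)} (hL : L.Nodup) {r : ℕ} {w : Fin L.length} (hw : L[w] = (r, 0)) :
    cellString L r m d f φ = encodeRooted (cellGraph m d f L φ) w := by
  classical
  have root_eq : (L.map fun x => decide (x.1 = r) && decide (x.2 = 0)) =
      List.ofFn fun u : Fin (cellGraph m d f L φ).order => decide (u = w) := by
    refine (ofFn_getElem_eq_map L _ _ fun u => ?_).symm
    have getElem_eq_iff : L[u] = L[w] ↔ u = w := by
      rw [Fin.ext_iff]
      exact hL.getElem_inj_iff
    rw [hw, Prod.ext_iff] at getElem_eq_iff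
    rw [Bool.eq_iff_iff, decide_eq_true_eq, Bool.and_eq_true, decide_eq_true_eq,
      decide_eq_true_eq]
    exact getElem_eq_iff.symm
  have features_eq : (L.map fun x => encodeBits (φ x.1)) =
      List.ofFn fun u => encodeBits ((cellGraph m d f L φ).feature u) :=
    (ofFn_getElem_eq_map L _ _ fun _ => rfl).symm
  have rows_eq : (L.map fun x => encodeBits (L.map fun y => cellAdj m d f x y)) =
      List.ofFn fun u => encodeBits
        (List.ofFn fun w => decide ((cellGraph m d f L φ).graph.Adj u w)) := by
    refine (ofFn_getElem_eq_map L _ _ fun u => congrArg encodeBits ?_).symm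
    refine ofFn_getElem_eq_map L _ _ fun w => ?_
    rw [Bool.eq_iff_iff, decide_eq_true_eq]
    rfl
  unfold cellString encodeRooted
  rw [root_eq, features_eq, rows_eq]
  congr!

namespace EquitablePartition

variable (P : EquitablePartition G) (φ : ℕ → List Bool)

theorem admissible_classSize : Admissible P.m P.d (classSize P.m P.d G.order) :=
  P.admissible.admissible_classSize P.sum_size_le

theorem sum_classSize_le : ∑ c ∈ Finset.range P.m, classSize P.m P.d G.order c ≤ G.order :=
  (Finset.sum_le_sum fun _ hc => P.admissible.classSize_le G.order (Finset.mem_range.1 hc)).trans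
    P.sum_size_le

/-- The graph of the same order as `G` with classes of the least admissible sizes, in which the
vertices of the class `c` have the feature `φ c`. -/
def realization : FeaturedGraph :=
  cellGraph P.m P.d (classSize P.m P.d G.order)
    (cells P.m (classSize P.m P.d G.order) G.order) φ

theorem order_realization : (P.realization φ).order = G.order :=
  length_cells P.sum_classSize_le

theorem exists_mpc_realization (hφ : ∀ y, P.domain y → φ (P.index y) = G.feature y)
    {y : Fin G.order} (hy : P.domain y) : ∃ w : Fin (P.realization φ).order,
      (∀ t, mpc (P.realization φ) t w = mpc G t y) ∧
      cellString (cells P.m (classSize P.m P.d G.order) G.order) (P.index y) P.m P.d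
        (classSize P.m P.d G.order) φ = encodeRooted (P.realization φ) w := by
  have index_lt := P.index_lt y hy
  have mem_cells : (P.index y, 0) ∈ cells P.m (classSize P.m P.d G.order) G.order :=
    List.mem_append_left _ (mem_blockCells.2
      ⟨index_lt, Nat.zero_lt_of_lt (P.admissible_classSize.lt _ index_lt)⟩)
  obtain ⟨i, hi, getElem_eq⟩ := List.getElem_of_mem mem_cells
  exact ⟨⟨i, hi⟩, fun t =>
      P.mpc_cellGraph P.admissible_classSize hφ t hy (i := ⟨i, hi⟩) (congrArg Prod.fst getElem_eq),
    cellString_eq_encodeRooted (w := ⟨i, hi⟩) (nodup_cells _ _ _) getElem_eq⟩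

end EquitablePartition

theorem descend_root :
    descend (levelMatrices N) (2 * G.order) (G.order - 1) 0 = vertexIndex N (G.order + 1) v := by
  have := v.pos
  have := descend_vertexIndex N (k := G.order - 1) le_rfl (by omega) (near_self v _)
  rwa [vertexIndex_top, show 2 * G.order - (G.order - 1) = G.order + 1 by omega] at this

theorem classFeature_vertexIndex {y : Fin G.order} (hy : Near v (G.order - 1) y) :
    classFeature (leafLabels N) (levelMatrices N) G.order (vertexIndex N (G.order + 1) y) =
      G.feature y := by
  have := v.pos
  rw [classFeature, descend_vertexIndex N (by omega) le_rfl (near_two_mul_order_sub le_rfl hy),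
    Nat.sub_self, getD_leafLabels_vertexIndex N (hy.mono (by omega))]

theorem length_classFeature_le {k : ℕ} (hk : FeatureBound G k) (c : ℕ) :
    (classFeature (leafLabels N) (levelMatrices N) G.order c).length ≤ k := by
  rw [classFeature]
  generalize descend _ _ _ _ = q
  by_cases hq : q < (leafLabels N).length
  · rw [List.getD_eq_getElem _ _ hq]
    simp only [leafLabels, List.getElem_ofFn]
    exact length_leafLabel_le hk _
  · rw [List.getD_eq_default _ _ (not_lt.1 hq)]
    exact Nat.zero_le k

theorem exists_graphString_eq : ∃ (H : FeaturedGraph) (w : Fin H.order), H.order = G.order ∧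
    (∀ t, mpc H t w = mpc G t v) ∧ (∀ k, FeatureBound G k → FeatureBound H k) ∧
      graphString (leafLabels N) (levelMatrices N) = encodeRooted H w := by
  have := v.pos
  have half_height : (levelMatrices N).length / 2 = G.order := by
    rw [length_levelMatrices]
    exact Nat.mul_div_cancel_left _ two_pos
  have height_eq : (colorDag (mpc G (2 * G.order) v)).height = 2 * G.order := rfl
  obtain ⟨w, mpc_eq, encode_eq⟩ := (dagPartition N).exists_mpc_realization
    (classFeature (leafLabels N) (levelMatrices N) G.order)
    (fun y hy => classFeature_vertexIndex N hy) (near_self v (G.order - 1))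
  refine ⟨_, w, (dagPartition N).order_realization _, mpc_eq,
    fun k hk _ => length_classFeature_le N hk _, ?_⟩
  rw [graphString, half_height, getD_levelMatrices N (by omega), realizationString, descend_root]
  exact encode_eq

end Realization

/-! ### Feature transformations and dags -/

theorem PolyTime.exists_preprocess {α : Type} [TreeRep α] {f : α → List Sym} (hf : PolyTime f) :
    ∃ (P : Turing.TM2ComputableAux Sym Bool → Turing.TM2ComputableAux Sym Bool)
      (q : Polynomial ℕ), ∀ (s : List Sym) (a : α), Represents s a → ∀ M y m,
        OutputsInTime M (f a) y m → OutputsInTime (P M) s y (m + q.eval s.length) := by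
  obtain ⟨c, p, hc⟩ := hf.exists_runs
  refine ⟨fun M => Preprocess.machine c 0 1 M, 2 * p + 1, fun s a hs M y m hM => ?_⟩
  obtain ⟨runs_c, length_le⟩ := hc s a hs
  have update_zero : Function.update (fun _ => []) 0 s = ![s, [], [], []] := by
    funext i; fin_cases i <;> rfl
  have update_one : Function.update (fun _ => []) 1 (f a).reverse =
      ![[], (f a).reverse, [], []] := by
    funext i; fin_cases i <;> rfl
  rw [← update_zero, ← update_one] at runs_c
  refine (Preprocess.outputsInTime_machine runs_c hM).mono ?_
  simp only [Polynomial.eval_add, Polynomial.eval_mul, Polynomial.eval_ofNat, Polynomial.eval_one]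
  omega

open Polynomial in
theorem exists_length_encodeDag_le : ∃ p : Polynomial ℕ, ∀ (G : FeaturedGraph) (v : Fin G.order)
    (N : Numbering (colorDag (finalColor G v))) (k : ℕ), FeatureBound G k →
      (encodeDag (colorDag (finalColor G v)) N).length ≤ p.eval (G.order + k) := by
  refine ⟨2 * ((X * (X + 2) + 2) + (2 * X * (X * (X * (2 * (X + 2) + 2) + 2) + 2) + 2)) + 2,
    fun G v N k hk => (length_encodeDag_le N hk).trans ?_⟩
  simp only [eval_add, eval_mul, eval_ofNat, eval_X]
  gcongr <;> omega

open Polynomial in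
theorem exists_length_encodeRooted_le : ∃ p : Polynomial ℕ, ∀ (G : FeaturedGraph)
    (v : Fin G.order) (k : ℕ), FeatureBound G k →
      (encodeRooted G v).length ≤ p.eval (G.order + k) := by
  refine ⟨3 * ((X + 2) + (X * (X + 2) + 2) + (X * (X + 2) + 2)) + 2,
    fun G v k hk => (length_encodeRooted_le v hk).trans ?_⟩
  simp only [eval_add, eval_mul, eval_ofNat, eval_X]
  gcongr <;> omega

variable {F : FeatureTransformation} {T T' : ℕ → ℕ → ℕ}

theorem ComputableInTime.mono (hF : ComputableInTime F T) (hT : ∀ n k, T n k ≤ T' n k) :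
    ComputableInTime F T' :=
  let ⟨M, hM⟩ := hF
  ⟨M, fun G v k hk => (hM G v k hk).mono (hT _ _)⟩

theorem ComputableFromDagInTime.mono (hF : ComputableFromDagInTime F T)
    (hT : ∀ n k, T n k ≤ T' n k) : ComputableFromDagInTime F T' :=
  let ⟨M, hM⟩ := hF
  ⟨M, fun G v N k hk => (hM G v N k hk).mono (hT _ _)⟩

theorem exists_encodeDag_eq {s t : ℕ} (h : s = t) {c : Color s} {c' : Color t} (hc : c ≍ c')
    (N : Numbering (colorDag c)) :
    ∃ N' : Numbering (colorDag c'), encodeDag (colorDag c) N = encodeDag (colorDag c') N' := by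
  subst h
  obtain rfl := eq_of_heq hc
  exact ⟨N, rfl⟩

theorem ComputableFromDag.mpInvariant (hF : ComputableFromDag F) : MPInvariant F := by
  obtain ⟨M, hM⟩ := hF
  intro G H v w order_eq mpc_eq
  obtain ⟨N⟩ := nonempty_numbering (2 * G.order) v
  have finalColor_heq : finalColor G v ≍ finalColor H w := by
    have := v.pos
    rw [finalColor, finalColor, mpc_eq _ (by omega), order_eq]
  obtain ⟨N', encode_eq⟩ := exists_encodeDag_eq (by rw [order_eq]) finalColor_heq N
  have outputs := hM H w N'
  rw [← encode_eq] at outputs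
  exact (hM G v N).unique outputs

theorem polyTime_graphString_dagData :
    PolyTime fun I : List (List Bool) × List LevelMatrix × Unit => graphString I.1 I.2.1 :=
  polyTime_graphString (by fun_prop) (by fun_prop)

theorem polyTime_dagString_rootedData :
    PolyTime fun I : List Bool × List (List Bool) × List (List Bool) × Unit =>
      dagString I.1 I.2.1 I.2.2.1 :=
  polyTime_dagString (by fun_prop) (by fun_prop) (by fun_prop)

theorem MPInvariant.computableFromDag (hinv : MPInvariant F) (hF : IsComputable F) :
    ComputableFromDag F := by
  obtain ⟨P, q, hP⟩ := polyTime_graphString_dagData.exists_preprocess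
  obtain ⟨M, hM⟩ := hF
  refine ⟨P M, fun G v N => ?_⟩
  obtain ⟨H, w, order_eq, mpc_eq, -, string_eq⟩ := exists_graphString_eq N
  obtain ⟨m, outputs⟩ := outputs_iff_exists_outputsInTime.1 (hM H w)
  rw [← string_eq, hinv H G w v order_eq fun t _ => mpc_eq t] at outputs
  exact outputs_iff_exists_outputsInTime.2 ⟨_, hP _ _ (represents_encodeDag N) M _ m outputs⟩

theorem exists_computableFromDagInTime : ∃ p : Polynomial ℕ, ∀ F T, MPInvariant F →
    ComputableInTime F T → ComputableFromDagInTime F fun n k => T n k + p.eval (n + k) := by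
  obtain ⟨P, q, hP⟩ := polyTime_graphString_dagData.exists_preprocess
  obtain ⟨p, hp⟩ := exists_length_encodeDag_le
  refine ⟨q.comp p, fun F T hinv ⟨M, hM⟩ => ⟨P M, fun G v N k hk => ?_⟩⟩
  obtain ⟨H, w, order_eq, mpc_eq, bound, string_eq⟩ := exists_graphString_eq N
  have outputs := hM H w k (bound k hk)
  rw [← string_eq, hinv H G w v order_eq fun t _ => mpc_eq t, order_eq] at outputs
  refine (hP _ _ (represents_encodeDag N) M _ _ outputs).mono ?_
  simp only [Polynomial.eval_comp]
  exact Nat.add_le_add_left (eval_mono q (hp G v N k hk)) _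

theorem exists_computableInTime : ∃ p : Polynomial ℕ, ∀ F T, ComputableFromDagInTime F T →
    ComputableInTime F fun n k => T n k + p.eval (n + k) := by
  obtain ⟨P, q, hP⟩ := polyTime_dagString_rootedData.exists_preprocess
  obtain ⟨p, hp⟩ := exists_length_encodeRooted_le
  refine ⟨q.comp p, fun F T ⟨M, hM⟩ => ⟨P M, fun G v k hk => ?_⟩⟩
  have outputs := hM G v (nodeNumbering v (2 * G.order)) k hk
  rw [← dagString_eq] at outputs
  refine (hP _ _ (represents_encodeRooted G v) M _ _ outputs).mono ?_
  simp only [Polynomial.eval_comp]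
  exact Nat.add_le_add_left (eval_mono q (hp G v k hk)) _

end MsgPass

theorem mainTheorem2 :
    ∃ p : Polynomial ℕ,
      (∀ (G : MsgPass.FeaturedGraph) (v : Fin G.order)
        (N : MsgPass.Numbering (MsgPass.colorDag (MsgPass.finalColor G v))) (k : ℕ),
        MsgPass.FeatureBound G k →
          (MsgPass.encodeDag (MsgPass.colorDag (MsgPass.finalColor G v)) N).length
            ≤ p.eval (G.order + k)) ∧
      ∀ F : MsgPass.FeatureTransformation, MsgPass.IsComputable F →
        (MsgPass.MPInvariant F ↔ MsgPass.ComputableFromDag F) ∧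
        (MsgPass.MPInvariant F → ∀ T : ℕ → ℕ → ℕ, MsgPass.ComputableInTime F T →
          MsgPass.ComputableFromDagInTime F (fun n k => T n k + p.eval (n + k))) ∧
        (∀ T : ℕ → ℕ → ℕ, MsgPass.ComputableFromDagInTime F T →
          MsgPass.ComputableInTime F (fun n k => T n k + p.eval (n + k))) := by
  obtain ⟨p, length_le⟩ := MsgPass.exists_length_encodeDag_le
  obtain ⟨q, fromDag⟩ := MsgPass.exists_computableFromDagInTime
  obtain ⟨r, toDag⟩ := MsgPass.exists_computableInTime
  refine ⟨p + q + r, fun G v N k hk => (length_le G v N k hk).trans ?_, fun F hF =>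
    ⟨⟨fun hinv => hinv.computableFromDag hF, MsgPass.ComputableFromDag.mpInvariant⟩,
      fun hinv T hT => (fromDag F T hinv hT).mono fun n k => ?_,
      fun T hT => (toDag F T hT).mono fun n k => ?_⟩⟩
  all_goals simp only [Polynomial.eval_add]; omega
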